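/- Let $-\infty<a<b<\infty$, $n\in\mathbb N$, $J=\begin{pmatrix}0&-I\\ I&0\end{pmatrix}\in\mathbb C^{2n\times 2n}$, and let $H\in L^1((a,b),\mathbb C^{2n\times 2n})$ with $H(x)\ge 0$ for almost every $x$. Assume that $H$ is definite on $(a,b)$: if $v\in\mathbb C^{2n}$ and $H(x)v=0$ for almost every $x\in(a,b)$, then $v=0$. Let $\alpha,\beta\in\mathbb C^{n\times 2n}$ satisfy $\alpha\alpha^*=I=\beta\beta^*$ and $\alpha J\alpha^*=0=\beta J\beta^*$. Let $L^2_H(a,b)$ be the space of Borel functions $f:(a,b)\to\mathbb C^{2n}$ with $\int_a^b f^*Hf\,dx<\infty$, modulo functions of seminorm $0$, with $\langle f,g\rangle=\int_a^b f^*Hg\,dx$. Let $\mathcal S=\mathcal S^{\alpha,\beta}$ be the linear relation of all $(f,g)\in L^2_H(a,b)\oplus L^2_H(a,b)$ such that $f$ has a representative $f_0$, absolutely continuous on $[a,b]$, with $Jf_0'=-Hg$ almost everywhere and $\alpha f_0(a)=0=\beta f_0(b)$. Write $D(\mathcal S)=\{f:(f,g)\in\mathcal S\text{ for some }g\}$ and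 $\mathcal S(0)=\{g:(0,g)\in\mathcal S\}$; $t\in\mathbb R$ is an eigenvalue of $\mathcal S$ with eigenspace $\{h:(h,th)\in\mathcal S\}$ if this space is not $\{0\}$. For $z\in\mathbb C$ let $u(\cdot,z),v(\cdot,z):[a,b]\to\mathbb C^{2n\times n}$ be the absolutely continuous solutions of $Jw'=-zHw$ with $u(a,z)=-J\alpha^*$ and $v(a,z)=\alpha^*$. For $\operatorname{Im}z>0$ the matrix $\beta u(b,z)$ is invertible; put $m(z)=-(\beta u(b,z))^{-1}\beta v(b,z)$. Then $m$ has a Herglotz representation $$m(z)=A+Bz+\int_{-\infty}^{\infty}\Bigl(\frac1{t-z}-\frac{t}{t^2+1}\Bigr)\,d\rho(t)\qquad(\operatorname{Im}z>0)$$ with $A=A^*$, $B\ge0$ and $\rho$ a nonnegative $n\times n$ matrix valued Borel measure on $\mathbb R$ with $\int\frac{d\rho(t)}{1+t^2}<\infty$, and for every such representation the following hold. 1. For every $h\in L^2_H(a,b)$ the integral $$(Uh)(t)=\int_a^b u(x,t)^*H(x)h(x)\,dx$$ converges absolutely for every $t\in\mathbb R$, and it defines a linear map $U:L^2_H(a,b)\to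 L^2(\rho)$ that is a spectral representation of $\mathcal S$: $U$ maps $\overline{D(\mathcal S)}$ isometrically onto $L^2(\rho)$, $\ker U=\mathcal S(0)$, and $U\mathcal S U^*=M_t$ (as linear relations), where $M_t$ is the operator of multiplication by the variable in $L^2(\rho)$. 2. The set of eigenvalues of $\mathcal S$ has only finitely many elements in each bounded interval, and $\rho$ vanishes on its complement. For every eigenvalue $t_j$ the eigenspace is finite dimensional. If $\varphi_{jk}$, $k=1,\dots,M(j)$, is an orthonormal basis of this eigenspace, then there are $c_{jk}\in\mathbb C^n$ such that $\varphi_{jk}$ is represented by $u(\cdot,t_j)c_{jk}$, and for any such $c_{jk}$ $$\rho(\{t_j\})=\sum_{k=1}^{M(j)}c_{jk}c_{jk}^*.$$ -/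

import Mathlib

open MeasureTheory Matrix Set
open scoped ComplexOrder

noncomputable section

/-! ### The space `L²` of a nonnegative matrix weight -/

/-- A nonnegative matrix valued weight `W(x) dμ(x)` on `ℝ`. -/
structure MatrixWeight (ι : Type) [Fintype ι] where
  base : Measure ℝ
  density : ℝ → Matrix ι ι ℂ
  aemeasurable : ∀ i j, AEMeasurable (fun x => density x i j) base
  posSemidef : ∀ᵐ x ∂base, (density x).PosSemidef

namespace MatrixWeight

variable {ι : Type} [Fintype ι] (W : MatrixWeight ι)

/-- The function `x ↦ f(x)* W(x) g(x)`. -/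
def pairing (f g : ℝ → ι → ℂ) (x : ℝ) : ℂ := star (f x) ⬝ᵥ (W.density x *ᵥ g x)

theorem pairing_add_left (f g h : ℝ → ι → ℂ) :
    W.pairing (f + g) h = W.pairing f h + W.pairing g h := by
  funext x
  simp [pairing, add_dotProduct]

theorem pairing_add_right (f g h : ℝ → ι → ℂ) :
    W.pairing f (g + h) = W.pairing f g + W.pairing f h := by
  funext x
  simp [pairing, mulVec_add, dotProduct_add]

theorem pairing_smul_left (c : ℂ) (f g : ℝ → ι → ℂ) :
    W.pairing (c • f) g = star c • W.pairing f g := by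
  funext x
  simp [pairing]

theorem pairing_smul_right (c : ℂ) (f g : ℝ → ι → ℂ) :
    W.pairing f (c • g) = c • W.pairing f g := by
  funext x
  simp [pairing, mulVec_smul]

theorem aemeasurable_pairing {f g : ℝ → ι → ℂ} (hf : Measurable f) (hg : Measurable g) :
    AEMeasurable (W.pairing f g) W.base := by
  have : W.pairing f g = fun x => ∑ i, star (f x i) * ∑ j, W.density x i j * g x j := by
    funext x
    simp [pairing, dotProduct, mulVec]
  rw [this]
  refine Finset.aemeasurable_fun_sum _ fun i _ => ?_
  refine AEMeasurable.mul ?_ (Finset.aemeasurable_fun_sum _ fun j _ => ?_)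
  · exact (continuous_star.measurable.comp ((measurable_pi_apply i).comp hf)).aemeasurable
  · exact (W.aemeasurable i j).mul ((measurable_pi_apply j).comp hg).aemeasurable

theorem star_pairing (f g : ℝ → ι → ℂ) :
    ∀ᵐ x ∂W.base, star (W.pairing f g x) = W.pairing g f x := by
  filter_upwards [W.posSemidef] with x hx
  simp only [pairing]
  rw [star_dotProduct, star_star, star_mulVec, hx.isHermitian.eq, ← dotProduct_mulVec]

theorem pairing_self_nonneg (f : ℝ → ι → ℂ) : ∀ᵐ x ∂W.base, 0 ≤ W.pairing f f x := by
  filter_upwards [W.posSemidef] with x hx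
  exact hx.dotProduct_mulVec_nonneg _

theorem norm_pairing_le (f g : ℝ → ι → ℂ) :
    ∀ᵐ x ∂W.base, ‖W.pairing f g x‖ ≤ ‖W.pairing f f x + W.pairing g g x‖ := by
  filter_upwards [W.posSemidef, W.star_pairing f g, W.pairing_self_nonneg f,
    W.pairing_self_nonneg g] with x hx hs hf hg
  obtain ⟨c, hc, hcz⟩ : ∃ c : ℂ, ‖c‖ = 1 ∧ c * W.pairing f g x = -(‖W.pairing f g x‖ : ℂ) := by
    by_cases h0 : W.pairing f g x = 0
    · exact ⟨1, by simp, by simp [h0]⟩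
    · have hn : (‖W.pairing f g x‖ : ℂ) ≠ 0 := by simpa using h0
      refine ⟨-(star (W.pairing f g x) / ‖W.pairing f g x‖), ?_, ?_⟩
      · rw [norm_neg, norm_div, norm_star, Complex.norm_real, norm_norm,
          div_self (norm_ne_zero_iff.mpr h0)]
      · have : star (W.pairing f g x) * W.pairing f g x = (‖W.pairing f g x‖ : ℂ) ^ 2 := by
          simpa using Complex.conj_mul' (W.pairing f g x)
        rw [neg_mul, div_mul_eq_mul_div, this, sq, mul_div_assoc, div_self hn, mul_one]
  have hpos := hx.dotProduct_mulVec_nonneg (f x + c • g x)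
  have hexp : star (f x + c • g x) ⬝ᵥ (W.density x *ᵥ (f x + c • g x)) =
      W.pairing f f x + W.pairing g g x - 2 * (‖W.pairing f g x‖ : ℂ) := by
    have e1 : star (f x + c • g x) ⬝ᵥ (W.density x *ᵥ (f x + c • g x)) =
        W.pairing f f x + c * W.pairing f g x + star (c * W.pairing f g x)
          + (star c * c) * W.pairing g g x := by
      rw [star_mul, hs]
      simp only [pairing, star_add, star_smul, mulVec_add, mulVec_smul, dotProduct_add,
        add_dotProduct, smul_dotProduct, dotProduct_smul, smul_eq_mul]
      ring
    have e2 : star c * c = 1 := by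
      have := Complex.conj_mul' c
      rw [hc] at this
      simpa using this
    rw [e1, e2, hcz]
    simp
    ring
  rw [hexp] at hpos
  have hsum := add_nonneg hf hg
  have h1 : ((‖W.pairing f f x + W.pairing g g x‖ : ℝ) : ℂ) =
      W.pairing f f x + W.pairing g g x := Complex.norm_of_nonneg' hsum
  rw [← h1] at hpos
  have h2 : (0 : ℝ) ≤ ‖W.pairing f f x + W.pairing g g x‖ - 2 * ‖W.pairing f g x‖ := by
    exact_mod_cast hpos
  nlinarith [norm_nonneg (W.pairing f g x)]

/-- Borel functions `f` with `∫ f* W f dμ < ∞`. -/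
def sqIntegrable : Submodule ℂ (ℝ → ι → ℂ) where
  carrier := {f | Measurable f ∧ Integrable (W.pairing f f) W.base}
  zero_mem' := ⟨measurable_const, by
    have : W.pairing (0 : ℝ → ι → ℂ) 0 = fun _ => 0 := by funext x; simp [pairing]
    rw [this]; exact integrable_zero _ _ _⟩
  add_mem' := by
    rintro f g ⟨hf, hf'⟩ ⟨hg, hg'⟩
    refine ⟨hf.add hg, ?_⟩
    have h1 : Integrable (W.pairing f g) W.base :=
      (hf'.add hg').mono (W.aemeasurable_pairing hf hg).aestronglyMeasurable
        (W.norm_pairing_le f g)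
    have h2 : Integrable (W.pairing g f) W.base :=
      (hg'.add hf').mono (W.aemeasurable_pairing hg hf).aestronglyMeasurable
        (W.norm_pairing_le g f)
    rw [W.pairing_add_left, W.pairing_add_right, W.pairing_add_right]
    exact (hf'.add h1).add (h2.add hg')
  smul_mem' := by
    rintro c f ⟨hf, hf'⟩
    refine ⟨hf.const_smul c, ?_⟩
    rw [W.pairing_smul_left, W.pairing_smul_right]
    exact (hf'.smul c).smul (star c)

/-- The space of square integrable functions, before identifying functions at distance `0`. -/
def PreL2 : Type := W.sqIntegrable

instance : AddCommGroup W.PreL2 := inferInstanceAs (AddCommGroup W.sqIntegrable)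

instance : Module ℂ W.PreL2 := inferInstanceAs (Module ℂ W.sqIntegrable)

instance : CoeFun W.PreL2 fun _ => ℝ → ι → ℂ := ⟨fun f => f.1⟩

theorem integrable_pairing (f g : W.PreL2) : Integrable (W.pairing f g) W.base :=
  (f.2.2.add g.2.2).mono (W.aemeasurable_pairing f.2.1 g.2.1).aestronglyMeasurable
    (W.norm_pairing_le f g)

/-- The semi-inner product `⟨f, g⟩ = ∫ f* W g dμ`. -/
instance preCore : PreInnerProductSpace.Core ℂ W.PreL2 where
  inner f g := ∫ x, W.pairing f g x ∂W.base
  conj_inner_symm f g := by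
    rw [← integral_conj]
    exact integral_congr_ae (W.star_pairing g f)
  re_inner_nonneg f := by
    have h : 0 ≤ ∫ x, (W.pairing f f x).re ∂W.base :=
      integral_nonneg_of_ae ((W.pairing_self_nonneg f).mono fun x hx => (Complex.le_def.1 hx).1)
    have e : ∫ x, (W.pairing f f x).re ∂W.base = (∫ x, W.pairing f f x ∂W.base).re :=
      integral_re (W.integrable_pairing f f)
    rw [e] at h
    exact h
  add_left f g h := by
    have : W.pairing (f + g : W.PreL2) h = W.pairing f h + W.pairing g h :=
      W.pairing_add_left f g h
    rw [this]
    exact integral_add (W.integrable_pairing f h) (W.integrable_pairing g h)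
  smul_left f g c := by
    have : W.pairing (c • f : W.PreL2) g = star c • W.pairing f g :=
      W.pairing_smul_left c f g
    rw [this]
    exact integral_smul (star c) _

instance : SeminormedAddCommGroup W.PreL2 :=
  InnerProductSpace.Core.toSeminormedAddCommGroup (𝕜 := ℂ)

instance : InnerProductSpace ℂ W.PreL2 := InnerProductSpace.ofCore W.preCore

/-- The inner product space `L²(W dμ)`: square integrable functions modulo functions of
seminorm `0`. -/
abbrev L2 : Type := SeparationQuotient W.PreL2

/-- The class in `L²(W dμ)` of a square integrable function. -/
def toL2 (f : W.PreL2) : W.L2 := SeparationQuotient.mk f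

end MatrixWeight

/-- A nonnegative `n × n` matrix valued Borel measure `ρ` on `ℝ`, finite on bounded sets. It is
given by its trace measure `τ = tr ρ` and its density with respect to it, `dρ = W dτ` with
`W ≥ 0` and `tr W = 1`; by the Radon-Nikodym theorem every such `ρ` has exactly one such form
(with `W` determined `τ`-almost everywhere). `L²(ρ)` is then `L²(W dτ)`. -/
structure MatrixMeasure (n : ℕ) extends MatrixWeight (Fin n) where
  locallyFinite : IsLocallyFiniteMeasure base
  trace_eq_one : ∀ᵐ t ∂base, (density t).trace = 1

/-- The value `ρ(B) = ∫_B W dτ`, for a bounded Borel set `B`. -/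
def MatrixMeasure.value {n : ℕ} (ρ : MatrixMeasure n) (B : Set ℝ) : Matrix (Fin n) (Fin n) ℂ :=
  Matrix.of fun i j => ∫ t in B, ρ.density t i j ∂ρ.base

/-! ### Linear relations and spectral representations -/

namespace LinearRel

variable {E F G : Type*} [AddCommGroup E] [Module ℂ E] [AddCommGroup F] [Module ℂ F]
  [AddCommGroup G] [Module ℂ G]

/-- The domain of a relation. -/
def dom (R : Submodule ℂ (E × F)) : Submodule ℂ E := R.map (LinearMap.fst ℂ E F)

/-- The multivalued part of a relation. -/
def multivaluedPart (R : Submodule ℂ (E × F)) : Submodule ℂ F := R.comap (LinearMap.inr ℂ E F)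

/-- The product `S R = {(f, h) | (f, g) ∈ R and (g, h) ∈ S for some g}`. -/
def comp (S : Submodule ℂ (F × G)) (R : Submodule ℂ (E × F)) : Submodule ℂ (E × G) where
  carrier := {p | ∃ g, (p.1, g) ∈ R ∧ (g, p.2) ∈ S}
  zero_mem' := ⟨0, R.zero_mem, S.zero_mem⟩
  add_mem' := by
    rintro p q ⟨g, h1, h2⟩ ⟨g', h1', h2'⟩
    exact ⟨g + g', R.add_mem h1 h1', S.add_mem h2 h2'⟩
  smul_mem' := by
    rintro c p ⟨g, h1, h2⟩
    exact ⟨c • g, R.smul_mem c h1, S.smul_mem c h2⟩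

/-- The eigenspace `ker (R - t) = {h | (h, t h) ∈ R}`. -/
def eigenspace (R : Submodule ℂ (E × E)) (t : ℂ) : Submodule ℂ E :=
  R.comap (LinearMap.prod LinearMap.id (t • LinearMap.id))

/-- The set of real eigenvalues of a relation. -/
def eigenvalues (R : Submodule ℂ (E × E)) : Set ℝ := {t | eigenspace R t ≠ ⊥}

end LinearRel

/-- The relation of multiplication by the variable in `L²(W dμ)`. -/
def MatrixWeight.mulVar {ι : Type} [Fintype ι] (W : MatrixWeight ι) :
    Submodule ℂ (W.L2 × W.L2) where
  carrier := {p | ∃ F G : W.PreL2, W.toL2 F = p.1 ∧ W.toL2 G = p.2 ∧ ∀ t : ℝ, G t = (t : ℂ) • F t}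
  zero_mem' := ⟨0, 0, rfl, rfl, fun t => (smul_zero (t : ℂ)).symm⟩
  add_mem' := by
    rintro p q ⟨F, G, h1, h2, h3⟩ ⟨F', G', h1', h2', h3'⟩
    refine ⟨F + F', G + G', ?_, ?_, fun t => ?_⟩
    · rw [Prod.fst_add, ← h1, ← h1']; rfl
    · rw [Prod.snd_add, ← h2, ← h2']; rfl
    · change G t + G' t = (t : ℂ) • (F t + F' t)
      rw [h3, h3', smul_add]
  smul_mem' := by
    rintro c p ⟨F, G, h1, h2, h3⟩
    refine ⟨c • F, c • G, ?_, ?_, fun t => ?_⟩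
    · rw [Prod.smul_fst, ← h1]; rfl
    · rw [Prod.smul_snd, ← h2]; rfl
    · change c • G t = (t : ℂ) • (c • F t)
      rw [h3, smul_comm]

/-- `U` is a spectral representation of the relation `S` in `L²(ρ)`: it maps the closure of the
domain of `S` isometrically onto `L²(ρ)`, its kernel is the multivalued part of `S`, and
`U S U* = M_t`, where `M_t` is multiplication by the variable in `L²(ρ)`. The adjoint
and the products are those of linear relations. -/
structure IsSpectralRepresentation {E : Type*} [NormedAddCommGroup E] [InnerProductSpace ℂ E]
    {n : ℕ} (S : Submodule ℂ (E × E)) (ρ : MatrixMeasure n) (U : E →ₗ[ℂ] ρ.L2) : Prop where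
  isometry : ∀ h ∈ closure (LinearRel.dom S : Set E), ‖U h‖ = ‖h‖
  surjOn : SurjOn U (closure (LinearRel.dom S : Set E)) univ
  ker_eq : LinearMap.ker U = LinearRel.multivaluedPart S
  conj_eq : LinearRel.comp U.graph (LinearRel.comp S U.graph.adjoint) = ρ.mulVar

/-! ### Regular canonical systems -/

/-- The coefficient of a regular canonical system `J u' = -z H u` of order `2n` on a bounded
interval `(a, b)`: `H ∈ L¹(a, b)` and `H(x) ≥ 0` for almost every `x`. -/
structure RegularCanonicalSystem (n : ℕ) (a b : ℝ) where
  H : ℝ → Matrix (Fin n ⊕ Fin n) (Fin n ⊕ Fin n) ℂ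
  integrable : ∀ i j, IntegrableOn (fun x => H x i j) (Ioo a b)
  posSemidef : ∀ᵐ x ∂volume.restrict (Ioo a b), (H x).PosSemidef

namespace RegularCanonicalSystem

variable {n : ℕ} {a b : ℝ} (𝓢 : RegularCanonicalSystem n a b)

/-- Definiteness on `(a, b)`. -/
def IsDefinite : Prop :=
  ∀ v : Fin n ⊕ Fin n → ℂ, (∀ᵐ x ∂volume.restrict (Ioo a b), 𝓢.H x *ᵥ v = 0) → v = 0

/-- The weight `H(x) dx` on `(a, b)`, so that `𝓢.weight.L2` is `L²_H(a, b)`. -/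
def weight : MatrixWeight (Fin n ⊕ Fin n) where
  base := volume.restrict (Ioo a b)
  density := 𝓢.H
  aemeasurable i j := (𝓢.integrable i j).aemeasurable
  posSemidef := 𝓢.posSemidef

/-- `f` is absolutely continuous on `[a, b]` and `J f' = -H g` almost everywhere. -/
def Solves (f g : ℝ → Fin n ⊕ Fin n → ℂ) : Prop :=
  AbsolutelyContinuousOnInterval f a b ∧
    ∀ᵐ x ∂volume.restrict (Ioo a b), ∃ f' : Fin n ⊕ Fin n → ℂ,
      HasDerivAt f f' x ∧ Matrix.J (Fin n) ℂ *ᵥ f' = -(𝓢.H x *ᵥ g x)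

theorem Solves.add {f g f' g' : ℝ → Fin n ⊕ Fin n → ℂ} (h : 𝓢.Solves f g)
    (h' : 𝓢.Solves f' g') : 𝓢.Solves (f + f') (g + g') := by
  refine ⟨h.1.add h'.1, ?_⟩
  filter_upwards [h.2, h'.2] with x ⟨d, hd, e⟩ ⟨d', hd', e'⟩
  refine ⟨d + d', hd.add hd', ?_⟩
  rw [mulVec_add, e, e', Pi.add_apply, mulVec_add, neg_add]

theorem Solves.smul (c : ℂ) {f g : ℝ → Fin n ⊕ Fin n → ℂ} (h : 𝓢.Solves f g) :
    𝓢.Solves (c • f) (c • g) := by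
  refine ⟨h.1.const_smul c, ?_⟩
  filter_upwards [h.2] with x ⟨d, hd, e⟩
  refine ⟨c • d, hd.const_smul c, ?_⟩
  rw [mulVec_smul, e, Pi.smul_apply, mulVec_smul, smul_neg]

/-- The relation `S^{α,β}` in `L²_H(a, b)`: all `(f, g)` such that `f` has an absolutely
continuous representative `f₀` with `J f₀' = -H g`, `α f₀(a) = 0` and `β f₀(b) = 0`. -/
def relation (α β : Matrix (Fin n) (Fin n ⊕ Fin n) ℂ) :
    Submodule ℂ (𝓢.weight.L2 × 𝓢.weight.L2) where
  carrier := {p | ∃ f₀ g : 𝓢.weight.PreL2, 𝓢.weight.toL2 f₀ = p.1 ∧ 𝓢.weight.toL2 g = p.2 ∧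
    𝓢.Solves f₀ g ∧ α *ᵥ f₀ a = 0 ∧ β *ᵥ f₀ b = 0}
  zero_mem' := by
    refine ⟨0, 0, rfl, rfl, ⟨?_, ?_⟩, mulVec_zero α, mulVec_zero β⟩
    · have : AbsolutelyContinuousOnInterval (fun _ : ℝ => (0 : Fin n ⊕ Fin n → ℂ)) a b := by
        simpa [AbsolutelyContinuousOnInterval] using tendsto_const_nhds
      exact this
    · refine Filter.Eventually.of_forall fun x => ⟨0, hasDerivAt_const x 0, ?_⟩
      change _ = -(𝓢.H x *ᵥ (0 : Fin n ⊕ Fin n → ℂ))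
      simp
  add_mem' := by
    rintro p q ⟨f, g, h1, h2, h3, h4, h5⟩ ⟨f', g', h1', h2', h3', h4', h5'⟩
    refine ⟨f + f', g + g', ?_, ?_, h3.add 𝓢 h3', ?_, ?_⟩
    · rw [Prod.fst_add, ← h1, ← h1']; rfl
    · rw [Prod.snd_add, ← h2, ← h2']; rfl
    · change α *ᵥ (f a + f' a) = 0
      rw [mulVec_add, h4, h4', add_zero]
    · change β *ᵥ (f b + f' b) = 0
      rw [mulVec_add, h5, h5', add_zero]
  smul_mem' := by
    rintro c p ⟨f, g, h1, h2, h3, h4, h5⟩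
    refine ⟨c • f, c • g, ?_, ?_, h3.smul 𝓢 c, ?_, ?_⟩
    · rw [Prod.smul_fst, ← h1]; rfl
    · rw [Prod.smul_snd, ← h2]; rfl
    · change α *ᵥ (c • f a) = 0
      rw [mulVec_smul, h4, smul_zero]
    · change β *ᵥ (c • f b) = 0
      rw [mulVec_smul, h5, smul_zero]

/-- The solution of `J w' = -z H w` on `[a, b]` with `w(a) = c` (it exists and is unique). -/
def solution (z : ℂ) (c : Fin n ⊕ Fin n → ℂ) : ℝ → Fin n ⊕ Fin n → ℂ :=
  Classical.epsilon fun w => 𝓢.Solves w (z • w) ∧ w a = c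

/-- The matrix solution `X(x, z)` with `X(a, z) = C`. -/
def matrixSolution (z : ℂ) (C : Matrix (Fin n ⊕ Fin n) (Fin n) ℂ) (x : ℝ) :
    Matrix (Fin n ⊕ Fin n) (Fin n) ℂ :=
  Matrix.of fun i k => 𝓢.solution z (fun l => C l k) x i

/-- The solution `u(x, z)` with `u(a, z) = -J α*`. -/
def u (α : Matrix (Fin n) (Fin n ⊕ Fin n) ℂ) (x : ℝ) (z : ℂ) : Matrix (Fin n ⊕ Fin n) (Fin n) ℂ :=
  𝓢.matrixSolution z (-(Matrix.J (Fin n) ℂ * αᴴ)) x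

/-- The solution `v(x, z)` with `v(a, z) = α*`. -/
def v (α : Matrix (Fin n) (Fin n ⊕ Fin n) ℂ) (x : ℝ) (z : ℂ) : Matrix (Fin n ⊕ Fin n) (Fin n) ℂ :=
  𝓢.matrixSolution z αᴴ x

/-- The `m` function `m(z) = -(β u(b, z))⁻¹ β v(b, z)`: the matrix for which `v + u m` satisfies
the boundary condition `β` at `b`. -/
def mFunction (α β : Matrix (Fin n) (Fin n ⊕ Fin n) ℂ) (z : ℂ) : Matrix (Fin n) (Fin n) ℂ :=
  -((β * 𝓢.u α b z)⁻¹ * (β * 𝓢.v α b z))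

/-- The integrand `x ↦ u(x, t)* H(x) h(x)` of the transform `U`. -/
def transformIntegrand (α : Matrix (Fin n) (Fin n ⊕ Fin n) ℂ) (h : ℝ → Fin n ⊕ Fin n → ℂ)
    (t x : ℝ) : Fin n → ℂ :=
  (𝓢.u α x t)ᴴ *ᵥ (𝓢.H x *ᵥ h x)

/-- The element `φ` of `L²_H(a, b)` is represented by `x ↦ u(x, t) c`. -/
def IsRepresentedBy (α : Matrix (Fin n) (Fin n ⊕ Fin n) ℂ) (t : ℝ) (φ : 𝓢.weight.L2)
    (c : Fin n → ℂ) : Prop :=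
  ∃ f : 𝓢.weight.PreL2, 𝓢.weight.toL2 f = φ ∧ ∀ x ∈ Icc a b, f x = 𝓢.u α x t *ᵥ c

end RegularCanonicalSystem

/-- A boundary condition: `α α* = I` and `α J α* = 0`. -/
def IsBoundaryCondition {n : ℕ} (α : Matrix (Fin n) (Fin n ⊕ Fin n) ℂ) : Prop :=
  α * αᴴ = 1 ∧ α * Matrix.J (Fin n) ℂ * αᴴ = 0

/-- `m(z) = A + B z + ∫ (1/(t - z) - t/(t² + 1)) dρ(t)` on the upper half plane, with `A = A*`,
`B ≥ 0` and `∫ dρ(t)/(1 + t²) < ∞` (equivalently, the trace measure has this property). -/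
structure IsHerglotzRepresentation {n : ℕ} (m : ℂ → Matrix (Fin n) (Fin n) ℂ)
    (A B : Matrix (Fin n) (Fin n) ℂ) (ρ : MatrixMeasure n) : Prop where
  hermitian : A.IsHermitian
  posSemidef : B.PosSemidef
  integrable : Integrable (fun t : ℝ => 1 / (1 + t ^ 2)) ρ.base
  eq : ∀ z : ℂ, 0 < z.im → ∀ i j, m z i j = A i j + B i j * z +
    ∫ t : ℝ, (1 / ((t : ℂ) - z) - (t : ℂ) / ((t : ℂ) ^ 2 + 1)) * ρ.density t i j ∂ρ.base

end

section

open Filter Topology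

/-! ### Absolutely continuous functions with values in a normed space -/

section AbsolutelyContinuous

variable {F : Type*} [NormedAddCommGroup F] [NormedSpace ℝ F]

/-! The system is a linear Volterra equation with integrable coefficient, so its solutions are
Neumann series, entire in the spectral parameter. Green's formula together with the Lagrangian
boundary conditions makes the relation S symmetric. A kernel vector of βu(b,z) would yield an
eigenfunction, nonzero by definiteness, so this matrix is invertible off the real axis. By the
identity theorem its determinant has only isolated zeros, and some real t₀ is not one of them.
Variation by u(·,t₀)c then solves every inhomogeneous boundary value problem, and Arzelà–Ascoli
makes R = (S − t₀)⁻¹ compact. R is symmetric with kernel S(0), so the eigenvectors of S, all of the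
form u(·,t)c, span a dense subspace of the complement of S(0) (`exists_hasCompactResolvent`,
`mem_multivaluedPart_of_forall_inner`).

The spectral measure comes from the Weyl solutions χ(z) = v + um. Green's formula evaluates two
inner products: (w − z̄)⟨χ(z)c, χ(w)d⟩ = c*m(w)d − (m(z)c)*d, and (t − w)⟨u(·,t)c, χ(w)d⟩ = c*d for
an eigenfunction u(·,t)c. The component of χ(w)d in S(0) does not depend on w. Parseval's identity
for χ(i) and χ(z) is therefore a Herglotz representation of m: the measure has masses Σ cc* at the
eigenvalues, B is the Gram matrix of the S(0)-components and A is the Hermitian part of m(i)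
(`exists_hasSum_inner_weylL2`, `exists_hasSum_herglotzKernel`).

Every other representation has the same measure in the sense needed. Its point masses are limits of
−iεm(t + iε), and comparing the imaginary parts of the traces bounds the mass of an interval of
radius ε off the spectrum by Cε², which forces mass zero there (`value_singleton_eq`,
`base_compl_eq_zero`).

Finally, the norm of F in L²(ρ) is given by the numbers c*F(t), and c*(Uh)(t) = ⟨u(·,t)c, h⟩. Thus U
lists the Fourier coefficients of h in the eigenvectors, and its properties are those of an
eigenvector expansion (`isSpectralRepresentation`). -/

theorem AbsolutelyContinuousOnInterval.of_dist_le {X Y : Type*} [PseudoMetricSpace X]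
    [PseudoMetricSpace Y] {f : ℝ → X} {g : ℝ → Y} {a b : ℝ}
    (hg : AbsolutelyContinuousOnInterval g a b)
    (h : ∀ x ∈ uIcc a b, ∀ y ∈ uIcc a b, dist (f x) (f y) ≤ dist (g x) (g y)) :
    AbsolutelyContinuousOnInterval f a b := by
  rw [absolutelyContinuousOnInterval_iff] at hg ⊢
  intro ε hε
  obtain ⟨δ, hδ, H⟩ := hg ε hε
  refine ⟨δ, hδ, fun E hE hE' => lt_of_le_of_lt (Finset.sum_le_sum fun i hi => ?_) (H E hE hE')⟩
  exact h _ (hE.1 i hi).1 _ (hE.1 i hi).2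

theorem absolutelyContinuousOnInterval_const {X : Type*} [PseudoMetricSpace X] (c : X) (a b : ℝ) :
    AbsolutelyContinuousOnInterval (fun _ => c) a b := by
  simpa [AbsolutelyContinuousOnInterval] using tendsto_const_nhds

theorem AbsolutelyContinuousOnInterval.congr {X : Type*} [PseudoMetricSpace X] {f g : ℝ → X}
    {a b : ℝ} (hf : AbsolutelyContinuousOnInterval f a b) (h : EqOn f g (uIcc a b)) :
    AbsolutelyContinuousOnInterval g a b :=
  hf.of_dist_le fun x hx y hy => by rw [h hx, h hy]

theorem AbsolutelyContinuousOnInterval.pow {f : ℝ → ℝ} {a b : ℝ}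
    (hf : AbsolutelyContinuousOnInterval f a b) (k : ℕ) :
    AbsolutelyContinuousOnInterval (fun x => f x ^ k) a b := by
  induction k with
  | zero => simpa using absolutelyContinuousOnInterval_const (1 : ℝ) a b
  | succ k ih => simp only [pow_succ]; exact ih.mul hf

/-- The increments are dominated by those of the scalar primitive of the norm. -/
theorem IntervalIntegrable.absolutelyContinuousOnInterval_primitive {f : ℝ → F} {a b : ℝ}
    (h : IntervalIntegrable f volume a b) :
    AbsolutelyContinuousOnInterval (fun x => ∫ v in a..x, f v) a b := by
  refine (h.norm.absolutelyContinuousOnInterval_intervalIntegral left_mem_uIcc).of_dist_le ?_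
  intro x hx y hy
  have hi : ∀ z ∈ uIcc a b, IntervalIntegrable f volume a z := fun z hz =>
    h.mono_set (uIcc_subset_uIcc left_mem_uIcc hz)
  rw [dist_comm, dist_comm (∫ v in a..x, ‖f v‖), dist_eq_norm, dist_eq_norm,
    intervalIntegral.integral_interval_sub_left (hi y hy) (hi x hx),
    intervalIntegral.integral_interval_sub_left (hi y hy).norm (hi x hx).norm]
  exact intervalIntegral.norm_integral_le_abs_integral_norm

/-- Subtracting the primitive of f' leaves an absolutely continuous function with derivative zero
almost everywhere, hence a constant. -/
theorem AbsolutelyContinuousOnInterval.eq_add_integral [CompleteSpace F] {f f' : ℝ → F} {a b : ℝ} (hab : a ≤ b)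
    (hf : AbsolutelyContinuousOnInterval f a b)
    (hd : ∀ᵐ x ∂volume.restrict (Ioo a b), HasDerivAt f (f' x) x)
    (hi : IntervalIntegrable f' volume a b) :
    ∀ x ∈ Icc a b, f x = f a + ∫ s in a..x, f' s := by
  have hg := hf.sub (hi.absolutelyContinuousOnInterval_primitive)
  rw [Measure.restrict_congr_set Ioo_ae_eq_Icc, ae_restrict_iff' measurableSet_Icc] at hd
  obtain ⟨C, hC⟩ := hg.const_of_ae_hasDerivAt_zero (by
    filter_upwards [hd, hi.ae_hasDerivAt_integral] with x h1 h2 hx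
    have := (h1 (by rwa [uIcc_of_le hab] at hx)).sub (h2 hx a left_mem_uIcc)
    rwa [sub_self] at this)
  rw [uIcc_of_le hab] at hC
  intro x hx
  have e1 := hC x hx
  have e2 := hC a (left_mem_Icc.2 hab)
  simp only [Pi.sub_apply, intervalIntegral.integral_same, sub_zero] at e1 e2
  rw [e2, ← e1, sub_add_cancel]

end AbsolutelyContinuous

/-! ### Linear Volterra equations -/

section Volterra

variable {V : Type*} [NormedAddCommGroup V] [NormedSpace ℂ V]
  {A : ℝ → V →L[ℂ] V} {a b : ℝ}

/-- The Volterra operator `w ↦ ∫ₐˣ A(s) w(s) ds`. -/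
noncomputable def volterra (A : ℝ → V →L[ℂ] V) (a : ℝ) (w : ℝ → V) (x : ℝ) : V :=
  ∫ s in a..x, A s (w s)

/-- The solution of `w = w₀ + z ∫ₐˣ A w`, as a Neumann series. -/
noncomputable def volterraSolution (A : ℝ → V →L[ℂ] V) (a : ℝ) (z : ℂ) (w₀ : ℝ → V) (x : ℝ) : V :=
  ∑' k : ℕ, z ^ k • (volterra A a)^[k] w₀ x

theorem IntervalIntegrable.clm_apply_continuousOn (hA : IntervalIntegrable A volume a b)
    (hab : a ≤ b) {w : ℝ → V} (hw : ContinuousOn w (Icc a b)) :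
    IntervalIntegrable (fun s => A s (w s)) volume a b := by
  obtain ⟨C, hC⟩ := isCompact_Icc.exists_bound_of_continuousOn hw
  rw [intervalIntegrable_iff_integrableOn_Icc_of_le hab] at hA ⊢
  refine (hA.norm.mul_const C).mono' ?_ ?_
  · exact (ContinuousLinearMap.id ℂ (V →L[ℂ] V)).aestronglyMeasurable_comp₂
      hA.aestronglyMeasurable (hw.aestronglyMeasurable measurableSet_Icc)
  · filter_upwards [ae_restrict_mem measurableSet_Icc] with x hx
    exact (A x).le_opNorm_of_le (hC x hx)

theorem IntervalIntegrable.mono_right {E : Type*} [NormedAddCommGroup E] {f : ℝ → E}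
    (hf : IntervalIntegrable f volume a b) {x : ℝ} (hx : x ∈ Icc a b) :
    IntervalIntegrable f volume a x :=
  hf.mono_set (uIcc_subset_uIcc left_mem_uIcc (Icc_subset_uIcc hx))

theorem continuousOn_volterra (hA : IntervalIntegrable A volume a b) (hab : a ≤ b) {w : ℝ → V}
    (hw : ContinuousOn w (Icc a b)) : ContinuousOn (volterra A a w) (Icc a b) := by
  have := ((hA.clm_apply_continuousOn hab hw).absolutelyContinuousOnInterval_primitive).continuousOn
  rwa [uIcc_of_le hab] at this

theorem continuousOn_iterate_volterra (hA : IntervalIntegrable A volume a b) (hab : a ≤ b)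
    {w : ℝ → V} (hw : ContinuousOn w (Icc a b)) (k : ℕ) :
    ContinuousOn ((volterra A a)^[k] w) (Icc a b) := by
  induction k with
  | zero => exact hw
  | succ k ih => rw [Function.iterate_succ_apply']; exact continuousOn_volterra hA hab ih

/-- With K the primitive of κ, the power K^(k+1) is absolutely continuous with derivative (k+1)κK^k
almost everywhere. This is the source of the factorials that make the Neumann series converge for
merely integrable coefficients. -/
theorem integral_mul_primitive_pow {κ : ℝ → ℝ} (hab : a ≤ b) (hκ : IntervalIntegrable κ volume a b)
    (k : ℕ) : ∫ s in a..b, κ s * (∫ r in a..s, κ r) ^ k =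
      (∫ r in a..b, κ r) ^ (k + 1) / (k + 1) := by
  have hK := hκ.absolutelyContinuousOnInterval_primitive
  have hc : ContinuousOn (fun s => ∫ r in a..s, κ r) (uIcc a b) := hK.continuousOn
  have h1 := (hK.pow (k + 1)).eq_add_integral hab
    (f' := fun s => (k + 1 : ℝ) * (κ s * (∫ r in a..s, κ r) ^ k)) (by
      have := hκ.ae_hasDerivAt_integral
      rw [ae_restrict_iff' measurableSet_Ioo]
      filter_upwards [this] with x hx hx'
      have := (hx (Icc_subset_uIcc (Ioo_subset_Icc_self hx')) a left_mem_uIcc).pow (k + 1)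
      convert! this using 1
      push_cast
      ring)
    ((hκ.mul_continuousOn (hc.pow k)).const_mul _) b (right_mem_Icc.2 hab)
  simp only [intervalIntegral.integral_same, intervalIntegral.integral_const_mul] at h1
  have : (k + 1 : ℝ) ≠ 0 := by positivity
  rw [eq_div_iff this, mul_comm, h1]
  simp

theorem norm_volterra_le (hA : IntervalIntegrable A volume a b) {w : ℝ → V} {C : ℝ} {k : ℕ}
    (hw : ∀ x ∈ Icc a b, ‖w x‖ ≤ C * (∫ r in a..x, ‖A r‖) ^ k / k.factorial) :
    ∀ x ∈ Icc a b, ‖volterra A a w x‖ ≤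
      C * (∫ r in a..x, ‖A r‖) ^ (k + 1) / (k + 1).factorial := by
  intro x hx
  have hAx := hA.mono_right hx
  have hc : ContinuousOn (fun s => ∫ r in a..s, ‖A r‖) (uIcc a x) :=
    (hAx.norm.absolutelyContinuousOnInterval_primitive).continuousOn
  have hi : IntervalIntegrable (fun s => (C / k.factorial) * (‖A s‖ * (∫ r in a..s, ‖A r‖) ^ k))
      volume a x := (hAx.norm.mul_continuousOn (hc.pow k)).const_mul _
  have := intervalIntegral.norm_integral_le_of_norm_le hx.1 (f := fun s => A s (w s)) (by
    refine Eventually.of_forall fun s hs => ?_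
    refine ((A s).le_opNorm_of_le (hw s ⟨hs.1.le, hs.2.trans hx.2⟩)).trans (le_of_eq ?_)
    ring) hi
  refine this.trans (le_of_eq ?_)
  rw [intervalIntegral.integral_const_mul, integral_mul_primitive_pow hx.1 hAx.norm,
    Nat.factorial_succ]
  push_cast
  field_simp

theorem norm_iterate_volterra_le (hA : IntervalIntegrable A volume a b) {w : ℝ → V} {C : ℝ}
    (hw : ∀ x ∈ Icc a b, ‖w x‖ ≤ C) (k : ℕ) :
    ∀ x ∈ Icc a b, ‖(volterra A a)^[k] w x‖ ≤
      C * (∫ r in a..x, ‖A r‖) ^ k / k.factorial := by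
  induction k with
  | zero => simpa using hw
  | succ k ih => rw [Function.iterate_succ_apply']; exact norm_volterra_le hA ih

theorem norm_iterate_volterra_le' (hA : IntervalIntegrable A volume a b) {w : ℝ → V} {C : ℝ}
    (hw : ∀ x ∈ Icc a b, ‖w x‖ ≤ C) (k : ℕ) :
    ∀ x ∈ Icc a b, ‖(volterra A a)^[k] w x‖ ≤
      C * ((∫ r in a..b, ‖A r‖) ^ k / k.factorial) := by
  intro x hx
  have hC : 0 ≤ C := (norm_nonneg _).trans (hw x hx)
  have h0 : 0 ≤ ∫ r in a..x, ‖A r‖ :=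
    intervalIntegral.integral_nonneg hx.1 fun _ _ => norm_nonneg _
  have h1 : ∫ r in a..x, ‖A r‖ ≤ ∫ r in a..b, ‖A r‖ :=
    intervalIntegral.integral_mono_interval le_rfl hx.1 hx.2
      (Eventually.of_forall fun _ => norm_nonneg _) hA.norm
  refine (norm_iterate_volterra_le hA hw k x hx).trans ?_
  rw [mul_div_assoc]
  gcongr

/-- A common bound for the terms of the Neumann series. -/
theorem norm_smul_iterate_volterra_le (hA : IntervalIntegrable A volume a b) {w : ℝ → V} {C : ℝ}
    (hw : ∀ x ∈ Icc a b, ‖w x‖ ≤ C) {z : ℂ} {R : ℝ} (hz : ‖z‖ ≤ R) (k : ℕ) :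
    ∀ x ∈ Icc a b, ‖z ^ k • (volterra A a)^[k] w x‖ ≤
      C * ((R * ∫ r in a..b, ‖A r‖) ^ k / k.factorial) := by
  intro x hx
  have h := norm_iterate_volterra_le' hA hw k x hx
  have hR : 0 ≤ R := (norm_nonneg z).trans hz
  rw [norm_smul, norm_pow]
  calc ‖z‖ ^ k * ‖(volterra A a)^[k] w x‖ ≤
      R ^ k * (C * ((∫ r in a..b, ‖A r‖) ^ k / k.factorial)) := by gcongr
    _ = _ := by rw [mul_pow]; ring

theorem summable_volterra_bound (C r : ℝ) :
    Summable fun k : ℕ => C * (r ^ k / k.factorial) :=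
  (Real.summable_pow_div_factorial r).mul_left C

theorem norm_volterraSolution_le (hA : IntervalIntegrable A volume a b) {w : ℝ → V} {C : ℝ}
    (hw : ∀ x ∈ Icc a b, ‖w x‖ ≤ C) {z : ℂ} {R : ℝ} (hz : ‖z‖ ≤ R) {x : ℝ} (hx : x ∈ Icc a b) :
    ‖volterraSolution A a z w x‖ ≤ C * Real.exp (R * ∫ r in a..b, ‖A r‖) := by
  have h1 : HasSum (fun k : ℕ => C * ((R * ∫ r in a..b, ‖A r‖) ^ k / k.factorial))
      (C * Real.exp (R * ∫ r in a..b, ‖A r‖)) := by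
    rw [Real.exp_eq_exp_ℝ]
    exact (NormedSpace.expSeries_div_hasSum_exp (R * ∫ r in a..b, ‖A r‖)).mul_left C
  exact tsum_of_norm_bounded h1 fun k => norm_smul_iterate_volterra_le hA hw hz k x hx

/-- Iterating the equation gives w = z^k V^k w for every k, where V is the Volterra operator, and
the factorial bound sends the right side to 0. -/
theorem volterra_unique (hA : IntervalIntegrable A volume a b) {w : ℝ → V} {z : ℂ}
    (hw : ContinuousOn w (Icc a b)) (h : ∀ x ∈ Icc a b, w x = z • volterra A a w x) :
    ∀ x ∈ Icc a b, w x = 0 := by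
  obtain ⟨C, hC⟩ := isCompact_Icc.exists_bound_of_continuousOn hw
  have key : ∀ k, ∀ x ∈ Icc a b, w x = z ^ k • (volterra A a)^[k] w x := by
    intro k
    induction k with
    | zero => simp
    | succ k ih =>
      intro x hx
      rw [h x hx, Function.iterate_succ_apply', pow_succ', mul_smul]
      congr 1
      rw [volterra, volterra, ← intervalIntegral.integral_smul]
      refine intervalIntegral.integral_congr fun s hs => ?_
      rw [uIcc_of_le hx.1] at hs
      change A s (w s) = z ^ k • A s _
      rw [← map_smul, ← ih s ⟨hs.1, hs.2.trans hx.2⟩]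
  intro x hx
  have h0 := (summable_volterra_bound C (‖z‖ * ∫ r in a..b, ‖A r‖)).tendsto_atTop_zero
  refine norm_le_zero_iff.1 (ge_of_tendsto' h0 fun k => ?_)
  conv_lhs => rw [key k x hx]
  exact norm_smul_iterate_volterra_le hA hC le_rfl k x hx

variable [CompleteSpace V]

theorem hasSum_volterraSolution (hA : IntervalIntegrable A volume a b) {w : ℝ → V} {C : ℝ}
    (hw : ∀ x ∈ Icc a b, ‖w x‖ ≤ C) (z : ℂ) {x : ℝ} (hx : x ∈ Icc a b) :
    HasSum (fun k : ℕ => z ^ k • (volterra A a)^[k] w x) (volterraSolution A a z w x) :=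
  ((summable_volterra_bound C (‖z‖ * ∫ r in a..b, ‖A r‖)).of_norm_bounded
    fun k => norm_smul_iterate_volterra_le hA hw le_rfl k x hx).hasSum

theorem continuousOn_volterraSolution (hA : IntervalIntegrable A volume a b) (hab : a ≤ b)
    {w : ℝ → V} (hw : ContinuousOn w (Icc a b)) (z : ℂ) :
    ContinuousOn (volterraSolution A a z w) (Icc a b) := by
  obtain ⟨C, hC⟩ := isCompact_Icc.exists_bound_of_continuousOn hw
  exact continuousOn_tsum (fun k => (continuousOn_iterate_volterra hA hab hw k).const_smul (z ^ k))
    (summable_volterra_bound C _)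
    fun k x hx => norm_smul_iterate_volterra_le hA hC le_rfl k x hx

theorem differentiable_volterraSolution (hA : IntervalIntegrable A volume a b)
    {w : ℝ → V} {C : ℝ} (hw : ∀ x ∈ Icc a b, ‖w x‖ ≤ C) {x : ℝ} (hx : x ∈ Icc a b) :
    Differentiable ℂ fun z => volterraSolution A a z w x := by
  intro z
  have : DifferentiableOn ℂ (fun z => volterraSolution A a z w x) (Metric.ball 0 (‖z‖ + 1)) :=
    Complex.differentiableOn_tsum_of_summable_norm
      (summable_volterra_bound C ((‖z‖ + 1) * ∫ r in a..b, ‖A r‖))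
      (fun k => by fun_prop) Metric.isOpen_ball
      fun k y hy => norm_smul_iterate_volterra_le hA hw ((mem_ball_zero_iff.1 hy).le) k x hx
  exact this.differentiableAt (Metric.isOpen_ball.mem_nhds (by simp))

/-- Integrating the Neumann series term by term, by dominated convergence, shifts its index by one,
so only the zeroth term is missing. -/
theorem volterraSolution_eq (hA : IntervalIntegrable A volume a b) (hab : a ≤ b)
    {w : ℝ → V} (hw : ContinuousOn w (Icc a b)) (z : ℂ) {x : ℝ} (hx : x ∈ Icc a b) :
    volterraSolution A a z w x = w x + z • ∫ s in a..x, A s (volterraSolution A a z w s) := by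
  obtain ⟨C, hC⟩ := isCompact_Icc.exists_bound_of_continuousOn hw
  set r := ‖z‖ * ∫ r in a..b, ‖A r‖ with hr
  have hsub : Icc a x ⊆ Icc a b := Icc_subset_Icc_right hx.2
  have hAx := hA.mono_right hx
  have h1 : HasSum (fun k : ℕ => ∫ s in a..x, A s (z ^ k • (volterra A a)^[k] w s))
      (∫ s in a..x, A s (volterraSolution A a z w s)) := by
    refine intervalIntegral.hasSum_integral_of_dominated_convergence
      (fun k s => ‖A s‖ * (C * (r ^ k / k.factorial))) (fun k => ?_) (fun k => ?_) ?_ ?_ ?_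
    · exact (hAx.clm_apply_continuousOn hx.1
        (((continuousOn_iterate_volterra hA hab hw k).mono hsub).const_smul
          (z ^ k))).aestronglyMeasurable_restrict_uIoc
    · refine Eventually.of_forall fun s hs => (A s).le_opNorm_of_le ?_
      rw [uIoc_of_le hx.1] at hs
      exact norm_smul_iterate_volterra_le hA hC le_rfl k s ⟨hs.1.le, hs.2.trans hx.2⟩
    · exact Eventually.of_forall fun s _ => (summable_volterra_bound C r).mul_left _
    · simp_rw [tsum_mul_left]
      exact hAx.norm.mul_const _
    · refine Eventually.of_forall fun s hs => ?_
      rw [uIoc_of_le hx.1] at hs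
      exact (A s).hasSum (hasSum_volterraSolution hA hC z ⟨hs.1.le, hs.2.trans hx.2⟩)
  have h2 : HasSum (fun k : ℕ => z ^ (k + 1) • (volterra A a)^[k + 1] w x)
      (z • ∫ s in a..x, A s (volterraSolution A a z w s)) := by
    refine (h1.const_smul z).congr_fun fun k => ?_
    simp only [map_smul]
    rw [intervalIntegral.integral_smul, smul_smul, ← pow_succ', Function.iterate_succ_apply']
    rfl
  have h3 := (hasSum_nat_add_iff' 1).2 (hasSum_volterraSolution hA hC z hx)
  have := h3.unique h2
  simp at this
  rw [← this]
  abel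

end Volterra

/-! ### Canonical systems as Volterra equations -/

theorem AbsolutelyContinuousOnInterval.sum {ι F : Type*} [SeminormedAddCommGroup F]
    {f : ι → ℝ → F} {a b : ℝ} (s : Finset ι)
    (hf : ∀ i ∈ s, AbsolutelyContinuousOnInterval (f i) a b) :
    AbsolutelyContinuousOnInterval (fun x => ∑ i ∈ s, f i x) a b := by
  classical
  induction s using Finset.induction_on with
  | empty => simpa using absolutelyContinuousOnInterval_const (0 : F) a b
  | insert i s hi ih =>
    simp_rw [Finset.sum_insert hi]
    exact (hf i (Finset.mem_insert_self i s)).add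
      (ih fun j hj => hf j (Finset.mem_insert_of_mem hj))

namespace RegularCanonicalSystem

variable {n : ℕ} {a b : ℝ} (𝓢 : RegularCanonicalSystem n a b)

/-- The matrix `J H(x)` as a continuous linear map. -/
noncomputable def coeff (x : ℝ) : (Fin n ⊕ Fin n → ℂ) →L[ℂ] (Fin n ⊕ Fin n → ℂ) :=
  LinearMap.toContinuousLinearMap (Matrix.mulVecLin (Matrix.J (Fin n) ℂ * 𝓢.H x))

theorem coeff_apply (x : ℝ) (v : Fin n ⊕ Fin n → ℂ) :
    𝓢.coeff x v = Matrix.J (Fin n) ℂ *ᵥ (𝓢.H x *ᵥ v) := by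
  simp [coeff]

theorem J_mulVec_eq_neg_iff (v w : Fin n ⊕ Fin n → ℂ) :
    Matrix.J (Fin n) ℂ *ᵥ v = -w ↔ v = Matrix.J (Fin n) ℂ *ᵥ w := by
  constructor
  · intro h
    have := congrArg (fun y => Matrix.J (Fin n) ℂ *ᵥ y) h
    simp only [mulVec_mulVec, Matrix.J_squared, neg_mulVec, one_mulVec, mulVec_neg] at this
    exact neg_injective this
  · rintro rfl
    rw [mulVec_mulVec, Matrix.J_squared, neg_mulVec, one_mulVec]

theorem intervalIntegrable_iff {E : Type*} [NormedAddCommGroup E] {f : ℝ → E} (hab : a ≤ b) :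
    IntervalIntegrable f volume a b ↔ IntegrableOn f (Ioo a b) := by
  rw [intervalIntegrable_iff_integrableOn_Ioo_of_le hab]

theorem intervalIntegrable_coeff (hab : a ≤ b) : IntervalIntegrable 𝓢.coeff volume a b := by
  have e : 𝓢.coeff = fun x => ∑ i, ∑ j, 𝓢.H x i j • LinearMap.toContinuousLinearMap
      (Matrix.mulVecLin (Matrix.J (Fin n) ℂ * Matrix.single i j 1)) := by
    funext x
    ext1 v
    simp only [coeff, _root_.sum_apply, _root_.smul_apply,
      LinearMap.coe_toContinuousLinearMap', Matrix.mulVecLin_apply]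
    conv_lhs => rw [Matrix.matrix_eq_sum_single (𝓢.H x)]
    simp_rw [Finset.mul_sum, Matrix.sum_mulVec, ← Matrix.smul_mulVec, ← Matrix.mul_smul,
      Matrix.smul_single, smul_eq_mul, mul_one]
  rw [intervalIntegrable_iff hab, e]
  exact integrable_finsetSum _ fun i _ => integrable_finsetSum _ fun j _ =>
    (𝓢.integrable i j).smul_const _

/-- Since J² = −1, the differential equation reads f' = JHg. One direction is the fundamental
theorem for absolutely continuous functions, the other Lebesgue differentiation. -/
theorem solves_iff (hab : a ≤ b) {f g : ℝ → Fin n ⊕ Fin n → ℂ}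
    (hg : IntervalIntegrable (fun s => 𝓢.coeff s (g s)) volume a b) :
    𝓢.Solves f g ↔ ∀ x ∈ Icc a b, f x = f a + ∫ s in a..x, 𝓢.coeff s (g s) := by
  constructor
  · rintro ⟨h1, h2⟩
    refine h1.eq_add_integral hab ?_ hg
    filter_upwards [h2] with x ⟨f', hf', e⟩
    rw [J_mulVec_eq_neg_iff, ← coeff_apply] at e
    rwa [← e]
  · intro h
    have hac := (absolutelyContinuousOnInterval_const (f a) a b).add
      hg.absolutelyContinuousOnInterval_primitive
    refine ⟨hac.congr fun x hx => (h x (by rwa [uIcc_of_le hab] at hx)).symm, ?_⟩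
    rw [ae_restrict_iff' measurableSet_Ioo]
    filter_upwards [hg.ae_hasDerivAt_integral] with x hx hx'
    refine ⟨𝓢.coeff x (g x), ?_, by rw [J_mulVec_eq_neg_iff, coeff_apply]⟩
    refine ((hx (Icc_subset_uIcc (Ioo_subset_Icc_self hx')) a
      left_mem_uIcc).const_add (f a)).congr_of_eventuallyEq ?_
    filter_upwards [Ioo_mem_nhds hx'.1 hx'.2] with y hy using h y (Ioo_subset_Icc_self hy)

theorem Solves.continuousOn (hab : a ≤ b) {f g : ℝ → Fin n ⊕ Fin n → ℂ} (h : 𝓢.Solves f g) :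
    ContinuousOn f (Icc a b) := by
  have := h.1.continuousOn
  rwa [uIcc_of_le hab] at this

/-- Existence for the inhomogeneous initial value problem. -/
theorem solves_volterraSolution (hab : a ≤ b) (z : ℂ) (c : Fin n ⊕ Fin n → ℂ)
    {g : ℝ → Fin n ⊕ Fin n → ℂ} (hg : IntervalIntegrable (fun s => 𝓢.coeff s (g s)) volume a b)
    {w : ℝ → Fin n ⊕ Fin n → ℂ} (hw : ∀ x, w x = c + ∫ s in a..x, 𝓢.coeff s (g s)) :
    𝓢.Solves (volterraSolution 𝓢.coeff a z w) (z • volterraSolution 𝓢.coeff a z w + g) ∧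
      volterraSolution 𝓢.coeff a z w a = c := by
  have hA := 𝓢.intervalIntegrable_coeff hab
  have hwc : ContinuousOn w (Icc a b) := by
    have := ((absolutelyContinuousOnInterval_const c a b).add
      hg.absolutelyContinuousOnInterval_primitive).continuousOn
    rw [uIcc_of_le hab] at this
    exact this.congr fun x _ => hw x
  have hs := continuousOn_volterraSolution hA hab hwc z
  have hi := hA.clm_apply_continuousOn hab hs
  have h0 : volterraSolution 𝓢.coeff a z w a = c := by
    rw [volterraSolution_eq hA hab hwc z (left_mem_Icc.2 hab), hw]
    simp
  have e : (fun s => 𝓢.coeff s ((z • volterraSolution 𝓢.coeff a z w + g) s)) =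
      fun s => z • 𝓢.coeff s (volterraSolution 𝓢.coeff a z w s) + 𝓢.coeff s (g s) := by
    funext s
    simp
  refine ⟨(𝓢.solves_iff hab ?_).2 fun x hx => ?_, h0⟩
  · rw [e]
    exact (hi.smul z).add hg
  · have hi' : IntervalIntegrable (fun s => z • 𝓢.coeff s (volterraSolution 𝓢.coeff a z w s))
        volume a x := (hi.smul z).mono_right hx
    rw [h0, e, intervalIntegral.integral_add hi' (hg.mono_right hx),
      volterraSolution_eq hA hab hwc z hx, hw, intervalIntegral.integral_smul]
    abel

/-- The difference satisfies the homogeneous Volterra equation with zero initial value. -/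
theorem Solves.unique (hab : a ≤ b) {f g : ℝ → Fin n ⊕ Fin n → ℂ} {z : ℂ}
    (hf : 𝓢.Solves f (z • f)) (hg : 𝓢.Solves g (z • g)) (h : f a = g a) : EqOn f g (Icc a b) := by
  have hA := 𝓢.intervalIntegrable_coeff hab
  have hd : 𝓢.Solves (f + (-1 : ℂ) • g) (z • (f + (-1 : ℂ) • g)) := by
    have := hf.add 𝓢 (hg.smul 𝓢 (-1))
    rwa [smul_comm (-1 : ℂ) z g, ← smul_add] at this
  have hc := hd.continuousOn 𝓢 hab
  have hi := hA.clm_apply_continuousOn hab (hc.const_smul z)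
  have key := volterra_unique hA hc (z := z) fun x hx => by
    rw [(𝓢.solves_iff hab hi).1 hd x hx]
    have h0 : (f + (-1 : ℂ) • g) a = 0 := by simp [h]
    simp only [h0, zero_add, Pi.smul_apply z, map_smul]
    rw [intervalIntegral.integral_smul, volterra]
  intro x hx
  have := key x hx
  rw [Pi.add_apply, Pi.smul_apply, neg_smul, one_smul, ← sub_eq_add_neg] at this
  exact sub_eq_zero.1 this

theorem solution_spec (hab : a ≤ b) (z : ℂ) (c : Fin n ⊕ Fin n → ℂ) :
    𝓢.Solves (𝓢.solution z c) (z • 𝓢.solution z c) ∧ 𝓢.solution z c a = c := by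
  refine Classical.epsilon_spec (p := fun w => 𝓢.Solves w (z • w) ∧ w a = c)
    ⟨volterraSolution 𝓢.coeff a z fun _ => c, ?_⟩
  have := 𝓢.solves_volterraSolution hab z c (g := 0) (w := fun _ => c) (by simp) (by simp)
  rwa [add_zero] at this

/-- `solution` is an arbitrary choice and is pinned down only on [a, b]. This identification gives
it the analyticity and the bounds of the Neumann series. -/
theorem solution_eq_volterraSolution (hab : a ≤ b) (z : ℂ) (c : Fin n ⊕ Fin n → ℂ) :
    EqOn (𝓢.solution z c) (volterraSolution 𝓢.coeff a z fun _ => c) (Icc a b) := by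
  have h1 := 𝓢.solution_spec hab z c
  have h2 := 𝓢.solves_volterraSolution hab z c (g := 0) (w := fun _ => c) (by simp) (by simp)
  rw [add_zero] at h2
  exact h1.1.unique 𝓢 hab h2.1 (h1.2.trans h2.2.symm)

theorem Solves.sum {ι : Type*} (s : Finset ι) {f g : ι → ℝ → Fin n ⊕ Fin n → ℂ}
    (h : ∀ i ∈ s, 𝓢.Solves (f i) (g i)) : 𝓢.Solves (∑ i ∈ s, f i) (∑ i ∈ s, g i) := by
  classical
  induction s using Finset.induction_on with
  | empty =>
    refine ⟨absolutelyContinuousOnInterval_const 0 a b, Eventually.of_forall fun x => ⟨0, ?_, ?_⟩⟩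
    · exact hasDerivAt_const x 0
    · simp
  | insert i s hi ih =>
    rw [Finset.sum_insert hi, Finset.sum_insert hi]
    exact (h i (Finset.mem_insert_self i s)).add 𝓢
      (ih fun j hj => h j (Finset.mem_insert_of_mem hj))

theorem solves_matrixSolution_mulVec (hab : a ≤ b) (z : ℂ)
    (C : Matrix (Fin n ⊕ Fin n) (Fin n) ℂ) (c : Fin n → ℂ) :
    𝓢.Solves (fun x => 𝓢.matrixSolution z C x *ᵥ c) (z • fun x => 𝓢.matrixSolution z C x *ᵥ c) ∧
      𝓢.matrixSolution z C a *ᵥ c = C *ᵥ c := by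
  have e : (fun x => 𝓢.matrixSolution z C x *ᵥ c) =
      ∑ k, c k • 𝓢.solution z fun l => C l k := by
    funext x i
    simp [matrixSolution, mulVec, dotProduct, mul_comm]
  constructor
  · rw [e, Finset.smul_sum]
    refine Solves.sum 𝓢 _ fun k _ => ?_
    rw [smul_comm]
    exact (𝓢.solution_spec hab z _).1.smul 𝓢 (c k)
  · refine (congrFun e a).trans ?_
    funext i
    simp [(𝓢.solution_spec hab z _).2, mulVec, dotProduct, mul_comm]

theorem differentiable_matrixSolution_apply (hab : a ≤ b) (C : Matrix (Fin n ⊕ Fin n) (Fin n) ℂ)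
    {x : ℝ} (hx : x ∈ Icc a b) (i : Fin n ⊕ Fin n) (k : Fin n) :
    Differentiable ℂ fun z => 𝓢.matrixSolution z C x i k := by
  have h := differentiable_volterraSolution (𝓢.intervalIntegrable_coeff hab)
    (w := fun _ => fun l => C l k) (C := ‖fun l => C l k‖) (fun _ _ => le_rfl) hx
  have e : (fun z => 𝓢.matrixSolution z C x i k) =
      fun z => volterraSolution 𝓢.coeff a z (fun _ l => C l k) x i := by
    funext z
    simp [matrixSolution, 𝓢.solution_eq_volterraSolution hab z _ hx]
  rw [e]
  exact differentiable_pi.1 h i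

/-- A bound for the solution which is locally uniform in the spectral parameter. -/
theorem exists_norm_matrixSolution_le (hab : a ≤ b) (C : Matrix (Fin n ⊕ Fin n) (Fin n) ℂ)
    (R : ℝ) : ∃ M, ∀ z : ℂ, ‖z‖ ≤ R → ∀ x ∈ Icc a b, ∀ i k, ‖𝓢.matrixSolution z C x i k‖ ≤ M := by
  refine ⟨(∑ k, ‖fun l => C l k‖) * Real.exp (R * ∫ r in a..b, ‖𝓢.coeff r‖),
    fun z hz x hx i k => ?_⟩
  have h := norm_volterraSolution_le (𝓢.intervalIntegrable_coeff hab)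
    (w := fun _ => fun l => C l k) (C := ‖fun l => C l k‖) (fun _ _ => le_rfl) hz hx
  rw [← 𝓢.solution_eq_volterraSolution hab z _ hx] at h
  refine (norm_le_pi_norm (𝓢.solution z (fun l => C l k) x) i).trans (h.trans ?_)
  gcongr
  exact Finset.single_le_sum (f := fun k => ‖fun l => C l k‖) (fun _ _ => norm_nonneg _)
    (Finset.mem_univ k)

/-! ### Green's formula -/

theorem hasDerivAt_star_dotProduct {ι : Type*} [Fintype ι] {f k : ℝ → ι → ℂ} {f' k' : ι → ℂ}
    {M : Matrix ι ι ℂ} {x : ℝ} (hf : HasDerivAt f f' x) (hk : HasDerivAt k k' x) :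
    HasDerivAt (fun x => star (f x) ⬝ᵥ (M *ᵥ k x))
      (star f' ⬝ᵥ (M *ᵥ k x) + star (f x) ⬝ᵥ (M *ᵥ k')) x := by
  have h1 : ∀ i, HasDerivAt (fun x => star (f x i)) (star (f' i)) x := fun i =>
    (hasDerivAt_pi.1 hf i).star
  have h2 : ∀ i, HasDerivAt (fun x => (M *ᵥ k x) i) ((M *ᵥ k') i) x := fun i => by
    simp only [mulVec, dotProduct]
    exact HasDerivAt.fun_sum fun j _ => (hasDerivAt_pi.1 hk j).const_mul (M i j)
  simp only [dotProduct, ← Finset.sum_add_distrib]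
  exact HasDerivAt.fun_sum fun i _ => (h1 i).mul (h2 i)

theorem absolutelyContinuousOnInterval_star_dotProduct {ι : Type*} [Fintype ι]
    {f k : ℝ → ι → ℂ} (M : Matrix ι ι ℂ) (hf : AbsolutelyContinuousOnInterval f a b)
    (hk : AbsolutelyContinuousOnInterval k a b) :
    AbsolutelyContinuousOnInterval (fun x => star (f x) ⬝ᵥ (M *ᵥ k x)) a b := by
  refine AbsolutelyContinuousOnInterval.sum _ fun i _ => ?_
  have h1 : AbsolutelyContinuousOnInterval (fun x => star (f x i)) a b :=
    hf.of_dist_le fun x _ y _ => by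
      rw [dist_star_star]
      exact dist_le_pi_dist _ _ i
  have h2 : AbsolutelyContinuousOnInterval (fun x => (M *ᵥ k x) i) a b :=
    AbsolutelyContinuousOnInterval.sum _ fun j _ =>
      AbsolutelyContinuousOnInterval.const_smul (M i j)
        (hk.of_dist_le fun x _ y _ => dist_le_pi_dist (k x) (k y) j)
  exact h1.smul h2

/-- Take adjoints in Jf' = −Hg, using J* = −J and H* = H. This computes the first half of the
derivative of f*Jk. -/
theorem star_dotProduct_J_mulVec {H : Matrix (Fin n ⊕ Fin n) (Fin n ⊕ Fin n) ℂ}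
    (hH : H.IsHermitian) {f' g k : Fin n ⊕ Fin n → ℂ}
    (h : Matrix.J (Fin n) ℂ *ᵥ f' = -(H *ᵥ g)) :
    star f' ⬝ᵥ (Matrix.J (Fin n) ℂ *ᵥ k) = star g ⬝ᵥ (H *ᵥ k) := by
  have hJ : (Matrix.J (Fin n) ℂ)ᴴ = -Matrix.J (Fin n) ℂ := by
    simp [Matrix.J, Matrix.fromBlocks_conjTranspose, Matrix.fromBlocks_neg]
  have h2 := congrArg star h
  rw [star_mulVec, hJ, vecMul_neg, star_neg, star_mulVec, hH.eq] at h2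
  rw [dotProduct_mulVec, neg_injective h2, ← dotProduct_mulVec]

/-- The function f*Jk is absolutely continuous with derivative g*Hk − f*Hl almost everywhere. -/
theorem green (hab : a ≤ b) {f g k l : ℝ → Fin n ⊕ Fin n → ℂ} (hf : 𝓢.Solves f g)
    (hk : 𝓢.Solves k l) (h1 : Integrable (𝓢.weight.pairing g k) 𝓢.weight.base)
    (h2 : Integrable (𝓢.weight.pairing f l) 𝓢.weight.base) :
    ∫ x, 𝓢.weight.pairing g k x ∂𝓢.weight.base - ∫ x, 𝓢.weight.pairing f l x ∂𝓢.weight.base =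
      star (f b) ⬝ᵥ (Matrix.J (Fin n) ℂ *ᵥ k b) - star (f a) ⬝ᵥ (Matrix.J (Fin n) ℂ *ᵥ k a) := by
  have hac := absolutelyContinuousOnInterval_star_dotProduct (Matrix.J (Fin n) ℂ) hf.1 hk.1
  have h3 : Integrable (fun x => 𝓢.weight.pairing g k x - 𝓢.weight.pairing f l x)
    (volume.restrict (Ioo a b)) := h1.sub h2
  have key := hac.eq_add_integral hab
    (f' := fun x => 𝓢.weight.pairing g k x - 𝓢.weight.pairing f l x) (by
      filter_upwards [hf.2, hk.2, 𝓢.posSemidef] with x ⟨f', hf', ef⟩ ⟨k', hk', ek⟩ hx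
      have := hasDerivAt_star_dotProduct (M := Matrix.J (Fin n) ℂ) hf' hk'
      rwa [star_dotProduct_J_mulVec hx.isHermitian ef, ek, dotProduct_neg, ← sub_eq_add_neg]
        at this)
    ((intervalIntegrable_iff hab).2 h3) b (right_mem_Icc.2 hab)
  rw [key, add_sub_cancel_left, intervalIntegral.integral_of_le hab,
    ← Measure.restrict_congr_set Ioo_ae_eq_Ioc]
  exact (integral_sub h1 h2).symm

end RegularCanonicalSystem

/-! ### Nonnegative matrices -/

section PosSemidef

variable {ι : Type*} [Fintype ι]

/-- On an eigenvector with eigenvalue d the operator (M + ε)⁻¹M is d/(d + ε), so the limit is the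
projection onto the range of M. It recovers, by explicit limits, a canonical preimage of Mv; this
makes a measurable choice of preimages possible. -/
theorem Matrix.PosSemidef.tendsto_regularized_inverse [DecidableEq ι] {M : Matrix ι ι ℂ}
    (hM : M.PosSemidef) (v : ι → ℂ) :
    ∃ y, Tendsto (fun k : ℕ => (M + ((1 / (k + 1) : ℝ) : ℂ) • 1)⁻¹ *ᵥ (M *ᵥ v)) atTop (𝓝 y) ∧
      M *ᵥ y = M *ᵥ v := by
  obtain ⟨U, d, hU, hd, hMU⟩ : ∃ (U : Matrix ι ι ℂ) (d : ι → ℝ), U * Uᴴ = 1 ∧ (∀ i, 0 ≤ d i) ∧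
      M = U * diagonal (fun i => (d i : ℂ)) * Uᴴ := by
    refine ⟨hM.isHermitian.eigenvectorUnitary, hM.isHermitian.eigenvalues, ?_,
      hM.eigenvalues_nonneg, ?_⟩
    · exact Unitary.coe_mul_star_self hM.isHermitian.eigenvectorUnitary
    · conv_lhs => rw [hM.isHermitian.spectral_theorem]
      rw [Unitary.conjStarAlgAut_apply]
      rfl
  have hU' : Uᴴ * U = 1 := mul_eq_one_comm.1 hU
  have key : ∀ e f : ι → ℂ, (U * diagonal e * Uᴴ) * (U * diagonal f * Uᴴ) =
      U * diagonal (fun i => e i * f i) * Uᴴ := by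
    intro e f
    rw [← diagonal_mul_diagonal]
    calc (U * diagonal e * Uᴴ) * (U * diagonal f * Uᴴ) =
        U * diagonal e * (Uᴴ * U) * diagonal f * Uᴴ := by simp only [Matrix.mul_assoc]
      _ = _ := by rw [hU', Matrix.mul_one]; simp only [Matrix.mul_assoc]
  have hinv : ∀ k : ℕ, (M + ((1 / (k + 1) : ℝ) : ℂ) • 1)⁻¹ =
      U * diagonal (fun i => ((d i + 1 / (k + 1) : ℝ) : ℂ)⁻¹) * Uᴴ := by
    intro k
    refine Matrix.inv_eq_right_inv ?_
    have e1 : M + ((1 / (k + 1) : ℝ) : ℂ) • 1 =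
        U * diagonal (fun i => ((d i + 1 / (k + 1) : ℝ) : ℂ)) * Uᴴ := by
      have : diagonal (fun i => ((d i + 1 / (k + 1) : ℝ) : ℂ)) =
          diagonal (fun i => (d i : ℂ)) + ((1 / (k + 1) : ℝ) : ℂ) • (1 : Matrix ι ι ℂ) := by
        rw [← diagonal_one, ← diagonal_smul, diagonal_add]
        congr 1
        funext i
        simp
      rw [this, Matrix.mul_add, Matrix.add_mul, ← hMU, Matrix.mul_smul, Matrix.smul_mul,
        Matrix.mul_one, hU]
    rw [e1, key]
    have : (fun i => ((d i + 1 / (k + 1) : ℝ) : ℂ) * ((d i + 1 / (k + 1) : ℝ) : ℂ)⁻¹) =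
        fun _ => 1 := by
      funext i
      refine mul_inv_cancel₀ ?_
      have := hd i
      have : 0 < d i + 1 / (k + 1 : ℝ) := by positivity
      exact_mod_cast this.ne'
    rw [this, diagonal_one, Matrix.mul_one, hU]
  -- The limits of d/(d + ε): the eigenvalues of the projection onto the range of M.
  set q : ι → ℂ := fun i => if d i = 0 then 0 else 1 with hq
  refine ⟨(U * diagonal q * Uᴴ) *ᵥ v, ?_, ?_⟩
  · have hlim : ∀ i, Tendsto (fun k : ℕ => ((d i + 1 / (k + 1) : ℝ) : ℂ)⁻¹ * (d i : ℂ)) atTop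
        (𝓝 (q i)) := by
      intro i
      by_cases h : d i = 0
      · simp [hq, h]
      · have h1 : Tendsto (fun k : ℕ => (((d i + 1 / (k + 1) : ℝ)⁻¹ * d i : ℝ) : ℂ)) atTop
            (𝓝 (((d i + 0)⁻¹ * d i : ℝ) : ℂ)) := by
          refine (Complex.continuous_ofReal.tendsto _).comp ?_
          refine Tendsto.mul_const _ (Tendsto.inv₀ ?_ (by simpa using h))
          exact tendsto_one_div_add_atTop_nhds_zero_nat.const_add _
        simpa [hq, h] using h1
    have hc : Continuous fun e : ι → ℂ => (U * diagonal e * Uᴴ) *ᵥ v := by fun_prop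
    have h2 := (hc.tendsto q).comp (tendsto_pi_nhds.2 hlim)
    refine h2.congr fun k => ?_
    rw [hinv k, mulVec_mulVec]
    conv_rhs => rw [hMU, key]
    rfl
  · rw [mulVec_mulVec]
    conv_lhs => rw [hMU, key]
    conv_rhs => rw [hMU]
    congr 4
    funext i
    by_cases h : d i = 0 <;> simp [hq, h]

open scoped MatrixOrder in
theorem Matrix.PosSemidef.exists_factor [DecidableEq ι] {M : Matrix ι ι ℂ} (hM : M.PosSemidef) :
    ∃ B : Matrix ι ι ℂ, M = Bᴴ * B ∧
      ∀ v, star v ⬝ᵥ (M *ᵥ v) = ((∑ i, ‖(B *ᵥ v) i‖ ^ 2 : ℝ) : ℂ) := by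
  obtain ⟨B, rfl⟩ := CStarAlgebra.nonneg_iff_eq_star_mul_self.mp hM.nonneg
  refine ⟨B, rfl, fun v => ?_⟩
  rw [star_eq_conjTranspose, ← mulVec_mulVec, dotProduct_mulVec, ← star_mulVec]
  simp [dotProduct, Complex.conj_mul']

/-- A sequence with rapidly decreasing differences in the seminorm of a nonnegative matrix has
a limit. -/
theorem Matrix.PosSemidef.exists_limit [DecidableEq ι] {M : Matrix ι ι ℂ} (hM : M.PosSemidef)
    {v : ℕ → ι → ℂ} {C : ℝ} (h : ∀ k, (star (v (k + 1) - v k) ⬝ᵥ (M *ᵥ (v (k + 1) - v k))).re ≤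
      C * (1 / 4) ^ k) :
    ∃ y, Tendsto (fun k => M *ᵥ v k) atTop (𝓝 (M *ᵥ y)) ∧ ∀ w,
      Tendsto (fun k => star (w - v k) ⬝ᵥ (M *ᵥ (w - v k))) atTop
        (𝓝 (star (w - y) ⬝ᵥ (M *ᵥ (w - y)))) := by
  obtain ⟨B, hMB, hB⟩ := hM.exists_factor
  have hc : CauchySeq fun k => B *ᵥ v k := by
    refine cauchySeq_of_le_geometric (1 / 2) (Real.sqrt C) (by norm_num) fun k => ?_
    rw [dist_comm, dist_eq_norm, ← mulVec_sub]
    have h1 := h k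
    rw [hB, Complex.ofReal_re] at h1
    have e : Real.sqrt C * (1 / 2) ^ k = Real.sqrt (C * (1 / 4) ^ k) := by
      have : ((1 / 4 : ℝ)) ^ k = ((1 / 2) ^ k) ^ 2 := by
        rw [← pow_mul, mul_comm, pow_mul]
        norm_num
      rw [this, Real.sqrt_mul' _ (by positivity), Real.sqrt_sq (by positivity)]
    rw [e]
    refine (pi_norm_le_iff_of_nonneg (Real.sqrt_nonneg _)).2 fun i => Real.le_sqrt_of_sq_le ?_
    exact (Finset.single_le_sum (f := fun i => ‖(B *ᵥ (v (k + 1) - v k)) i‖ ^ 2)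
      (fun _ _ => by positivity) (Finset.mem_univ i)).trans h1
  obtain ⟨y', hy'⟩ := cauchySeq_tendsto_of_complete hc
  -- The vectors v k themselves need not converge, only their images under B. A finite dimensional
  -- range is closed, so the limit is again an image By.
  have hcl : IsClosed (LinearMap.range (Matrix.mulVecLin B) : Set (ι → ℂ)) :=
    Submodule.closed_of_finiteDimensional _
  obtain ⟨y, rfl⟩ := hcl.mem_of_tendsto hy' (Eventually.of_forall fun k => ⟨v k, rfl⟩)
  simp only [mulVecLin_apply] at hy'
  have h2 : ∀ w, Tendsto (fun k => star (w - v k) ⬝ᵥ (M *ᵥ (w - v k))) atTop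
        (𝓝 (star (w - y) ⬝ᵥ (M *ᵥ (w - y)))) := by
    intro w
    simp only [hB]
    simp only [mulVec_sub]
    have hcont : Continuous fun x : ι → ℂ => ((∑ i, ‖((B *ᵥ w) - x) i‖ ^ 2 : ℝ) : ℂ) := by
      fun_prop
    exact (hcont.tendsto _).comp hy'
  refine ⟨y, ?_, h2⟩
  have hcont : Continuous fun x : ι → ℂ => Bᴴ *ᵥ x := by fun_prop
  have hM' : ∀ x, M *ᵥ x = Bᴴ *ᵥ (B *ᵥ x) := fun x => by rw [hMB, mulVec_mulVec]
  simp only [hM']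
  exact (hcont.tendsto _).comp hy'

/-- By Cramer's rule the inverse is the adjugate times the reciprocal determinant; the latter is
measurable even across the zeros of the determinant. -/
theorem measurable_regularized_inverse [DecidableEq ι] (c : ℂ) :
    Measurable fun p : (ι → ι → ℂ) × (ι → ℂ) =>
      ((Matrix.of p.1 + c • (1 : Matrix ι ι ℂ))⁻¹ *ᵥ p.2) := by
  have h1 : Continuous fun p : (ι → ι → ℂ) × (ι → ℂ) =>
      (Matrix.of p.1 + c • (1 : Matrix ι ι ℂ)) := by
    refine Continuous.add ?_ continuous_const
    exact continuous_fst
  have h2 : Measurable fun p : (ι → ι → ℂ) × (ι → ℂ) =>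
      ((Matrix.of p.1 + c • (1 : Matrix ι ι ℂ)).det) := h1.matrix_det.measurable
  have h3 : Measurable fun p : (ι → ι → ℂ) × (ι → ℂ) =>
      ((Matrix.of p.1 + c • (1 : Matrix ι ι ℂ)).adjugate *ᵥ p.2) :=
    (h1.matrix_adjugate.matrix_mulVec continuous_snd).measurable
  simp only [Matrix.inv_def, Ring.inverse_eq_inv', smul_mulVec]
  exact h2.inv.smul h3

end PosSemidef

/-! ### Completeness of `L²` of a matrix weight -/

namespace MatrixWeight

variable {ι : Type} [Fintype ι] (W : MatrixWeight ι)

theorem inner_def (f g : W.PreL2) : inner ℂ f g = ∫ x, W.pairing f g x ∂W.base := rfl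

theorem inner_toL2 (f g : W.PreL2) :
    inner ℂ (W.toL2 f) (W.toL2 g) = ∫ x, W.pairing f g x ∂W.base :=
  SeparationQuotient.inner_mk_mk f g

theorem coe_sub (f g : W.PreL2) : ((f - g : W.PreL2) : ℝ → ι → ℂ) = (f : ℝ → ι → ℂ) - g := rfl

/-- The function `x ↦ f(x)* W(x) f(x)`, as a real valued function. -/
noncomputable def sqDensity (f : W.PreL2) (x : ℝ) : ℝ := (W.pairing f f x).re

theorem integrable_sqDensity (f : W.PreL2) : Integrable (W.sqDensity f) W.base :=
  (W.integrable_pairing f f).re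

theorem sqDensity_nonneg (f : W.PreL2) : 0 ≤ᵐ[W.base] W.sqDensity f :=
  (W.pairing_self_nonneg f).mono fun _ hx => (Complex.le_def.1 hx).1

theorem norm_sq (f : W.PreL2) : ‖f‖ ^ 2 = ∫ x, W.sqDensity f x ∂W.base := by
  have h1 : ‖f‖ ^ 2 = RCLike.re (inner ℂ f f) := (inner_self_eq_norm_sq f).symm
  rw [h1, inner_def]
  exact (integral_re (W.integrable_pairing f f)).symm

theorem norm_toL2 (f : W.PreL2) : ‖W.toL2 f‖ = ‖f‖ := rfl

theorem ofReal_norm_sq (f : W.PreL2) :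
    ENNReal.ofReal (‖f‖ ^ 2) = ∫⁻ x, ENNReal.ofReal (W.sqDensity f x) ∂W.base := by
  rw [norm_sq, ofReal_integral_eq_lintegral_ofReal (W.integrable_sqDensity f)
    (W.sqDensity_nonneg f)]

/-- Functions at distance `0` agree after multiplication with the weight. -/
theorem toL2_eq_iff (f g : W.PreL2) :
    W.toL2 f = W.toL2 g ↔ ∀ᵐ x ∂W.base, W.density x *ᵥ f x = W.density x *ᵥ g x := by
  have h1 : W.toL2 f = W.toL2 g ↔ ‖f - g‖ ^ 2 = 0 := by
    rw [← norm_toL2, sq_eq_zero_iff, norm_eq_zero,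
      show W.toL2 (f - g) = W.toL2 f - W.toL2 g from rfl, sub_eq_zero]
  rw [h1, norm_sq, integral_eq_zero_iff_of_nonneg_ae (W.sqDensity_nonneg _)
    (W.integrable_sqDensity _)]
  refine eventually_congr ?_
  filter_upwards [W.posSemidef] with x hx
  have h3 := hx.dotProduct_mulVec_zero_iff ((f - g : W.PreL2) x)
  have h4 := hx.dotProduct_mulVec_nonneg ((f - g : W.PreL2) x)
  rw [coe_sub, Pi.sub_apply, mulVec_sub, sub_eq_zero] at h3
  rw [← h3]
  rw [coe_sub, Pi.sub_apply, mulVec_sub] at h4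
  have h5 := (Complex.le_def.1 h4).2
  rw [Complex.ext_iff, ← h5]
  simp only [Complex.zero_re, Complex.zero_im, and_true]
  rw [← mulVec_sub]
  rfl

theorem aemeasurable_density_mulVec {f : ℝ → ι → ℂ} (hf : AEMeasurable f W.base) :
    AEMeasurable (fun x => W.density x *ᵥ f x) W.base := by
  refine aemeasurable_pi_iff.2 fun i => ?_
  simp only [mulVec, dotProduct]
  exact Finset.aemeasurable_fun_sum _ fun j _ =>
    (W.aemeasurable i j).mul ((measurable_pi_apply j).comp_aemeasurable hf)

/-- The series of the squared differences weighted by 4^k has integral at most Σ 4^(−k), hence is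
finite almost everywhere; its value at x serves as the constant. -/
theorem ae_sqDensity_le (u : ℕ → W.PreL2) (hu : ∀ k, ‖u (k + 1) - u k‖ ≤ (1 / 4) ^ k) :
    ∀ᵐ x ∂W.base, ∃ C : ℝ, ∀ k, W.sqDensity (u (k + 1) - u k) x ≤ C * (1 / 4) ^ k := by
  have hm : ∀ k, AEMeasurable (fun x => ENNReal.ofReal (4 ^ k) * ENNReal.ofReal
      (W.sqDensity (u (k + 1) - u k) x)) W.base :=
    fun k => ((W.integrable_sqDensity _).aemeasurable.ennreal_ofReal).const_mul _
  have h2 : ∫⁻ x, ∑' k, ENNReal.ofReal (4 ^ k) * ENNReal.ofReal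
      (W.sqDensity (u (k + 1) - u k) x) ∂W.base ≠ ⊤ := by
    rw [lintegral_tsum hm]
    have h3 : ∀ k, ∫⁻ x, ENNReal.ofReal (4 ^ k) * ENNReal.ofReal
        (W.sqDensity (u (k + 1) - u k) x) ∂W.base ≤
        ENNReal.ofReal ((1 / 4) ^ k) := by
      intro k
      rw [lintegral_const_mul' _ _ ENNReal.ofReal_ne_top, ← ofReal_norm_sq,
        ← ENNReal.ofReal_mul (by positivity)]
      refine ENNReal.ofReal_le_ofReal ?_
      calc (4 : ℝ) ^ k * ‖u (k + 1) - u k‖ ^ 2 ≤ 4 ^ k * ((1 / 4) ^ k) ^ 2 := by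
            gcongr
            exact hu k
        _ = (1 / 4) ^ k := by
          rw [sq, ← mul_assoc, ← mul_pow]
          norm_num
    refine ne_top_of_le_ne_top ?_ (ENNReal.tsum_le_tsum h3)
    rw [← ENNReal.ofReal_tsum_of_nonneg (fun k => by positivity)
      (summable_geometric_of_lt_one (by norm_num) (by norm_num))]
    exact ENNReal.ofReal_ne_top
  filter_upwards [ae_lt_top' (AEMeasurable.tsum hm) h2] with x hx
  refine ⟨(∑' k, ENNReal.ofReal (4 ^ k) * ENNReal.ofReal
      (W.sqDensity (u (k + 1) - u k) x)).toReal,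
      fun k => ?_⟩
  have h4 := ENNReal.le_tsum (f := fun k => ENNReal.ofReal (4 ^ k) * ENNReal.ofReal
      (W.sqDensity (u (k + 1) - u k) x)) k
  rw [← ENNReal.ofReal_mul (by positivity), ENNReal.ofReal_le_iff_le_toReal hx.ne] at h4
  rw [one_div, inv_pow, ← div_eq_mul_inv, le_div_iff₀ (by positivity), mul_comm]
  exact h4

theorem aemeasurable_regularized_inverse [DecidableEq ι] (c : ℂ) {G : ℝ → ι → ℂ}
    (hG : Measurable G) : AEMeasurable (fun x => (W.density x + c • 1)⁻¹ *ᵥ G x) W.base := by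
  have hd : AEMeasurable (β := ι → ι → ℂ) (fun x => W.density x) W.base :=
    aemeasurable_pi_iff.2 fun i => aemeasurable_pi_iff.2 fun j => W.aemeasurable i j
  have hp : AEMeasurable (β := (ι → ι → ℂ) × (ι → ℂ)) (fun x => (W.density x, G x)) W.base :=
    hd.prodMk hG.aemeasurable
  have h := (measurable_regularized_inverse (ι := ι) c).comp_aemeasurable hp
  refine h.congr (Eventually.of_forall fun x => ?_)
  simp only [Function.comp_apply]
  rw [show Matrix.of (W.density x) = W.density x from rfl]

/-- At almost every x the sequence is Cauchy in the seminorm of W(x), which determines a limit only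
modulo the kernel of W(x). A Borel representative is obtained in two measurable limits: G = lim W
u_k, then the regularized inverses applied to G. The vector w is left free so that it can later be u
n x. -/
theorem exists_pointwise_limit (u : ℕ → W.PreL2)
    (hu : ∀ k, ‖u (k + 1) - u k‖ ≤ (1 / 4) ^ k) :
    ∃ f : ℝ → ι → ℂ, Measurable f ∧ ∀ᵐ x ∂W.base, ∀ w : ι → ℂ,
      Tendsto (fun k => star (w - u k x) ⬝ᵥ (W.density x *ᵥ (w - u k x))) atTop
        (𝓝 (star (w - f x) ⬝ᵥ (W.density x *ᵥ (w - f x)))) := by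
  classical
  have h1 := W.ae_sqDensity_le u hu
  have h2 : ∀ᵐ x ∂W.base, ∃ y, Tendsto (fun k => W.density x *ᵥ u k x) atTop
      (𝓝 (W.density x *ᵥ y)) ∧ ∀ w,
      Tendsto (fun k => star (w - u k x) ⬝ᵥ (W.density x *ᵥ (w - u k x))) atTop
        (𝓝 (star (w - y) ⬝ᵥ (W.density x *ᵥ (w - y)))) := by
    filter_upwards [h1, W.posSemidef] with x ⟨C, hC⟩ hx
    exact hx.exists_limit hC
  obtain ⟨G, hG, hGlim⟩ := measurable_limit_of_tendsto_metrizable_ae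
    (f := fun k x => W.density x *ᵥ u k x) (μ := W.base) (L := atTop)
    (fun k => W.aemeasurable_density_mulVec (u k).2.1.aemeasurable)
    (h2.mono fun x ⟨y, hy, _⟩ => ⟨_, hy⟩)
  have h3 : ∀ᵐ x ∂W.base, ∃ y, Tendsto (fun k : ℕ =>
      (W.density x + ((1 / (k + 1) : ℝ) : ℂ) • 1)⁻¹ *ᵥ G x) atTop (𝓝 y) ∧ ∀ w,
      Tendsto (fun k => star (w - u k x) ⬝ᵥ (W.density x *ᵥ (w - u k x))) atTop
        (𝓝 (star (w - y) ⬝ᵥ (W.density x *ᵥ (w - y)))) := by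
    filter_upwards [h2, hGlim, W.posSemidef] with x ⟨y, hy, hy'⟩ hx hp
    obtain ⟨y', h4, h5⟩ := hp.tendsto_regularized_inverse y
    rw [← tendsto_nhds_unique hx hy] at h4
    refine ⟨y', h4, fun w => ?_⟩
    -- The canonical preimage y' differs from the pointwise limit y by a kernel vector, which the
    -- quadratic form does not see.
    have h6 : W.density x *ᵥ (y - y') = 0 := by rw [mulVec_sub, h5, sub_self]
    have e : star (w - y') ⬝ᵥ (W.density x *ᵥ (w - y')) =
        star (w - y) ⬝ᵥ (W.density x *ᵥ (w - y)) := by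
      have e1 : w - y' = (w - y) + (y - y') := by abel
      rw [e1, mulVec_add, h6, add_zero, star_add, add_dotProduct]
      have e2 : star (y - y') ⬝ᵥ (W.density x *ᵥ (w - y)) = 0 := by
        rw [dotProduct_mulVec, ← hp.isHermitian.eq, ← star_mulVec, h6]
        simp
      rw [e2, add_zero]
    rw [e]
    exact hy' w
  obtain ⟨f, hf, hflim⟩ := measurable_limit_of_tendsto_metrizable_ae
    (f := fun (k : ℕ) x => (W.density x + ((1 / (k + 1) : ℝ) : ℂ) • 1)⁻¹ *ᵥ G x)
    (μ := W.base) (L := atTop)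
    (fun k => W.aemeasurable_regularized_inverse _ hG)
    (h3.mono fun x ⟨y, hy, _⟩ => ⟨_, hy⟩)
  refine ⟨f, hf, ?_⟩
  filter_upwards [h3, hflim] with x ⟨y, hy, hy'⟩ hx
  rwa [tendsto_nhds_unique hx hy]

/-- Riesz–Fischer for a degenerate weight: Fatou's lemma bounds the distance from u n to the
pointwise limit. The bound is stated with lower integrals because the limit is not yet known to be
square integrable; that follows from it. -/
instance : CompleteSpace W.PreL2 := by
  refine Metric.complete_of_convergent_controlled_sequences (fun k => (1 / 4 : ℝ) ^ k)
    (fun k => by positivity) fun u hu => ?_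
  obtain ⟨f, hf, hlim⟩ := W.exists_pointwise_limit u fun k => by
    rw [← dist_eq_norm]
    exact (hu k _ _ (by omega) le_rfl).le
  have h1 : ∀ N n, N ≤ n → ∫⁻ x, ENNReal.ofReal (W.pairing (u n - f) (u n - f) x).re ∂W.base ≤
      ENNReal.ofReal (((1 / 4) ^ N) ^ 2) := by
    intro N n hn
    have h2 : ∫⁻ x, ENNReal.ofReal (W.pairing (u n - f) (u n - f) x).re ∂W.base ≤
        ∫⁻ x, liminf (fun k => ENNReal.ofReal
          (W.sqDensity (u n - u k) x)) atTop ∂W.base := by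
      refine lintegral_mono_ae ?_
      filter_upwards [hlim] with x hx
      have h3 : Tendsto (fun k => ENNReal.ofReal
          (W.sqDensity (u n - u k) x)) atTop
          (𝓝 (ENNReal.ofReal (W.pairing (u n - f) (u n - f) x).re)) :=
        (ENNReal.continuous_ofReal.tendsto _).comp
          ((Complex.continuous_re.tendsto _).comp (hx (u n x)))
      rw [h3.liminf_eq]
    refine h2.trans ((lintegral_liminf_le' fun k =>
      (W.integrable_sqDensity _).aemeasurable.ennreal_ofReal).trans ?_)
    refine liminf_le_of_frequently_le' (Eventually.frequently ?_)
    filter_upwards [eventually_ge_atTop N] with k hk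
    rw [← ofReal_norm_sq]
    refine ENNReal.ofReal_le_ofReal ?_
    rw [← dist_eq_norm]
    have := (hu N n k hn hk).le
    gcongr
  have hmem : ∀ n, (u n : ℝ → ι → ℂ) - f ∈ W.sqIntegrable := fun n => by
    have hm : Measurable ((u n : ℝ → ι → ℂ) - f) := (u n).2.1.sub hf
    refine ⟨hm, (W.aemeasurable_pairing hm hm).aestronglyMeasurable, ?_⟩
    have e : ∫⁻ x, ‖W.pairing (u n - f) (u n - f) x‖ₑ ∂W.base =
        ∫⁻ x, ENNReal.ofReal (W.pairing (u n - f) (u n - f) x).re ∂W.base := by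
      refine lintegral_congr_ae ?_
      filter_upwards [W.pairing_self_nonneg (u n - f)] with x hx
      rw [← ofReal_norm, (Complex.ext_iff.1 (Complex.norm_of_nonneg' hx)).1.symm, Complex.ofReal_re]
    rw [HasFiniteIntegral, e]
    exact (h1 n n le_rfl).trans_lt ENNReal.ofReal_lt_top
  have hfm : f ∈ W.sqIntegrable := by
    have := W.sqIntegrable.sub_mem (u 0).2 (hmem 0)
    rwa [sub_sub_cancel] at this
  let F : W.PreL2 := ⟨f, hfm⟩
  refine ⟨F, ?_⟩
  rw [tendsto_iff_dist_tendsto_zero]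
  refine squeeze_zero (fun _ => dist_nonneg) (fun n => ?_)
    (tendsto_pow_atTop_nhds_zero_of_lt_one (r := (1 / 4 : ℝ)) (by norm_num) (by norm_num))
  rw [dist_eq_norm]
  have h2 := h1 n n le_rfl
  have h3 : ENNReal.ofReal (‖u n - F‖ ^ 2) ≤ ENNReal.ofReal (((1 / 4) ^ n) ^ 2) := by
    rw [ofReal_norm_sq]
    exact h2
  rw [ENNReal.ofReal_le_ofReal_iff (by positivity)] at h3
  exact (sq_le_sq₀ (norm_nonneg _) (by positivity)).1 h3

instance : CompleteSpace W.L2 := inferInstance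

end MatrixWeight

/-! ### Symmetric linear relations with compact resolvent -/

namespace LinearRel

variable {E : Type*} [NormedAddCommGroup E] [InnerProductSpace ℂ E]

/-- The relation `S` is symmetric and `(S - t₀)⁻¹` is the compact operator `R`. -/
structure HasCompactResolvent (S : Submodule ℂ (E × E)) (t₀ : ℝ) (R : E →L[ℂ] E) : Prop where
  mem : ∀ g, (R g, g + (t₀ : ℂ) • R g) ∈ S
  eq_of_mem : ∀ f g, (f, g) ∈ S → f = R (g - (t₀ : ℂ) • f)
  compact : IsCompactOperator R
  symm : ∀ f g f' g', (f, g) ∈ S → (f', g') ∈ S → inner ℂ g f' = inner ℂ f g'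

theorem mem_eigenspace_iff {S : Submodule ℂ (E × E)} {t : ℂ} {f : E} :
    f ∈ eigenspace S t ↔ (f, t • f) ∈ S := Iff.rfl

theorem mem_dom_iff {S : Submodule ℂ (E × E)} {f : E} : f ∈ dom S ↔ ∃ g, (f, g) ∈ S := by
  simp [dom]

theorem mem_multivaluedPart_iff {S : Submodule ℂ (E × E)} {g : E} :
    g ∈ multivaluedPart S ↔ (0, g) ∈ S := Iff.rfl

namespace HasCompactResolvent

variable {S : Submodule ℂ (E × E)} {t₀ : ℝ} {R : E →L[ℂ] E} (h : HasCompactResolvent S t₀ R)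
include h

theorem isSymmetric : (R : E →ₗ[ℂ] E).IsSymmetric := by
  intro f g
  have := h.symm _ _ _ _ (h.mem f) (h.mem g)
  simp only [inner_add_left, inner_add_right, inner_smul_left, inner_smul_right,
    Complex.conj_ofReal] at this
  simpa using this.symm

theorem mem_eigenspace_iff_resolvent {t : ℝ} {f : E} :
    f ∈ eigenspace S (t : ℂ) ↔ f = ((t : ℂ) - t₀) • R f := by
  rw [mem_eigenspace_iff]
  constructor
  · intro hf
    have := h.eq_of_mem _ _ hf
    rwa [← sub_smul, map_smul] at this
  · intro hf
    have := h.mem (((t : ℂ) - t₀) • f)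
    rw [map_smul, ← hf, ← add_smul, sub_add_cancel] at this
    exact this

theorem mem_multivaluedPart_iff_resolvent {g : E} : g ∈ multivaluedPart S ↔ R g = 0 := by
  rw [mem_multivaluedPart_iff]
  constructor
  · intro hg
    have := h.eq_of_mem _ _ hg
    rw [smul_zero, sub_zero] at this
    exact this.symm
  · intro hg
    have := h.mem g
    rwa [hg, smul_zero, add_zero] at this

theorem orthogonalFamily_eigenspace :
    OrthogonalFamily ℂ (fun t : ℝ => eigenspace S (t : ℂ))
      fun t => (eigenspace S (t : ℂ)).subtypeₗᵢ := by
  intro s t hst f g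
  have := h.symm _ _ _ _ (mem_eigenspace_iff.1 f.2) (mem_eigenspace_iff.1 g.2)
  simp only [inner_smul_left, inner_smul_right, Complex.conj_ofReal] at this
  have h0 : ((s : ℂ) - t) * inner ℂ (f : E) (g : E) = 0 := by rw [sub_mul, this, sub_self]
  refine (mul_eq_zero.1 h0).resolve_left ?_
  exact sub_ne_zero.2 (by exact_mod_cast hst)

theorem eigenspace_le_orthogonal (t : ℝ) : eigenspace S (t : ℂ) ≤ (multivaluedPart S)ᗮ := by
  intro f hf g hg
  have := h.symm _ _ _ _ (mem_multivaluedPart_iff.1 hg) (mem_eigenspace_iff.1 hf)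
  simpa using this

variable [CompleteSpace E]

/-- For t ≠ t₀ this is the eigenspace of the compact operator R at the nonzero number 1/(t − t₀),
and for t = t₀ it is trivial. -/
theorem finiteDimensional_eigenspace (t : ℝ) :
    FiniteDimensional ℂ (eigenspace S (t : ℂ)) := by
  by_cases ht : t = t₀
  · have : eigenspace S (t : ℂ) = ⊥ := by
      rw [eq_bot_iff]
      intro f hf
      rw [h.mem_eigenspace_iff_resolvent, ht, sub_self, zero_smul] at hf
      exact hf
    rw [this]
    infer_instance
  · have ht' : (t : ℂ) - t₀ ≠ 0 := by
      rw [sub_ne_zero]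
      exact_mod_cast ht
    have := ContinuousLinearMap.finite_dimensional_eigenspace h.compact ((t : ℂ) - t₀)⁻¹
      (inv_ne_zero ht')
    have e : eigenspace S (t : ℂ) = Module.End.eigenspace R.toLinearMap ((t : ℂ) - t₀)⁻¹ := by
      ext f
      rw [h.mem_eigenspace_iff_resolvent, Module.End.mem_eigenspace_iff,
        ContinuousLinearMap.coe_coe, eq_inv_smul_iff₀ ht', eq_comm]
    rw [e]
    exact this

/-- Subtract the projection of x onto the closed subspace S(0) = ker R. The rest is orthogonal to
ker R and, by hypothesis, to the eigenvectors of R with nonzero eigenvalue, so it vanishes by the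
spectral theorem for compact symmetric operators. -/
theorem mem_multivaluedPart_of_forall_inner {x : E}
    (hx : ∀ t : ℝ, ∀ f ∈ eigenspace S (t : ℂ), inner ℂ f x = 0) : x ∈ multivaluedPart S := by
  have hcl : IsClosed (multivaluedPart S : Set E) := by
    have : (multivaluedPart S : Set E) = R ⁻¹' {0} := by
      ext g
      exact h.mem_multivaluedPart_iff_resolvent
    rw [this]
    exact isClosed_singleton.preimage R.continuous
  have : CompleteSpace (multivaluedPart S) := hcl.completeSpace_coe
  set k := (multivaluedPart S).starProjection x with hk
  have hkm : k ∈ multivaluedPart S := Submodule.starProjection_apply_mem _ _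
  have hxk : x - k ∈ (multivaluedPart S)ᗮ := Submodule.sub_starProjection_mem_orthogonal x
  have h0 : x - k ∈ (⨆ μ, Module.End.eigenspace (R : Module.End ℂ E) μ)ᗮ := by
    rw [← Submodule.iInf_orthogonal, Submodule.mem_iInf]
    intro μ v hv
    rw [Module.End.mem_eigenspace_iff, ContinuousLinearMap.coe_coe] at hv
    by_cases hμ : μ = 0
    · rw [hμ, zero_smul] at hv
      exact hxk v (h.mem_multivaluedPart_iff_resolvent.2 hv)
    · by_cases hv0 : v = 0
      · rw [hv0, inner_zero_left]
      have hconj := h.isSymmetric.conj_eigenvalue_eq_self (μ := μ)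
        (Module.End.hasEigenvalue_of_hasEigenvector
          ⟨Module.End.mem_eigenspace_iff.2 hv, hv0⟩)
      obtain ⟨r, rfl⟩ := Complex.conj_eq_iff_real.1 hconj
      -- An eigenvalue r ≠ 0 of R = (S − t₀)⁻¹ corresponds to the eigenvalue t₀ + 1/r of S.
      have hve : v ∈ eigenspace S ((t₀ + r⁻¹ : ℝ) : ℂ) := by
        rw [h.mem_eigenspace_iff_resolvent, hv, smul_smul]
        push_cast
        rw [add_sub_cancel_left, inv_mul_cancel₀ hμ, one_smul]
      have h1 : inner ℂ v k = 0 := by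
        rw [← inner_conj_symm, h.eigenspace_le_orthogonal _ hve k hkm, map_zero]
      rw [inner_sub_right, hx _ v hve, h1, sub_zero]
  rw [ContinuousLinearMap.orthogonalComplement_iSup_eigenspaces_eq_bot h.compact h.isSymmetric,
    Submodule.mem_bot, sub_eq_zero] at h0
  rw [h0]
  exact hkm

theorem iSup_eigenspace_orthogonal :
    (⨆ t : ℝ, eigenspace S (t : ℂ))ᗮ = multivaluedPart S := by
  refine le_antisymm (fun x hx => h.mem_multivaluedPart_of_forall_inner fun t f hf => ?_) ?_
  · exact hx f (Submodule.mem_iSup_of_mem t hf)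
  · exact (Submodule.le_orthogonal_orthogonal _).trans
      (Submodule.orthogonal_le (iSup_le fun t => h.eigenspace_le_orthogonal t))

theorem closure_iSup_eigenspace :
    (⨆ t : ℝ, eigenspace S (t : ℂ)).topologicalClosure = (multivaluedPart S)ᗮ := by
  rw [← h.iSup_eigenspace_orthogonal, Submodule.orthogonal_orthogonal_eq_closure]

/-- The domain is the range of R, and the orthogonal complement of the range of a symmetric operator
is its kernel, here S(0). -/
theorem closure_dom : closure (dom S : Set E) = ((multivaluedPart S)ᗮ : Submodule ℂ E) := by
  have e : (dom S)ᗮ = multivaluedPart S := by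
    ext x
    rw [h.mem_multivaluedPart_iff_resolvent, Submodule.mem_orthogonal]
    constructor
    · intro hx
      have := hx (R (R x)) (mem_dom_iff.2 ⟨_, h.mem _⟩)
      have h2 : inner ℂ (R x) (R x) = 0 := by rw [← this]; exact (h.isSymmetric (R x) x).symm
      exact inner_self_eq_zero.1 h2
    · intro hx f hf
      obtain ⟨g, hg⟩ := mem_dom_iff.1 hf
      rw [h.eq_of_mem _ _ hg]
      have h2 := h.isSymmetric (g - (t₀ : ℂ) • f) x
      simp only [ContinuousLinearMap.coe_coe] at h2
      rw [h2, hx, inner_zero_right]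
  rw [← e, Submodule.orthogonal_orthogonal_eq_closure, Submodule.topologicalClosure_coe]

/-- Expansion of an element orthogonal to the multivalued part in eigenvectors. -/
theorem exists_hasSum {x : E} (hx : x ∈ (multivaluedPart S)ᗮ) :
    ∃ w : ℝ → E, (∀ t : ℝ, w t ∈ eigenspace S (t : ℂ)) ∧
      (∀ t : ℝ, ∀ f ∈ eigenspace S (t : ℂ), inner ℂ f (w t) = inner ℂ f x) ∧ HasSum w x := by
  have := h.finiteDimensional_eigenspace
  have hc : ∀ t : ℝ, CompleteSpace (eigenspace S (t : ℂ)) := fun t => FiniteDimensional.complete ℂ _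
  have hO := h.orthogonalFamily_eigenspace
  have hr := hO.range_linearIsometry
  simp only [Submodule.subtypeₗᵢ_toLinearMap, Submodule.range_subtype] at hr
  rw [h.closure_iSup_eigenspace] at hr
  rw [← hr] at hx
  obtain ⟨f, rfl⟩ := hx
  refine ⟨fun t => f t, fun t => (f t).2, fun t v hv => ?_, hO.hasSum_linearIsometry f⟩
  have h1 := (hO.hasSum_linearIsometry f).mapL (innerSL ℂ v)
  have h2 : HasSum (fun s => inner ℂ v (f s : E)) (inner ℂ v (f t : E)) := by
    refine hasSum_single t fun s hs => ?_
    exact hO hs.symm ⟨v, hv⟩ (f s)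
  exact h2.unique h1

/-- Orthogonal vectors with summable squared norms have a sum, by completeness. This produces
preimages under U. -/
theorem exists_of_summable {w : ℝ → E} (hw : ∀ t : ℝ, w t ∈ eigenspace S (t : ℂ))
    (hs : Summable fun t => ‖w t‖ ^ 2) : ∃ x ∈ (multivaluedPart S)ᗮ,
      ∀ t : ℝ, ∀ f ∈ eigenspace S (t : ℂ), inner ℂ f x = inner ℂ f (w t) := by
  have hO := h.orthogonalFamily_eigenspace
  obtain ⟨x, hx⟩ := (hO.summable_iff_norm_sq_summable fun t => ⟨w t, hw t⟩).2 hs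
  replace hx : HasSum w x := hx
  refine ⟨x, ?_, fun t v hv => ?_⟩
  · have hcl : IsClosed ((multivaluedPart S)ᗮ : Set E) := Submodule.isClosed_orthogonal _
    exact hcl.mem_of_tendsto hx (Eventually.of_forall fun s =>
      Submodule.sum_mem _ fun t _ => h.eigenspace_le_orthogonal t (hw t))
  · have h1 := hx.mapL (innerSL ℂ v)
    have h2 : HasSum (fun s => inner ℂ v (w s)) (inner ℂ v (w t)) := by
      refine hasSum_single t fun s hs => ?_
      exact hO hs.symm ⟨v, hv⟩ ⟨w s, hw s⟩
    exact h1.unique h2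

end HasCompactResolvent

/-- A choice of an orthonormal basis of every eigenspace. -/
structure EigenBasis (S : Submodule ℂ (E × E)) where
  dim : ℝ → ℕ
  vec : ∀ t, Fin (dim t) → E
  orthonormal : ∀ t, Orthonormal ℂ (vec t)
  span_eq : ∀ t : ℝ, Submodule.span ℂ (range (vec t)) = eigenspace S (t : ℂ)

theorem eq_sum_of_mem_span {ι : Type*} [Fintype ι] {v : ι → E} (hv : Orthonormal ℂ v) {x : E}
    (hx : x ∈ Submodule.span ℂ (range v)) : x = ∑ k, inner ℂ (v k) x • v k := by
  obtain ⟨c, rfl⟩ := (Submodule.mem_span_range_iff_exists_fun ℂ).1 hx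
  refine Finset.sum_congr rfl fun k _ => ?_
  rw [hv.inner_right_fintype]

theorem norm_sq_sum {ι : Type*} [Fintype ι] {v : ι → E} (hv : Orthonormal ℂ v) (c : ι → ℂ) :
    ‖∑ k, c k • v k‖ ^ 2 = ∑ k, ‖c k‖ ^ 2 := by
  have h := hv.inner_sum c c Finset.univ
  rw [inner_self_eq_norm_sq_to_K] at h
  have h2 : (((‖∑ k, c k • v k‖ ^ 2 : ℝ)) : ℂ) = ((∑ k, ‖c k‖ ^ 2 : ℝ) : ℂ) := by
    push_cast
    refine h.trans (Finset.sum_congr rfl fun k _ => ?_)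
    rw [Complex.conj_mul']
  exact_mod_cast h2

namespace EigenBasis

variable {S : Submodule ℂ (E × E)} (b : EigenBasis S)

theorem mem (t : ℝ) (k : Fin (b.dim t)) : b.vec t k ∈ eigenspace S (t : ℂ) := by
  rw [← b.span_eq]
  exact Submodule.subset_span ⟨k, rfl⟩

theorem inner_eq_zero {t : ℝ} {x : E} (hx : ∀ k, inner ℂ (b.vec t k) x = 0) {f : E}
    (hf : f ∈ eigenspace S (t : ℂ)) : inner ℂ f x = 0 := by
  rw [← b.span_eq] at hf
  rw [eq_sum_of_mem_span (b.orthonormal t) hf, sum_inner]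
  exact Finset.sum_eq_zero fun k _ => by rw [inner_smul_left, hx, mul_zero]

variable [CompleteSpace E] {t₀ : ℝ} {R : E →L[ℂ] E} (h : HasCompactResolvent S t₀ R)
include h

theorem _root_.LinearRel.HasCompactResolvent.nonempty_eigenBasis : Nonempty (EigenBasis S) := by
  have := h.finiteDimensional_eigenspace
  let β := fun t : ℝ => stdOrthonormalBasis ℂ (eigenspace S (t : ℂ))
  refine ⟨⟨fun t => Module.finrank ℂ (eigenspace S (t : ℂ)), fun t k => β t k, fun t => ?_,
    fun t => ?_⟩⟩
  · exact (β t).orthonormal.comp_linearIsometry (eigenspace S (t : ℂ)).subtypeₗᵢ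
  · have h1 : range (fun k => ((β t k : eigenspace S (t : ℂ)) : E)) =
        (eigenspace S (t : ℂ)).subtype '' range (β t) := by
      rw [← range_comp]
      rfl
    rw [h1, Submodule.span_image, ← OrthonormalBasis.coe_toBasis, Module.Basis.span_eq,
      Submodule.map_top, Submodule.range_subtype]

/-- Parseval's identity. Only one of the two vectors has to be orthogonal to S(0). The sum may run
over all real t, since the inner sum is empty unless t is an eigenvalue. -/
theorem hasSum_inner (x : E) {y : E} (hy : y ∈ (multivaluedPart S)ᗮ) :
    HasSum (fun t => ∑ k, inner ℂ x (b.vec t k) * inner ℂ (b.vec t k) y) (inner ℂ x y) := by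
  obtain ⟨w, hw, hwi, hs⟩ := h.exists_hasSum hy
  have h1 := hs.mapL (innerSL ℂ x)
  refine h1.congr_fun fun t => ?_
  have hwt := hw t
  rw [← b.span_eq] at hwt
  change _ = inner ℂ x (w t)
  rw [eq_sum_of_mem_span (b.orthonormal t) hwt, inner_sum]
  refine Finset.sum_congr rfl fun k _ => ?_
  rw [inner_smul_right, hwi t _ (b.mem t k), mul_comm]

theorem hasSum_norm_sq {y : E} (hy : y ∈ (multivaluedPart S)ᗮ) :
    HasSum (fun t => ∑ k, ‖inner ℂ (b.vec t k) y‖ ^ 2) (‖y‖ ^ 2) := by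
  have h1 := b.hasSum_inner h y hy
  rw [inner_self_eq_norm_sq_to_K] at h1
  have h2 : HasSum (fun t => (((∑ k, ‖inner ℂ (b.vec t k) y‖ ^ 2 : ℝ)) : ℂ))
      (((‖y‖ ^ 2 : ℝ)) : ℂ) := by
    push_cast
    refine h1.congr_fun fun t => Finset.sum_congr rfl fun k _ => ?_
    rw [← inner_conj_symm y, Complex.conj_mul']
  exact_mod_cast h2

end EigenBasis

end LinearRel

/-! ### Spectral representations in terms of eigenvectors -/

namespace LinearRel

variable {E : Type*} [NormedAddCommGroup E] [InnerProductSpace ℂ E]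
  {S : Submodule ℂ (E × E)} {t₀ : ℝ} {R : E →L[ℂ] E} {n : ℕ} {ρ : MatrixMeasure n}

/-- The measure `ρ` is the sum of the point masses `∑ₖ cₖ(t) cₖ(t)*`. -/
structure IsDiscrete (ρ : MatrixMeasure n) (b : EigenBasis S)
    (c : ∀ t, Fin (b.dim t) → Fin n → ℂ) : Prop where
  hasSum : ∀ F : ρ.PreL2, HasSum (fun t => ∑ k, ‖star (c t k) ⬝ᵥ F t‖ ^ 2) (‖F‖ ^ 2)
  mem : ∀ F : ℝ → Fin n → ℂ, Measurable F →
    (Summable fun t => ∑ k, ‖star (c t k) ⬝ᵥ F t‖ ^ 2) → F ∈ ρ.sqIntegrable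

/-- The squared distance is the sum of the squared differences of the coordinates c*F(t), so these
are complete coordinates on L²(ρ). -/
theorem IsDiscrete.toL2_eq {b : EigenBasis S} {c : ∀ t, Fin (b.dim t) → Fin n → ℂ}
    (hc : IsDiscrete ρ b c) {F G : ρ.PreL2} :
    ρ.toL2 F = ρ.toL2 G ↔ ∀ t k, star (c t k) ⬝ᵥ F t = star (c t k) ⬝ᵥ G t := by
  have h1 : ρ.toL2 F = ρ.toL2 G ↔ ‖F - G‖ ^ 2 = 0 := by
    rw [← ρ.norm_toL2, sq_eq_zero_iff, norm_eq_zero,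
      show ρ.toL2 (F - G) = ρ.toL2 F - ρ.toL2 G from rfl, sub_eq_zero]
  have h2 := hc.hasSum (F - G)
  have h3 : ∀ t k, star (c t k) ⬝ᵥ (F - G : ρ.PreL2) t =
      star (c t k) ⬝ᵥ F t - star (c t k) ⬝ᵥ G t := fun t k => by
    rw [ρ.coe_sub, Pi.sub_apply, dotProduct_sub]
  rw [h1]
  constructor
  · intro h0 t k
    rw [h0, hasSum_zero_iff_of_nonneg fun t => by positivity] at h2
    have h4 := congrFun h2 t
    rw [Pi.zero_apply, Finset.sum_eq_zero_iff_of_nonneg fun k _ => by positivity] at h4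
    have h5 := h4 k (Finset.mem_univ k)
    rwa [sq_eq_zero_iff, norm_eq_zero, h3, sub_eq_zero] at h5
  · intro h0
    refine h2.unique ?_
    convert! hasSum_zero using 2 with t
    exact Finset.sum_eq_zero fun k _ => by rw [h3, h0 t k, sub_self]; simp

variable [CompleteSpace E] (h : HasCompactResolvent S t₀ R) (b : EigenBasis S)
  {c : ∀ t, Fin (b.dim t) → Fin n → ℂ} (hc : IsDiscrete ρ b c) {U : E →ₗ[ℂ] ρ.L2}
  (hU : ∀ x, ∃ F : ρ.PreL2, U x = ρ.toL2 F ∧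
    ∀ t k, star (c t k) ⬝ᵥ F t = inner ℂ (b.vec t k) x)
include h hc hU

theorem norm_map_of_mem {x : E} (hx : x ∈ (multivaluedPart S)ᗮ) : ‖U x‖ = ‖x‖ := by
  obtain ⟨F, hF, hF'⟩ := hU x
  have h1 := hc.hasSum F
  simp only [hF'] at h1
  have h2 := h1.unique (b.hasSum_norm_sq h hx)
  rw [hF, ρ.norm_toL2]
  exact (sq_eq_sq₀ (norm_nonneg _) (norm_nonneg _)).1 h2

theorem map_eq_zero_iff_mem {x : E} : U x = 0 ↔ x ∈ multivaluedPart S := by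
  obtain ⟨F, hF, hF'⟩ := hU x
  have h0 : U x = 0 ↔ ∀ t k, inner ℂ (b.vec t k) x = 0 := by
    rw [hF, show (0 : ρ.L2) = ρ.toL2 0 from rfl, hc.toL2_eq]
    refine forall_congr' fun t => forall_congr' fun k => ?_
    rw [hF', show (0 : ρ.PreL2) t = 0 from rfl, dotProduct_zero]
  rw [h0]
  constructor
  · intro hx
    exact h.mem_multivaluedPart_of_forall_inner fun t f hf => b.inner_eq_zero (hx t) hf
  · intro hx t k
    rw [← inner_conj_symm, h.eigenspace_le_orthogonal t (b.mem t k) x hx, map_zero]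

theorem exists_map_eq (y : ρ.L2) : ∃ x ∈ (multivaluedPart S)ᗮ, U x = y := by
  obtain ⟨F, rfl⟩ := SeparationQuotient.surjective_mk y
  have hs := (hc.hasSum F).summable
  obtain ⟨x, hx, hx'⟩ := h.exists_of_summable
    (w := fun t => ∑ k, (star (c t k) ⬝ᵥ F t) • b.vec t k)
    (fun t => Submodule.sum_mem _ fun k _ => Submodule.smul_mem _ _ (b.mem t k))
    (hs.congr fun t => (norm_sq_sum (b.orthonormal t) _).symm)
  refine ⟨x, hx, ?_⟩
  obtain ⟨G, hG, hG'⟩ := hU x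
  rw [hG]
  refine hc.toL2_eq.2 fun t k => ?_
  rw [hG', hx' t _ (b.mem t k), (b.orthonormal t).inner_right_fintype]

/-- Surjectivity supplies x' orthogonal to S(0) with the same image as x. Then x − x' lies in S(0),
invisible to y, and U preserves inner products on the complement of S(0). -/
theorem inner_map_of_mem (x : E) {y : E} (hy : y ∈ (multivaluedPart S)ᗮ) :
    inner ℂ (U x) (U y) = inner ℂ x y := by
  obtain ⟨x', hx', hxx⟩ := exists_map_eq h b hc hU (U x)
  have h0 : x - x' ∈ multivaluedPart S := by
    rw [← map_eq_zero_iff_mem h b hc hU, map_sub, hxx, sub_self]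
  let V : ((multivaluedPart S)ᗮ : Submodule ℂ E) →ₗᵢ[ℂ] ρ.L2 :=
    { toLinearMap := U.comp ((multivaluedPart S)ᗮ).subtype
      norm_map' := fun x => norm_map_of_mem h b hc hU x.2 }
  have h1 : inner ℂ (U x') (U y) = inner ℂ x' y := V.inner_map_map ⟨x', hx'⟩ ⟨y, hy⟩
  have h2 : inner ℂ (x - x') y = 0 := hy _ h0
  rw [inner_sub_left, sub_eq_zero] at h2
  rw [h2, ← h1, hxx]

/-- U is a partial isometry onto L²(ρ), so its adjoint inverts its restriction to the complement of
S(0). -/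
theorem mem_adjoint_graph_iff {y : ρ.L2} {x : E} :
    (y, x) ∈ U.graph.adjoint ↔ x ∈ (multivaluedPart S)ᗮ ∧ U x = y := by
  rw [Submodule.mem_adjoint_iff]
  simp only [LinearMap.mem_graph_iff]
  constructor
  · intro hx
    have h1 : x ∈ (multivaluedPart S)ᗮ := fun f hf => by
      have := hx f 0 ((map_eq_zero_iff_mem h b hc hU).2 hf).symm
      simpa using this
    refine ⟨h1, ?_⟩
    have h2 : ∀ f, inner ℂ (U f) (y - U x) = 0 := fun f => by
      rw [inner_sub_right, inner_map_of_mem h b hc hU f h1]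
      exact hx f _ rfl
    obtain ⟨f, -, hf⟩ := exists_map_eq h b hc hU (y - U x)
    have h3 := h2 f
    rw [hf, inner_self_eq_zero, sub_eq_zero] at h3
    exact h3.symm
  · rintro ⟨hx, rfl⟩ f _ rfl
    rw [inner_map_of_mem h b hc hU f hx, sub_self]

omit [CompleteSpace E] in
-- Symmetry of S against an eigenvector φ at t gives ⟨φ, g⟩ = t⟨φ, f⟩. Hence tF has the coordinates
-- of G; in particular it is square integrable.
theorem mem_mulVar_of_mem {f g : E} (hfg : (f, g) ∈ S) : (U f, U g) ∈ ρ.mulVar := by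
  obtain ⟨F, hF, hF'⟩ := hU f
  obtain ⟨G, hG, hG'⟩ := hU g
  have e : ∀ t k, star (c t k) ⬝ᵥ ((t : ℂ) • F t) = star (c t k) ⬝ᵥ G t := fun t k => by
    have := h.symm _ _ _ _ (mem_eigenspace_iff.1 (b.mem t k)) hfg
    rw [dotProduct_smul, hF', hG', ← this, inner_smul_left, Complex.conj_ofReal, smul_eq_mul]
  have hm : (fun t : ℝ => (t : ℂ) • F t) ∈ ρ.sqIntegrable := by
    refine hc.mem _ (Complex.measurable_ofReal.smul F.2.1) ?_
    simp only [e]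
    exact (hc.hasSum G).summable
  refine ⟨F, ⟨_, hm⟩, hF.symm, ?_, fun t => rfl⟩
  rw [hG]
  exact hc.toL2_eq.2 e

/-- It suffices that f = R(g − t₀f). Both sides are orthogonal to S(0) and have the same Fourier
coefficients, since t − t₀ times either one is the coefficient of g − t₀f. -/
theorem mem_of_mem_mulVar {f g : E} (hf : f ∈ (multivaluedPart S)ᗮ)
    (hfg : (U f, U g) ∈ ρ.mulVar) : (f, g) ∈ S := by
  obtain ⟨F, G, hF, hG, e⟩ := hfg
  simp only at hF hG
  obtain ⟨F', hF', hF''⟩ := hU f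
  obtain ⟨G', hG', hG''⟩ := hU g
  rw [hF', hc.toL2_eq] at hF
  rw [hG', hc.toL2_eq] at hG
  have key : R (g - (t₀ : ℂ) • f) = f := by
    have hR : R (g - (t₀ : ℂ) • f) ∈ (multivaluedPart S)ᗮ := by
      have : R (g - (t₀ : ℂ) • f) ∈ closure (dom S : Set E) :=
        subset_closure (mem_dom_iff.2 ⟨_, h.mem _⟩)
      rwa [h.closure_dom] at this
    have h1 : R (g - (t₀ : ℂ) • f) - f ∈ multivaluedPart S := by
      refine h.mem_multivaluedPart_of_forall_inner fun t v hv =>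
        b.inner_eq_zero (fun k => ?_) hv
      have hφ := (h.mem_eigenspace_iff_resolvent).1 (b.mem t k)
      have ht : (t : ℂ) - t₀ ≠ 0 := fun h0 => by
        rw [h0, zero_smul] at hφ
        exact (b.orthonormal t).ne_zero k hφ
      have e1 : inner ℂ (b.vec t k) (g - (t₀ : ℂ) • f) =
          ((t : ℂ) - t₀) * inner ℂ (b.vec t k) (R (g - (t₀ : ℂ) • f)) := by
        have hs := h.isSymmetric (b.vec t k) (g - (t₀ : ℂ) • f)
        simp only [ContinuousLinearMap.coe_coe] at hs
        conv_lhs => rw [hφ]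
        rw [inner_smul_left, hs, map_sub, Complex.conj_ofReal, Complex.conj_ofReal]
      have e2 : inner ℂ (b.vec t k) (g - (t₀ : ℂ) • f) =
          ((t : ℂ) - t₀) * inner ℂ (b.vec t k) f := by
        rw [inner_sub_right, inner_smul_right, ← hF'', ← hG'', ← hF, ← hG, e, dotProduct_smul,
          smul_eq_mul, sub_mul]
      rw [inner_sub_right, sub_eq_zero]
      exact mul_left_cancel₀ ht (e1.symm.trans e2)
    have h2 := (sub_mem hR hf) _ h1
    rw [inner_self_eq_zero, sub_eq_zero] at h2
    exact h2
  have := h.mem (g - (t₀ : ℂ) • f)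
  rwa [key, sub_add_cancel] at this

theorem isSpectralRepresentation : IsSpectralRepresentation S ρ U where
  isometry x hx := by
    rw [h.closure_dom] at hx
    exact norm_map_of_mem h b hc hU hx
  surjOn y _ := by
    rw [h.closure_dom]
    obtain ⟨x, hx, hxy⟩ := exists_map_eq h b hc hU y
    exact ⟨x, hx, hxy⟩
  ker_eq := by
    ext x
    rw [LinearMap.mem_ker, map_eq_zero_iff_mem h b hc hU]
  conj_eq := by
    ext ⟨y, y'⟩
    constructor
    · rintro ⟨g, ⟨f, h1, h2⟩, h3⟩
      rw [mem_adjoint_graph_iff h b hc hU] at h1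
      have h3' : y' = U g := (LinearMap.mem_graph_iff _ _).1 h3
      rw [h3', show y = U f from h1.2.symm]
      exact mem_mulVar_of_mem h b hc hU h2
    · intro hy
      obtain ⟨f, hf, rfl⟩ := exists_map_eq h b hc hU y
      obtain ⟨g, -, rfl⟩ := exists_map_eq h b hc hU y'
      exact ⟨g, ⟨f, (mem_adjoint_graph_iff h b hc hU).2 ⟨hf, rfl⟩,
        mem_of_mem_mulVar h b hc hU hf hy⟩, (LinearMap.mem_graph_iff _ _).2 rfl⟩

end LinearRel

/-! ### Matrix measures -/

namespace MatrixMeasure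

variable {n : ℕ} (ρ : MatrixMeasure n)

instance : IsLocallyFiniteMeasure ρ.base := ρ.locallyFinite

/-- Nonnegativity and trace 1 bound the diagonal entries by 1, and an off-diagonal entry is at most
the sum of two of them. Only boundedness is needed. -/
theorem norm_density_le (i j : Fin n) : ∀ᵐ t ∂ρ.base, ‖ρ.density t i j‖ ≤ 2 := by
  filter_upwards [ρ.norm_pairing_le (fun _ => Pi.single i 1) (fun _ => Pi.single j 1),
    ρ.trace_eq_one, ρ.posSemidef] with t h1 h2 h3
  have e : ∀ k l, ρ.pairing (fun _ => Pi.single k 1) (fun _ => Pi.single l 1) t =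
      ρ.density t k l := fun k l => by simp [MatrixWeight.pairing]
  rw [e, e, e] at h1
  have h4 : ∀ k, ‖ρ.density t k k‖ ≤ 1 := by
    intro k
    have h5 : ∀ l, 0 ≤ ρ.density t l l := fun l => h3.diag_nonneg
    have h6 : ρ.density t k k ≤ 1 := by
      rw [← h2]
      exact Finset.single_le_sum (f := fun l => ρ.density t l l) (fun l _ => h5 l)
        (Finset.mem_univ k)
    rw [← Complex.norm_of_nonneg' (h5 k)] at h6
    exact_mod_cast h6
  refine h1.trans ((norm_add_le _ _).trans ?_)
  linarith [h4 i, h4 j]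

theorem value_singleton (t : ℝ) : ρ.value {t} = (ρ.base.real {t} : ℂ) • ρ.density t := by
  ext i j
  rw [value, of_apply, integral_singleton, Matrix.smul_apply, smul_eq_mul]
  exact Complex.real_smul

theorem setIntegral_sqDensity (F : ℝ → Fin n → ℂ) (t : ℝ) {M : ℕ} {c : Fin M → Fin n → ℂ}
    (hv : ρ.value {t} = ∑ k, vecMulVec (c k) (star (c k))) :
    ∫ s in {t}, ρ.pairing F F s ∂ρ.base = ((∑ k, ‖star (c k) ⬝ᵥ F t‖ ^ 2 : ℝ) : ℂ) := by
  rw [integral_singleton]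
  have e : ρ.base.real {t} • ρ.pairing F F t = star (F t) ⬝ᵥ (ρ.value {t} *ᵥ F t) := by
    rw [value_singleton, smul_mulVec, dotProduct_smul]
    rfl
  rw [e, hv, sum_mulVec, dotProduct_sum]
  push_cast
  refine Finset.sum_congr rfl fun k _ => ?_
  rw [vecMulVec_mulVec, dotProduct_smul, ← Complex.conj_mul', ← starRingEnd_apply]
  have e2 : star (star (c k) ⬝ᵥ F t) = star (F t) ⬝ᵥ c k := by
    rw [star_dotProduct, star_star]
  simp only [MulOpposite.smul_eq_mul_unop, MulOpposite.unop_op]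
  rw [← e2]
  rfl

/-- The trace measure lives on a countable set, so integrals are sums over points, and the mass Σ
cc* turns F*ρ({t})F into Σ |c*F(t)|². -/
theorem isDiscrete {E : Type*} [NormedAddCommGroup E] [InnerProductSpace ℂ E]
    {S : Submodule ℂ (E × E)} (b : LinearRel.EigenBasis S) (c : ∀ t, Fin (b.dim t) → Fin n → ℂ)
    (hΛ : (LinearRel.eigenvalues S).Countable) (h0 : ρ.base (LinearRel.eigenvalues S)ᶜ = 0)
    (hv : ∀ t ∈ LinearRel.eigenvalues S, ρ.value {t} = ∑ k, vecMulVec (c t k) (star (c t k))) :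
    LinearRel.IsDiscrete ρ b c := by
  set Λ := LinearRel.eigenvalues S with hΛdef
  have hdim : ∀ F : ℝ → Fin n → ℂ, ∀ t ∉ Λ, ∑ k, ‖star (c t k) ⬝ᵥ F t‖ ^ 2 = 0 := by
    intro F t ht
    have h1 : LinearRel.eigenspace S (t : ℂ) = ⊥ := by
      by_contra h
      exact ht h
    refine Finset.sum_eq_zero fun k _ => ?_
    have h2 := b.mem t k
    rw [h1, Submodule.mem_bot] at h2
    exact absurd h2 ((b.orthonormal t).ne_zero k)
  have : Countable Λ := hΛ
  have hU : ⋃ t : Λ, ({(t : ℝ)} : Set ℝ) = Λ := by simp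
  have hres : ρ.base.restrict Λ = ρ.base :=
    Measure.restrict_eq_self_of_ae_mem (by rwa [← mem_ae_iff] at h0)
  have hsub : ∀ (F : ℝ → Fin n → ℂ) (x : ℝ),
      (HasSum (fun t : Λ => ∑ k, ‖star (c t k) ⬝ᵥ F t‖ ^ 2) x ↔
        HasSum (fun t : ℝ => ∑ k, ‖star (c t k) ⬝ᵥ F t‖ ^ 2) x) := fun F x =>
    hasSum_subtype_iff_of_support_subset (f := fun t : ℝ => ∑ k, ‖star (c t k) ⬝ᵥ F t‖ ^ 2)
      fun t ht => by
        by_contra h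
        exact ht (hdim F t h)
  refine ⟨fun F => ?_, fun F hF hs => ?_⟩
  · rw [← hsub]
    have hI : IntegrableOn (ρ.pairing F F) (⋃ t : Λ, ({(t : ℝ)} : Set ℝ)) ρ.base :=
      (ρ.integrable_pairing F F).integrableOn
    have h1 := hasSum_integral_iUnion (fun t : Λ => measurableSet_singleton (t : ℝ))
      (fun s t hst => by simpa [Function.onFun] using fun h => hst (Subtype.ext h)) hI
    rw [hU, hres] at h1
    have e : ∫ x, ρ.pairing F F x ∂ρ.base = ((‖F‖ ^ 2 : ℝ) : ℂ) := by
      rw [← ρ.inner_def, inner_self_eq_norm_sq_to_K]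
      push_cast
      rfl
    rw [e] at h1
    have h2 : HasSum (fun t : Λ => ((∑ k, ‖star (c t k) ⬝ᵥ F t‖ ^ 2 : ℝ) : ℂ))
        ((‖F‖ ^ 2 : ℝ) : ℂ) :=
      h1.congr_fun fun t => (ρ.setIntegral_sqDensity F t (hv t t.2)).symm
    exact_mod_cast h2
  · refine ⟨hF, ?_⟩
    have hm : AEStronglyMeasurable (ρ.pairing F F) ρ.base :=
      (ρ.aemeasurable_pairing hF hF).aestronglyMeasurable
    rw [← hres, ← hU]
    refine integrableOn_iUnion_of_summable_integral_norm (fun t => ?_) ?_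
    · exact integrableOn_singleton (hx := isCompact_singleton.measure_lt_top)
    · obtain ⟨x, hx⟩ := hs
      refine ((hsub F x).2 hx).summable.congr fun t => ?_
      have h1 := ρ.setIntegral_sqDensity F t (hv t t.2)
      have h2 : ∀ᵐ s ∂ρ.base.restrict {(t : ℝ)}, ((‖ρ.pairing F F s‖ : ℝ) : ℂ) =
          ρ.pairing F F s :=
        (ae_restrict_of_ae (ρ.pairing_self_nonneg F)).mono fun s hs => Complex.norm_of_nonneg' hs
      have h3 : ((∫ s in {(t : ℝ)}, ‖ρ.pairing F F s‖ ∂ρ.base : ℝ) : ℂ) =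
          ((∑ k, ‖star (c t k) ⬝ᵥ F t‖ ^ 2 : ℝ) : ℂ) := by
        rw [← h1, ← integral_congr_ae h2]
        exact integral_complex_ofReal.symm
      exact_mod_cast h3.symm

end MatrixMeasure

/-! ### Uniqueness of Herglotz representations -/

/-- Cover the interval by N intervals of radius ε = (q − p)/N. Their total mass is at most NCε² =
C(q − p)²/N, which tends to 0. -/
theorem MeasureTheory.Measure.Ioo_eq_zero_of_le_sq (μ : Measure ℝ) [IsLocallyFiniteMeasure μ]
    {p q C δ : ℝ} (hδ : 0 < δ)
    (h : ∀ x ∈ Icc p q, ∀ ε ∈ Ioo 0 δ, μ.real (Ioo (x - ε) (x + ε)) ≤ C * ε ^ 2) :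
    μ (Ioo p q) = 0 := by
  rcases le_or_gt q p with hpq | hpq
  · simp [Ioo_eq_empty_of_le hpq]
  have hL : 0 < q - p := sub_pos.2 hpq
  have hfin : ∀ c d : ℝ, μ (Ioo c d) ≠ ⊤ := fun c d => measure_Ioo_lt_top.ne
  have key : ∀ᶠ N : ℕ in atTop, μ.real (Ioo p q) ≤ C * (q - p) ^ 2 / N := by
    have h1 : ∀ᶠ N : ℕ in atTop, (q - p) / N < δ :=
      (tendsto_const_div_atTop_nhds_zero_nat (q - p)).eventually_lt_const hδ
    filter_upwards [h1, eventually_gt_atTop 0] with N hN hN0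
    have hN0' : (0 : ℝ) < N := by exact_mod_cast hN0
    set ε := (q - p) / N with hε
    have hε0 : 0 < ε := div_pos hL hN0'
    have hεN : ε * N = q - p := div_mul_cancel₀ _ hN0'.ne'
    have hsub : Ioo p q ⊆ ⋃ k ∈ Finset.range N, Ioo (p + k * ε - ε) (p + k * ε + ε) := by
      intro s hs
      have h0 : 0 ≤ (s - p) / ε := div_nonneg (by linarith [hs.1]) hε0.le
      have hk1 := Nat.floor_le h0
      have hk2 := Nat.lt_floor_add_one ((s - p) / ε)
      rw [le_div_iff₀ hε0] at hk1
      rw [div_lt_iff₀ hε0] at hk2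
      simp only [mem_iUnion, Finset.mem_range]
      refine ⟨⌊(s - p) / ε⌋₊, ?_, by linarith, by linarith⟩
      have : (⌊(s - p) / ε⌋₊ : ℝ) < N := by
        by_contra hc
        rw [not_lt] at hc
        have := mul_le_mul_of_nonneg_right hc hε0.le
        linarith [hs.2]
      exact_mod_cast this
    calc μ.real (Ioo p q) ≤ μ.real (⋃ k ∈ Finset.range N, Ioo (p + k * ε - ε) (p + k * ε + ε)) :=
          measureReal_mono hsub
            ((measure_biUnion_lt_top (Finset.finite_toSet _) fun k _ => (hfin _ _).lt_top).ne)
      _ ≤ ∑ k ∈ Finset.range N, μ.real (Ioo (p + k * ε - ε) (p + k * ε + ε)) :=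
          measureReal_biUnion_finset_le _ _
      _ ≤ ∑ k ∈ Finset.range N, C * ε ^ 2 := by
          refine Finset.sum_le_sum fun k hk => h _ ⟨?_, ?_⟩ ε ⟨hε0, hN⟩
          · have : 0 ≤ (k : ℝ) * ε := by positivity
            linarith
          · have h2 : (k : ℝ) ≤ N := by exact_mod_cast (Finset.mem_range.1 hk).le
            have := mul_le_mul_of_nonneg_right h2 hε0.le
            linarith
      _ = C * (q - p) ^ 2 / N := by
          rw [Finset.sum_const, Finset.card_range, nsmul_eq_mul, hε]
          field_simp
  have h0 : μ.real (Ioo p q) ≤ 0 :=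
    ge_of_tendsto (tendsto_const_div_atTop_nhds_zero_nat (C * (q - p) ^ 2)) key
  exact (measureReal_eq_zero_iff (hfin p q)).1 (le_antisymm h0 measureReal_nonneg)

/-- The kernel of Herglotz representations. -/
noncomputable def herglotzKernel (z : ℂ) (t : ℝ) : ℂ :=
  1 / ((t : ℂ) - z) - (t : ℂ) / ((t : ℂ) ^ 2 + 1)

theorem Complex.ofReal_sub_ne_zero {z : ℂ} (hz : 0 < z.im) (t : ℝ) : (t : ℂ) - z ≠ 0 := by
  intro h
  have := congrArg Complex.im h
  simp at this
  exact hz.ne' this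

theorem Complex.im_le_norm_ofReal_sub {z : ℂ} (hz : 0 < z.im) (t : ℝ) : z.im ≤ ‖(t : ℂ) - z‖ := by
  have := Complex.abs_im_le_norm ((t : ℂ) - z)
  simpa [abs_of_pos hz] using this

theorem Complex.ofReal_sq_add_one_ne_zero (t : ℝ) : (t : ℂ) ^ 2 + 1 ≠ 0 := by
  have : (t ^ 2 + 1 : ℝ) ≠ 0 := by positivity
  exact_mod_cast this

/-- This form exhibits the decay 1/(1 + t²) that makes the kernel integrable. -/
theorem herglotzKernel_eq {z : ℂ} (hz : 0 < z.im) (t : ℝ) :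
    herglotzKernel z t = (z + (1 + z ^ 2) / ((t : ℂ) - z)) / ((t : ℂ) ^ 2 + 1) := by
  have h1 := Complex.ofReal_sub_ne_zero hz t
  have h2 := Complex.ofReal_sq_add_one_ne_zero t
  rw [herglotzKernel]
  field_simp
  ring

theorem norm_herglotzKernel_le {z : ℂ} (hz : 0 < z.im) (t : ℝ) :
    ‖herglotzKernel z t‖ ≤ (‖z‖ + ‖1 + z ^ 2‖ / z.im) * (1 / (1 + t ^ 2)) := by
  have h2 : ‖(t : ℂ) ^ 2 + 1‖ = 1 + t ^ 2 := by
    have : ((t : ℂ) ^ 2 + 1) = ((1 + t ^ 2 : ℝ) : ℂ) := by push_cast; ring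
    rw [this, Complex.norm_real, Real.norm_of_nonneg (by positivity)]
  rw [herglotzKernel_eq hz, norm_div, h2, div_eq_mul_one_div]
  gcongr
  refine (norm_add_le _ _).trans ?_
  rw [norm_div]
  gcongr
  exact Complex.im_le_norm_ofReal_sub hz t

theorem herglotzKernel_im (z : ℂ) (t : ℝ) :
    (herglotzKernel z t).im = z.im * (1 / ‖(t : ℂ) - z‖ ^ 2) := by
  have : (t : ℂ) / ((t : ℂ) ^ 2 + 1) = ((t / (t ^ 2 + 1) : ℝ) : ℂ) := by push_cast; rfl
  rw [herglotzKernel, this, Complex.sub_im, Complex.ofReal_im, sub_zero, one_div, Complex.inv_im,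
    Complex.normSq_eq_norm_sq]
  simp [div_eq_mul_inv]

@[fun_prop]
theorem measurable_herglotzKernel (z : ℂ) : Measurable (herglotzKernel z) := by
  unfold herglotzKernel
  fun_prop

namespace IsHerglotzRepresentation

variable {n : ℕ} {m : ℂ → Matrix (Fin n) (Fin n) ℂ} {A B A₀ B₀ : Matrix (Fin n) (Fin n) ℂ}
  {ρ ρ₀ : MatrixMeasure n}

theorem integrable_kernel (h : IsHerglotzRepresentation m A B ρ) {z : ℂ} (hz : 0 < z.im) :
    Integrable (herglotzKernel z) ρ.base :=
  (h.integrable.const_mul _).mono' (measurable_herglotzKernel z).aestronglyMeasurable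
    (Eventually.of_forall fun t => norm_herglotzKernel_le hz t)

theorem integrable_kernel_mul (h : IsHerglotzRepresentation m A B ρ) {z : ℂ} (hz : 0 < z.im)
    (i j : Fin n) : Integrable (fun t => herglotzKernel z t * ρ.density t i j) ρ.base := by
  exact ((h.integrable_kernel hz).bdd_mul (ρ.aemeasurable i j).aestronglyMeasurable
    (ρ.norm_density_le i j)).congr (Eventually.of_forall fun t => mul_comm _ _)

/-- Stieltjes inversion for point masses: −iε/(s − t − iε) equals 1 at s = t and tends to 0
elsewhere, while −iε times the kernel stays dominated by a multiple of 1/(1 + s²). -/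
theorem tendsto_value_singleton (h : IsHerglotzRepresentation m A B ρ) (t : ℝ) (i j : Fin n) :
    Tendsto (fun ε : ℝ => -(Complex.I * ε) * m (t + ε * Complex.I) i j) (𝓝[>] 0)
      (𝓝 (ρ.value {t} i j)) := by
  have him : ∀ ε : ℝ, ((t : ℂ) + ε * Complex.I).im = ε := fun ε => by simp
  have hI : Tendsto (fun ε : ℝ => ∫ s, -(Complex.I * ε) * herglotzKernel (t + ε * Complex.I) s *
      ρ.density s i j ∂ρ.base) (𝓝[>] 0)
      (𝓝 (∫ s, ({t} : Set ℝ).indicator (fun s => ρ.density s i j) s ∂ρ.base)) := by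
    refine tendsto_integral_filter_of_dominated_convergence
      -- From `norm_herglotzKernel_le` with Im z = ε ≤ 1 and |z| ≤ |t| + 1, after the factor ε has
      -- cancelled 1/Im z; the final 2 bounds the density.
      (fun s => ((|t| + 1) + (1 + (|t| + 1) ^ 2)) * (1 / (1 + s ^ 2)) * 2)
      (Eventually.of_forall fun ε => ?_) ?_ ((h.integrable.const_mul _).mul_const _) ?_
    · exact (((measurable_herglotzKernel _).const_mul _).aemeasurable.mul
        (ρ.aemeasurable i j)).aestronglyMeasurable
    · filter_upwards [Ioc_mem_nhdsGT (zero_lt_one' ℝ)] with ε hε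
      filter_upwards [ρ.norm_density_le i j] with s hs
      have hz : 0 < ((t : ℂ) + ε * Complex.I).im := by rw [him]; exact hε.1
      have hn : ‖(t : ℂ) + ε * Complex.I‖ ≤ |t| + 1 := by
        refine (norm_add_le _ _).trans ?_
        rw [norm_mul, Complex.norm_I, mul_one, Complex.norm_real, Complex.norm_real,
          Real.norm_eq_abs, Real.norm_eq_abs, abs_of_pos hε.1]
        linarith [hε.2]
      have hk := norm_herglotzKernel_le hz s
      rw [him] at hk
      rw [norm_mul, norm_mul, norm_neg, norm_mul, Complex.norm_I, one_mul, Complex.norm_real,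
        Real.norm_of_nonneg hε.1.le]
      refine mul_le_mul ?_ hs (norm_nonneg _) (by positivity)
      calc ε * ‖herglotzKernel (t + ε * Complex.I) s‖
          ≤ ε * ((‖(t : ℂ) + ε * Complex.I‖ + ‖1 + ((t : ℂ) + ε * Complex.I) ^ 2‖ / ε) *
              (1 / (1 + s ^ 2))) := mul_le_mul_of_nonneg_left hk hε.1.le
        _ = (ε * ‖(t : ℂ) + ε * Complex.I‖ + ‖1 + ((t : ℂ) + ε * Complex.I) ^ 2‖) *
              (1 / (1 + s ^ 2)) := by
            have := hε.1.ne'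
            field_simp
        _ ≤ _ := by
            refine mul_le_mul_of_nonneg_right (add_le_add ?_ ?_) (by positivity)
            · exact (mul_le_of_le_one_left (norm_nonneg _) hε.2).trans hn
            · refine (norm_add_le _ _).trans ?_
              rw [norm_one, norm_pow]
              gcongr
    · refine Eventually.of_forall fun s => ?_
      by_cases hst : s = t
      · subst hst
        rw [indicator_of_mem (mem_singleton s)]
        have h1 : Tendsto (fun ε : ℝ => (1 + Complex.I * ε * ((s : ℂ) / ((s : ℂ) ^ 2 + 1))) *
            ρ.density s i j) (𝓝[>] 0) (𝓝 (ρ.density s i j)) := by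
          refine Tendsto.mono_left ?_ nhdsWithin_le_nhds
          have : Continuous (fun ε : ℝ => (1 + Complex.I * ε * ((s : ℂ) / ((s : ℂ) ^ 2 + 1))) *
            ρ.density s i j) := by fun_prop
          simpa using this.tendsto 0
        refine h1.congr' ?_
        filter_upwards [self_mem_nhdsWithin] with ε hε
        have hε' : (ε : ℂ) ≠ 0 := by exact_mod_cast (ne_of_gt hε)
        have e : -(Complex.I * ε) * (1 / ((s : ℂ) - (s + ε * Complex.I))) = 1 := by
          have : (s : ℂ) - (s + ε * Complex.I) = -(Complex.I * ε) := by ring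
          rw [this, mul_one_div, div_self (neg_ne_zero.2 (mul_ne_zero Complex.I_ne_zero hε'))]
        rw [herglotzKernel, mul_sub, e]
        ring
      · rw [indicator_of_notMem (by simpa using hst)]
        refine Tendsto.mono_left ?_ nhdsWithin_le_nhds
        have hne : (s : ℂ) - (t + (0 : ℝ) * Complex.I) ≠ 0 := by
          simpa [sub_eq_zero] using hst
        have : ContinuousAt (fun ε : ℝ => -(Complex.I * ε) *
            (1 / ((s : ℂ) - (t + ε * Complex.I)) - (s : ℂ) / ((s : ℂ) ^ 2 + 1)) *
            ρ.density s i j) 0 := by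
          refine ContinuousAt.mul (ContinuousAt.mul (by fun_prop) (ContinuousAt.sub
            (ContinuousAt.div (by fun_prop) (by fun_prop) hne) (by fun_prop))) (by fun_prop)
        simpa [ContinuousAt, herglotzKernel] using this
  rw [integral_indicator (measurableSet_singleton t)] at hI
  have hAB : Tendsto (fun ε : ℝ => -(Complex.I * ε) * (A i j + B i j * (t + ε * Complex.I)))
      (𝓝[>] 0) (𝓝 0) := by
    refine Tendsto.mono_left ?_ nhdsWithin_le_nhds
    have : Continuous fun ε : ℝ => -(Complex.I * ε) * (A i j + B i j * (t + ε * Complex.I)) := by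
      fun_prop
    simpa using this.tendsto 0
  have hsum := hAB.add hI
  rw [zero_add] at hsum
  refine hsum.congr' ?_
  filter_upwards [self_mem_nhdsWithin] with ε hε
  have hz : 0 < ((t : ℂ) + ε * Complex.I).im := by rw [him]; exact hε
  have e : ∫ s, -(Complex.I * ε) * herglotzKernel (t + ε * Complex.I) s * ρ.density s i j ∂ρ.base =
      -(Complex.I * ε) * ∫ s, herglotzKernel (t + ε * Complex.I) s * ρ.density s i j ∂ρ.base := by
    rw [← integral_const_mul]
    exact integral_congr_ae (Eventually.of_forall fun s => mul_assoc _ _ _)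
  rw [e, h.eq _ hz i j, ← mul_add]
  rfl

theorem value_singleton_eq (h : IsHerglotzRepresentation m A B ρ)
    (h₀ : IsHerglotzRepresentation m A₀ B₀ ρ₀) (t : ℝ) : ρ.value {t} = ρ₀.value {t} := by
  ext i j
  exact tendsto_nhds_unique (h.tendsto_value_singleton t i j) (h₀.tendsto_value_singleton t i j)

theorem integrable_one_div_norm_sq (h : IsHerglotzRepresentation m A B ρ) {z : ℂ}
    (hz : 0 < z.im) : Integrable (fun t : ℝ => 1 / ‖(t : ℂ) - z‖ ^ 2) ρ.base := by
  have h1 := ((h.integrable_kernel hz).im.const_mul (z.im)⁻¹)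
  refine h1.congr (Eventually.of_forall fun t => ?_)
  change (z.im)⁻¹ * (herglotzKernel z t).im = _
  rw [herglotzKernel_im, inv_mul_cancel_left₀ hz.ne']

/-- Since tr W = 1, the trace reduces the matrix representation to a scalar one for the trace
measure. -/
theorem trace_im (h : IsHerglotzRepresentation m A B ρ) {z : ℂ} (hz : 0 < z.im) :
    (m z).trace.im = z.im * (B.trace.re + ∫ t : ℝ, 1 / ‖(t : ℂ) - z‖ ^ 2 ∂ρ.base) := by
  have h1 : (m z).trace = A.trace + B.trace * z + ∫ t, herglotzKernel z t ∂ρ.base := by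
    have h2 : ∫ t, herglotzKernel z t ∂ρ.base =
        ∑ i, ∫ t, herglotzKernel z t * ρ.density t i i ∂ρ.base := by
      rw [← integral_finsetSum _ fun i _ => h.integrable_kernel_mul hz i i]
      refine integral_congr_ae ?_
      filter_upwards [ρ.trace_eq_one] with t ht
      rw [← Finset.mul_sum]
      change _ = _ * (ρ.density t).trace
      rw [ht, mul_one]
    rw [h2]
    simp only [trace, diag_apply, Finset.sum_mul, ← Finset.sum_add_distrib]
    exact Finset.sum_congr rfl fun i _ => h.eq z hz i i
  have hA : A.trace.im = 0 := by
    have : star A.trace = A.trace := by rw [← trace_conjTranspose, h.hermitian.eq]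
    exact Complex.conj_eq_iff_im.1 this
  have hB : B.trace.im = 0 := by
    have : star B.trace = B.trace := by rw [← trace_conjTranspose, h.posSemidef.isHermitian.eq]
    exact Complex.conj_eq_iff_im.1 this
  have h3 : (∫ t, herglotzKernel z t ∂ρ.base).im =
      z.im * ∫ t : ℝ, 1 / ‖(t : ℂ) - z‖ ^ 2 ∂ρ.base := by
    rw [← integral_const_mul]
    refine (integral_im (h.integrable_kernel hz)).symm.trans ?_
    exact integral_congr_ae (Eventually.of_forall fun t => herglotzKernel_im z t)
  rw [h1, Complex.add_im, Complex.add_im, hA, Complex.mul_im, hB, h3]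
  ring

/-- With z = x + iε, the Poisson type kernel 1/|t − z|² is at least 1/(2ε²) on the interval. Compare
the two expressions for Im tr m(z) and drop the nonnegative tr B. -/
theorem measure_Ioo_le (h : IsHerglotzRepresentation m A B ρ)
    (h₀ : IsHerglotzRepresentation m A₀ B₀ ρ₀) (x : ℝ) {ε : ℝ} (hε : 0 < ε) :
    ρ.base.real (Ioo (x - ε) (x + ε)) ≤
      2 * (B₀.trace.re + ∫ t : ℝ, 1 / ‖(t : ℂ) - (x + ε * Complex.I)‖ ^ 2 ∂ρ₀.base) * ε ^ 2 := by
  set z : ℂ := x + ε * Complex.I with hzdef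
  have him : z.im = ε := by simp [hzdef]
  have hz : 0 < z.im := by rw [him]; exact hε
  have h1 := (h.trace_im hz).symm.trans (h₀.trace_im hz)
  have h2 := mul_left_cancel₀ hz.ne' h1
  have hB : 0 ≤ B.trace.re := (Complex.le_def.1 h.posSemidef.trace_nonneg).1
  have h3 : ∫ t in Ioo (x - ε) (x + ε), 1 / (2 * ε ^ 2) ∂ρ.base ≤
      ∫ t : ℝ, 1 / ‖(t : ℂ) - z‖ ^ 2 ∂ρ.base := by
    refine le_trans (setIntegral_mono_on (integrableOn_const measure_Ioo_lt_top.ne)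
      (h.integrable_one_div_norm_sq hz).integrableOn measurableSet_Ioo fun t ht => ?_)
      (setIntegral_le_integral (h.integrable_one_div_norm_sq hz)
        (Eventually.of_forall fun t => by positivity))
    have h4 : ‖(t : ℂ) - z‖ ^ 2 = (t - x) ^ 2 + ε ^ 2 := by
      rw [← Complex.normSq_eq_norm_sq, Complex.normSq_apply]
      simp [hzdef]
      ring
    rw [h4]
    have h5 : (t - x) ^ 2 ≤ ε ^ 2 := sq_le_sq' (by linarith [ht.1]) (by linarith [ht.2])
    gcongr
    linarith
  rw [setIntegral_const, smul_eq_mul] at h3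
  have h6 : ρ.base.real (Ioo (x - ε) (x + ε)) * (1 / (2 * ε ^ 2)) ≤
      B₀.trace.re + ∫ t : ℝ, 1 / ‖(t : ℂ) - z‖ ^ 2 ∂ρ₀.base := by linarith
  rw [mul_one_div, div_le_iff₀ (by positivity)] at h6
  linarith

/-- Near a point off Λ the measure ρ₀ stays at a positive distance, so the right side of
`measure_Ioo_le` is O(ε²) uniformly in x, and the covering lemma applies. -/
theorem base_compl_eq_zero (h : IsHerglotzRepresentation m A B ρ)
    (h₀ : IsHerglotzRepresentation m A₀ B₀ ρ₀) {Λ : Set ℝ} (hΛ : IsClosed Λ)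
    (hΛ₀ : ρ₀.base Λᶜ = 0) : ρ.base Λᶜ = 0 := by
  refine measure_null_of_locally_null _ fun t ht => ?_
  obtain ⟨r, hr, hrΛ⟩ := Metric.isOpen_iff.1 hΛ.isOpen_compl t ht
  set δ := r / 2 with hδdef
  have hδ : 0 < δ := by positivity
  refine ⟨Ioo (t - δ) (t + δ), mem_nhdsWithin_of_mem_nhds
    (Ioo_mem_nhds (by linarith) (by linarith)), ?_⟩
  -- Chosen so that 1 + s² ≤ C(s − x)² for s in Λ and x within δ of t: use s² ≤ 2(s − x)² + 2x², |x|
  -- ≤ |t| + δ and |s − x| ≥ δ.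
  set C := 2 + (1 + 2 * (|t| + δ) ^ 2) / δ ^ 2 with hC
  refine Measure.Ioo_eq_zero_of_le_sq ρ.base
    (C := 2 * (B₀.trace.re + ∫ s : ℝ, C * (1 / (1 + s ^ 2)) ∂ρ₀.base)) zero_lt_one
    fun x hx ε hε => (h.measure_Ioo_le h₀ x hε.1).trans ?_
  refine mul_le_mul_of_nonneg_right (mul_le_mul_of_nonneg_left (add_le_add le_rfl ?_) zero_le_two)
    (sq_nonneg ε)
  have hz : 0 < ((x : ℂ) + ε * Complex.I).im := by simpa using hε.1
  refine integral_mono_ae (h₀.integrable_one_div_norm_sq hz) (h₀.integrable.const_mul _) ?_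
  have hae : ∀ᵐ s ∂ρ₀.base, s ∈ Λ := hΛ₀
  filter_upwards [hae] with s hs
  have h4 : ‖(s : ℂ) - (x + ε * Complex.I)‖ ^ 2 = (s - x) ^ 2 + ε ^ 2 := by
    rw [← Complex.normSq_eq_norm_sq, Complex.normSq_apply]
    simp
    ring
  have hxt : |x - t| ≤ δ := abs_le.2 ⟨by linarith [hx.1], by linarith [hx.2]⟩
  have hst : r ≤ |s - t| := by
    by_contra hc
    exact hrΛ (by simpa [Real.dist_eq] using hc : s ∈ Metric.ball t r) hs
  have hsx : δ ≤ |s - x| := by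
    have := abs_sub_le s x t
    linarith
  have h5 : δ ^ 2 ≤ (s - x) ^ 2 := by
    rw [← sq_abs (s - x)]
    gcongr
  have h6 : x ^ 2 ≤ (|t| + δ) ^ 2 := by
    rw [← sq_abs x]
    gcongr
    have := abs_sub_abs_le_abs_sub x t
    linarith
  have hε0 : 0 < ε := hε.1
  rw [h4, mul_one_div, div_le_div_iff₀ (by positivity) (by positivity), one_mul]
  have h7 : (1 + 2 * (|t| + δ) ^ 2) ≤ (1 + 2 * (|t| + δ) ^ 2) / δ ^ 2 * (s - x) ^ 2 := by
    rw [div_mul_eq_mul_div, le_div_iff₀ (by positivity)]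
    gcongr
  have h8 : 0 ≤ C * ε ^ 2 := by positivity
  have h9 : C * ((s - x) ^ 2 + ε ^ 2) = 2 * (s - x) ^ 2 +
    (1 + 2 * (|t| + δ) ^ 2) / δ ^ 2 * (s - x) ^ 2 + C * ε ^ 2 := by rw [hC]; ring
  nlinarith [sq_nonneg (s - 2 * x)]

end IsHerglotzRepresentation

/-! ### Discrete matrix measures -/

namespace MatrixMeasure

variable {n : ℕ}

/-- The measure `∑ p t δ_t`. -/
noncomputable def sumDirac (Λ : Set ℝ) (p : ℝ → ℝ) : Measure ℝ :=
  Measure.sum fun t : Λ => ENNReal.ofReal (p t) • Measure.dirac (t : ℝ)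

theorem ae_sumDirac {Λ : Set ℝ} (hΛ : Λ.Countable) {p : ℝ → ℝ} {q : ℝ → Prop}
    (h : ∀ t ∈ Λ, p t ≠ 0 → q t) : ∀ᵐ t ∂sumDirac Λ p, q t := by
  have : Countable Λ := hΛ
  rw [sumDirac, Measure.ae_sum_iff]
  intro t
  by_cases hp : p t = 0
  · simp [hp]
  · refine Measure.ae_smul_measure ?_ _
    rw [ae_dirac_eq]
    exact h _ t.2 hp

theorem sumDirac_singleton {Λ : Set ℝ} {p : ℝ → ℝ} {t : ℝ} (ht : t ∈ Λ) :
    sumDirac Λ p {t} = ENNReal.ofReal (p t) := by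
  rw [sumDirac, Measure.sum_apply _ (measurableSet_singleton t), tsum_eq_single ⟨t, ht⟩]
  · simp
  · intro s hs
    have : (s : ℝ) ≠ t := fun h => hs (Subtype.ext h)
    simp [this]

theorem isLocallyFiniteMeasure_of_integrable {μ : Measure ℝ}
    (h : Integrable (fun t : ℝ => 1 / (1 + t ^ 2)) μ) : IsLocallyFiniteMeasure μ := by
  refine ⟨fun x => ⟨Ioo (x - 1) (x + 1), Ioo_mem_nhds (by linarith) (by linarith), ?_⟩⟩
  refine lt_of_le_of_lt (measure_mono fun t ht => ?_)
    (h.measure_ge_lt_top (ε := 1 / (1 + (|x| + 1) ^ 2)) (by positivity))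
  have h1 : |t| ≤ |x| + 1 := by
    have h2 : |t - x| ≤ 1 := abs_le.2 ⟨by linarith [ht.1], by linarith [ht.2]⟩
    linarith [abs_sub_abs_le_abs_sub t x]
  change 1 / (1 + (|x| + 1) ^ 2) ≤ 1 / (1 + t ^ 2)
  rw [← sq_abs t]
  gcongr

theorem exists_isHerglotzRepresentation {Λ : Set ℝ} (hΛ : Λ.Countable)
    {P : ℝ → Matrix (Fin n) (Fin n) ℂ} (hP : ∀ t, (P t).PosSemidef)
    (hs : Summable fun t : Λ => (P t).trace.re * (1 / (1 + (t : ℝ) ^ 2)))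
    {m : ℂ → Matrix (Fin n) (Fin n) ℂ} {A B : Matrix (Fin n) (Fin n) ℂ} (hA : A.IsHermitian)
    (hB : B.PosSemidef) (hm : ∀ z : ℂ, 0 < z.im → ∀ i j,
      HasSum (fun t : Λ => herglotzKernel z t * P t i j) (m z i j - (A i j + B i j * z))) :
    ∃ ρ : MatrixMeasure n, IsHerglotzRepresentation m A B ρ ∧ ρ.base Λᶜ = 0 ∧
      ∀ t ∈ Λ, ρ.value {t} = P t := by
  have : Countable Λ := hΛ
  set p : ℝ → ℝ := fun t => (P t).trace.re with hp
  have hp0 : ∀ t, 0 ≤ p t := fun t => (Complex.le_def.1 (hP t).trace_nonneg).1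
  have hpt : ∀ t, (p t : ℂ) = (P t).trace := fun t =>
    (Complex.eq_re_of_ofReal_le (r := 0) (by simpa using (hP t).trace_nonneg)).symm
  have hP0 : ∀ t, p t = 0 → P t = 0 := fun t ht => by
    rw [← (hP t).trace_eq_zero_iff, ← hpt, ht, Complex.ofReal_zero]
  have hpP : ∀ t, (p t : ℂ) • ((p t : ℂ)⁻¹ • P t) = P t := fun t => by
    by_cases h : p t = 0
    · rw [hP0 t h, smul_zero, smul_zero]
    · rw [smul_smul, mul_inv_cancel₀ (by exact_mod_cast h), one_smul]
  have hreal : ∀ t, (ENNReal.ofReal (p t)).toReal = p t := fun t => ENNReal.toReal_ofReal (hp0 t)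
  have hint : Integrable (fun t : ℝ => 1 / (1 + t ^ 2)) (sumDirac Λ p) := by
    refine integrable_sum_dirac (fun t => ENNReal.ofReal_ne_top) (hs.congr fun t => ?_)
    rw [hreal, Real.norm_of_nonneg (by positivity)]
  let ρ : MatrixMeasure n :=
    { base := sumDirac Λ p
      -- Where the trace vanishes so does P, and the point carries no mass; the trace normalization
      -- is only required almost everywhere.
      density := fun t => (p t : ℂ)⁻¹ • P t
      aemeasurable := fun i j => by
        rw [sumDirac, aemeasurable_sum_measure_iff]
        exact fun t => aemeasurable_dirac.smul_measure _
      posSemidef := Eventually.of_forall fun t => (hP t).smul (by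
        rw [← Complex.ofReal_inv]
        exact_mod_cast inv_nonneg.2 (hp0 t))
      locallyFinite := isLocallyFiniteMeasure_of_integrable hint
      trace_eq_one := ae_sumDirac hΛ fun t _ ht => by
        rw [trace_smul, ← hpt, smul_eq_mul, inv_mul_cancel₀ (by exact_mod_cast ht)] }
  refine ⟨ρ, ⟨hA, hB, hint, fun z hz i j => ?_⟩, ?_, fun t ht => ?_⟩
  · have e : ∀ t, (p t : ℂ) * (herglotzKernel z t * ((p t : ℂ)⁻¹ • P t) i j) =
        herglotzKernel z t * P t i j := fun t => by
      conv_rhs => rw [← hpP t]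
      simp only [Matrix.smul_apply, smul_eq_mul]
      ring
    have h1 := hasSum_integral_sum_dirac (x := fun t : Λ => (t : ℝ))
      (c := fun t : Λ => ENNReal.ofReal (p t))
      (f := fun t => herglotzKernel z t * ((p t : ℂ)⁻¹ • P t) i j)
      (fun t => ENNReal.ofReal_ne_top) ((hm z hz i j).summable.norm.congr fun t => by
        rw [← e, norm_mul, hreal, Complex.norm_real, Real.norm_of_nonneg (hp0 t)])
    have h2 := h1.unique ((hm z hz i j).congr_fun fun t => by
      rw [← e, hreal, Complex.real_smul])
    change m z i j = A i j + B i j * z +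
      ∫ t : ℝ, herglotzKernel z t * ((p t : ℂ)⁻¹ • P t) i j ∂(sumDirac Λ p)
    rw [sumDirac, h2]
    ring
  · have : ∀ᵐ t ∂sumDirac Λ p, t ∈ Λ := ae_sumDirac hΛ fun t ht _ => ht
    exact this
  · rw [value_singleton]
    change ((sumDirac Λ p).real {t} : ℂ) • ((p t : ℂ)⁻¹ • P t) = P t
    rw [Measure.real, sumDirac_singleton ht, hreal, hpP]

end MatrixMeasure

/-! ### Square integrable functions for the weight of a canonical system -/

theorem Matrix.norm_star_dotProduct_mulVec_le {ι : Type*} [Fintype ι] (M : Matrix ι ι ℂ)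
    {v : ι → ℂ} {C : ℝ} (hv : ‖v‖ ≤ C) :
    ‖star v ⬝ᵥ (M *ᵥ v)‖ ≤ C ^ 2 * ∑ i, ∑ j, ‖M i j‖ := by
  have hC : 0 ≤ C := (norm_nonneg v).trans hv
  have h : ∀ i, ‖v i‖ ≤ C := fun i => (norm_le_pi_norm v i).trans hv
  simp only [dotProduct, mulVec, Finset.mul_sum]
  refine (norm_sum_le _ _).trans (Finset.sum_le_sum fun i _ => ?_)
  refine (norm_sum_le _ _).trans (Finset.sum_le_sum fun j _ => ?_)
  rw [norm_mul, norm_mul, Pi.star_apply, norm_star]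
  calc ‖v i‖ * (‖M i j‖ * ‖v j‖) ≤ C * (‖M i j‖ * C) := by
        gcongr
        · exact h i
        · exact h j
    _ = C ^ 2 * ‖M i j‖ := by ring

namespace RegularCanonicalSystem

variable {n : ℕ} {a b : ℝ} (𝓢 : RegularCanonicalSystem n a b)

theorem integrable_sum_norm :
    Integrable (fun x => ∑ i, ∑ j, ‖𝓢.H x i j‖) (volume.restrict (Ioo a b)) :=
  integrable_finsetSum _ fun i _ => integrable_finsetSum _ fun j _ => (𝓢.integrable i j).norm

/-- A bounded Borel function as a square integrable function. -/
noncomputable def bounded (f : ℝ → Fin n ⊕ Fin n → ℂ) (hf : Measurable f) (C : ℝ)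
    (hC : ∀ x, ‖f x‖ ≤ C) : 𝓢.weight.PreL2 :=
  ⟨f, hf, ((𝓢.integrable_sum_norm.const_mul (C ^ 2)).mono'
    (𝓢.weight.aemeasurable_pairing hf hf).aestronglyMeasurable
    (Eventually.of_forall fun x => Matrix.norm_star_dotProduct_mulVec_le (𝓢.H x) (hC x)))⟩

theorem norm_toL2_le_of_bounded {f : 𝓢.weight.PreL2} {C : ℝ} (hC : ∀ x ∈ Ioo a b, ‖f x‖ ≤ C)
    (hC0 : 0 ≤ C) : ‖f‖ ≤ √(∫ x in Ioo a b, ∑ i, ∑ j, ‖𝓢.H x i j‖) * C := by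
  have h0 : 0 ≤ ∫ x in Ioo a b, ∑ i, ∑ j, ‖𝓢.H x i j‖ :=
    integral_nonneg fun x => by positivity
  refine (sq_le_sq₀ (norm_nonneg f) (by positivity)).1 ?_
  rw [mul_pow, Real.sq_sqrt h0, 𝓢.weight.norm_sq, mul_comm, ← integral_const_mul]
  refine integral_mono_ae (𝓢.weight.integrable_sqDensity f) (𝓢.integrable_sum_norm.const_mul _) ?_
  refine (ae_restrict_iff' measurableSet_Ioo).2 (Eventually.of_forall fun x hx => ?_)
  exact ((le_abs_self _).trans (Complex.abs_re_le_norm _)).trans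
    (Matrix.norm_star_dotProduct_mulVec_le (𝓢.H x) (hC x hx))

/-- The square integrable function which agrees on `[a, b]` with a continuous one. -/
noncomputable def ofContinuousOn (hab : a ≤ b) (f : ℝ → Fin n ⊕ Fin n → ℂ)
    (hf : ContinuousOn f (Icc a b)) : 𝓢.weight.PreL2 :=
  have hc : Continuous fun x => f (projIcc a b hab x) :=
    hf.comp_continuous (continuous_subtype_val.comp continuous_projIcc)
      fun x => (projIcc a b hab x).2
  𝓢.bounded (fun x => f (projIcc a b hab x)) hc.measurable
    ((isCompact_Icc.exists_bound_of_continuousOn hf).choose)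
    fun x => (isCompact_Icc.exists_bound_of_continuousOn hf).choose_spec _ (projIcc a b hab x).2

theorem ofContinuousOn_apply (hab : a ≤ b) (f : ℝ → Fin n ⊕ Fin n → ℂ)
    (hf : ContinuousOn f (Icc a b)) {x : ℝ} (hx : x ∈ Icc a b) :
    𝓢.ofContinuousOn hab f hf x = f x := by
  change f (projIcc a b hab x) = f x
  rw [projIcc_of_mem hab hx]

variable {𝓢} in
theorem Solves.congr (hab : a ≤ b) {f g f' g' : ℝ → Fin n ⊕ Fin n → ℂ} (h : 𝓢.Solves f g)
    (hf : EqOn f' f (Icc a b))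
    (hg : ∀ᵐ x ∂volume.restrict (Ioo a b), 𝓢.H x *ᵥ g' x = 𝓢.H x *ᵥ g x) : 𝓢.Solves f' g' := by
  refine ⟨h.1.congr fun x hx => (hf (by rwa [uIcc_of_le hab] at hx)).symm, ?_⟩
  filter_upwards [h.2, hg, ae_restrict_mem measurableSet_Ioo] with x ⟨d, hd, e⟩ hgx hx
  refine ⟨d, hd.congr_of_eventuallyEq ?_, by rw [e, hgx]⟩
  filter_upwards [Ioo_mem_nhds hx.1 hx.2] with y hy using hf (Ioo_subset_Icc_self hy)

theorem pairing_const (d : Fin n ⊕ Fin n → ℂ) (g : ℝ → Fin n ⊕ Fin n → ℂ) (x : ℝ) :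
    𝓢.weight.pairing (fun _ => star d) g x = d ⬝ᵥ (𝓢.H x *ᵥ g x) := by
  rw [MatrixWeight.pairing, star_star]
  rfl

theorem integrable_dotProduct (d : Fin n ⊕ Fin n → ℂ) (g : 𝓢.weight.PreL2) :
    IntegrableOn (fun x => d ⬝ᵥ (𝓢.H x *ᵥ g x)) (Ioo a b) :=
  (𝓢.weight.integrable_pairing
    (𝓢.bounded (fun _ => star d) measurable_const ‖star d‖ fun _ => le_rfl) g).congr
    (Eventually.of_forall fun x => 𝓢.pairing_const d g x)

theorem intervalIntegrable_coeff_apply (hab : a ≤ b) (g : 𝓢.weight.PreL2) :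
    IntervalIntegrable (fun s => 𝓢.coeff s (g s)) volume a b := by
  rw [intervalIntegrable_iff hab]
  refine Integrable.of_eval fun i => ?_
  simp only [coeff_apply]
  exact 𝓢.integrable_dotProduct (Matrix.J (Fin n) ℂ i) g

theorem green_inner (hab : a ≤ b) {f g k l : 𝓢.weight.PreL2} (hf : 𝓢.Solves f g)
    (hk : 𝓢.Solves k l) :
    inner ℂ (𝓢.weight.toL2 g) (𝓢.weight.toL2 k) - inner ℂ (𝓢.weight.toL2 f) (𝓢.weight.toL2 l) =
      star (f b) ⬝ᵥ (Matrix.J (Fin n) ℂ *ᵥ k b) - star (f a) ⬝ᵥ (Matrix.J (Fin n) ℂ *ᵥ k a) := by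
  rw [𝓢.weight.inner_toL2, 𝓢.weight.inner_toL2]
  exact 𝓢.green hab hf hk (𝓢.weight.integrable_pairing g k) (𝓢.weight.integrable_pairing f l)

/-- A primitive of a density that dominates the oscillation of solutions. -/
noncomputable def modulus (x : ℝ) : ℝ :=
  ∫ s in a..x, ∑ i, (star (star (Matrix.J (Fin n) ℂ i)) ⬝ᵥ
    (𝓢.H s *ᵥ star (Matrix.J (Fin n) ℂ i))).re

theorem intervalIntegrable_modulus (hab : a ≤ b) :
    IntervalIntegrable (fun s => ∑ i, (star (star (Matrix.J (Fin n) ℂ i)) ⬝ᵥ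
      (𝓢.H s *ᵥ star (Matrix.J (Fin n) ℂ i))).re) volume a b := by
  rw [intervalIntegrable_iff hab]
  exact integrable_finsetSum _ fun i _ => 𝓢.weight.integrable_sqDensity
    (𝓢.bounded (fun _ => star (Matrix.J (Fin n) ℂ i)) measurable_const _ fun _ => le_rfl)

theorem continuousOn_modulus (hab : a ≤ b) : ContinuousOn 𝓢.modulus (Icc a b) := by
  have := (𝓢.intervalIntegrable_modulus hab).absolutelyContinuousOnInterval_primitive.continuousOn
  rwa [uIcc_of_le hab] at this

/-- Each component of f x − f y is the inner product of k with a constant vector cut off to (y, x],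
whose squared norm is at most an increment of `modulus`. Cauchy–Schwarz then gives equicontinuity
controlled by the norm of k alone. -/
theorem norm_sub_le (hab : a ≤ b) {f : ℝ → Fin n ⊕ Fin n → ℂ} {k : 𝓢.weight.PreL2}
    (h : 𝓢.Solves f k) {x y : ℝ} (hx : x ∈ Icc a b) (hy : y ∈ Icc a b) (hyx : y ≤ x) :
    ‖f x - f y‖ ≤ √|𝓢.modulus x - 𝓢.modulus y| * ‖k‖ := by
  have hi := 𝓢.intervalIntegrable_coeff_apply hab k
  have hm := 𝓢.intervalIntegrable_modulus hab
  have hs := (𝓢.solves_iff hab hi).1 h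
  have h1 : f x - f y = ∫ s in y..x, 𝓢.coeff s (k s) := by
    rw [hs x hx, hs y hy, add_sub_add_left_eq_sub,
      intervalIntegral.integral_interval_sub_left (hi.mono_right hx) (hi.mono_right hy)]
  have h2 : 𝓢.modulus x - 𝓢.modulus y = ∫ s in y..x, ∑ i, (star (star (Matrix.J (Fin n) ℂ i)) ⬝ᵥ
      (𝓢.H s *ᵥ star (Matrix.J (Fin n) ℂ i))).re :=
    intervalIntegral.integral_interval_sub_left (hm.mono_right hx) (hm.mono_right hy)
  have hsub : Ioc y x ⊆ Ioc a b := Ioc_subset_Ioc hy.1 hx.2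
  have hsub' : (Ioc y x : Set ℝ) =ᵐ[volume] (Ioo a b ∩ Ioc y x : Set ℝ) := by
    have h3 : (Ioc y x : Set ℝ) = Ioc a b ∩ Ioc y x := (inter_eq_self_of_subset_right hsub).symm
    conv_lhs => rw [h3]
    exact Ioo_ae_eq_Ioc.symm.inter (ae_eq_refl _)
  refine (pi_norm_le_iff_of_nonneg (by positivity)).2 fun i => ?_
  set d := star (Matrix.J (Fin n) ℂ i) with hd
  have hmeas : Measurable ((Ioc y x).indicator fun _ => d) :=
    measurable_const.indicator measurableSet_Ioc
  let e : 𝓢.weight.PreL2 := 𝓢.bounded ((Ioc y x).indicator fun _ => d) hmeas ‖d‖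
    fun s => norm_indicator_le_norm_self (fun _ => d) s
  have he : ∀ s, 𝓢.weight.pairing e k s =
      (Ioc y x).indicator (fun s => (𝓢.coeff s (k s)) i) s := by
    intro s
    change star ((Ioc y x).indicator (fun _ => d) s) ⬝ᵥ (𝓢.H s *ᵥ k s) = _
    by_cases hs : s ∈ Ioc y x
    · rw [indicator_of_mem hs, indicator_of_mem hs, hd, star_star, coeff_apply]
      rfl
    · rw [indicator_of_notMem hs, indicator_of_notMem hs, star_zero, zero_dotProduct]
  have h3 : (f x - f y) i = inner ℂ e k := by
    have hi' : IntervalIntegrable (fun s => 𝓢.coeff s (k s)) volume y x :=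
      hi.mono_set (by rw [uIcc_of_le hyx, uIcc_of_le hab]; exact Icc_subset_Icc hy.1 hx.2)
    have h4 := (ContinuousLinearMap.proj (R := ℂ) (φ := fun _ : Fin n ⊕ Fin n => ℂ)
      i).intervalIntegral_comp_comm hi'
    rw [h1, 𝓢.weight.inner_def, integral_congr_ae (Eventually.of_forall he)]
    change _ = ∫ s in Ioo a b, (Ioc y x).indicator (fun s => (𝓢.coeff s (k s)) i) s
    rw [setIntegral_indicator measurableSet_Ioc, ← setIntegral_congr_set hsub',
      ← intervalIntegral.integral_of_le hyx]
    exact h4.symm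
  have h5 : ‖e‖ ^ 2 ≤ |𝓢.modulus x - 𝓢.modulus y| := by
    have hae : ∀ᵐ s ∂volume.restrict (Ioc y x), ∀ j,
        0 ≤ (star (star (Matrix.J (Fin n) ℂ j)) ⬝ᵥ
          (𝓢.H s *ᵥ star (Matrix.J (Fin n) ℂ j))).re := by
      rw [Measure.restrict_congr_set hsub']
      filter_upwards [ae_mono (Measure.restrict_mono inter_subset_left le_rfl) 𝓢.posSemidef]
        with s hs j using (Complex.le_def.1 (hs.dotProduct_mulVec_nonneg _)).1
    have h6 : ‖e‖ ^ 2 = ∫ s in Ioc y x, (star d ⬝ᵥ (𝓢.H s *ᵥ d)).re := by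
      rw [𝓢.weight.norm_sq]
      have he' : ∀ s, 𝓢.weight.sqDensity e s =
          (Ioc y x).indicator (fun s => (star d ⬝ᵥ (𝓢.H s *ᵥ d)).re) s := by
        intro s
        change (star ((Ioc y x).indicator (fun _ => d) s) ⬝ᵥ
          (𝓢.H s *ᵥ ((Ioc y x).indicator (fun _ => d) s))).re = _
        by_cases hs : s ∈ Ioc y x
        · rw [indicator_of_mem hs, indicator_of_mem hs]
        · rw [indicator_of_notMem hs, indicator_of_notMem hs, star_zero, zero_dotProduct,
            Complex.zero_re]
      rw [integral_congr_ae (Eventually.of_forall he')]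
      change ∫ s in Ioo a b, (Ioc y x).indicator (fun s => (star d ⬝ᵥ (𝓢.H s *ᵥ d)).re) s = _
      rw [setIntegral_indicator measurableSet_Ioc, ← setIntegral_congr_set hsub']
    rw [h6, h2, intervalIntegral.integral_of_le hyx]
    refine le_trans ?_ (le_abs_self _)
    have hm' : ∀ j, IntegrableOn (fun s => (star (star (Matrix.J (Fin n) ℂ j)) ⬝ᵥ
          (𝓢.H s *ᵥ star (Matrix.J (Fin n) ℂ j))).re) (Ioc y x) := fun j => by
      rw [IntegrableOn, Measure.restrict_congr_set hsub']
      refine IntegrableOn.mono_set ?_ inter_subset_left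
      exact 𝓢.weight.integrable_sqDensity
        (𝓢.bounded (fun _ => star (Matrix.J (Fin n) ℂ j)) measurable_const _ fun _ => le_rfl)
    refine integral_mono_ae (hm' i) (integrable_finsetSum _ fun j _ => hm' j) ?_
    filter_upwards [hae] with s hs
    exact Finset.single_le_sum (f := fun j => (star (star (Matrix.J (Fin n) ℂ j)) ⬝ᵥ
          (𝓢.H s *ᵥ star (Matrix.J (Fin n) ℂ j))).re) (fun j _ => hs j) (Finset.mem_univ i)
  rw [h3]
  refine (norm_inner_le_norm e k).trans (mul_le_mul_of_nonneg_right ?_ (norm_nonneg k))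
  exact Real.le_sqrt_of_sq_le h5

/-- Seminorm 0 means Hf = 0, so f' = 0 and f is constant; definiteness then kills the constant. -/
theorem eqOn_zero_of_toL2_eq_zero (hab : a ≤ b) (hdef : 𝓢.IsDefinite) {f : 𝓢.weight.PreL2} {z : ℂ}
    (h : 𝓢.Solves f (z • (f : ℝ → Fin n ⊕ Fin n → ℂ))) (h0 : 𝓢.weight.toL2 f = 0) :
    ∀ x ∈ Icc a b, f x = 0 := by
  have hH : ∀ᵐ x ∂volume.restrict (Ioo a b), 𝓢.H x *ᵥ f x = 0 := by
    have := (𝓢.weight.toL2_eq_iff f 0).1 h0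
    filter_upwards [this] with x hx
    exact hx.trans (mulVec_zero _)
  have h1 : 𝓢.Solves f 0 := h.congr hab (fun _ _ => rfl) (by
    filter_upwards [hH] with x hx
    simp [mulVec_smul, hx])
  have h2 := (𝓢.solves_iff hab (g := 0) (by simp)).1 h1
  have h3 : ∀ x ∈ Icc a b, f x = f a := fun x hx => by simpa using h2 x hx
  have h4 : f a = 0 := hdef _ (by
    filter_upwards [hH, ae_restrict_mem measurableSet_Ioo] with x hx hxm
    rw [← h3 x (Ioo_subset_Icc_self hxm), hx])
  intro x hx
  rw [h3 x hx, h4]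

end RegularCanonicalSystem

/-! ### Boundary conditions and eigenspaces -/

theorem Matrix.conjTranspose_J (n : ℕ) : (Matrix.J (Fin n) ℂ)ᴴ = -Matrix.J (Fin n) ℂ := by
  simp [Matrix.J, Matrix.fromBlocks_conjTranspose, Matrix.fromBlocks_neg]

namespace IsBoundaryCondition

variable {n : ℕ} {α : Matrix (Fin n) (Fin n ⊕ Fin n) ℂ} (hα : IsBoundaryCondition α)
include hα

/-- The boundary condition says that the square matrix with row blocks α and −αJ has the right
inverse with column blocks α* and Jα*; a right inverse of a square matrix is a left inverse. -/
theorem completeness :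
    αᴴ * α - Matrix.J (Fin n) ℂ * αᴴ * (α * Matrix.J (Fin n) ℂ) = 1 := by
  have h1 : (fromRows α (-(α * Matrix.J (Fin n) ℂ))) *
      (fromCols αᴴ (Matrix.J (Fin n) ℂ * αᴴ)) = 1 := by
    rw [fromRows_mul_fromCols, Matrix.neg_mul, Matrix.neg_mul, ← Matrix.mul_assoc, ← Matrix.mul_assoc, hα.1,
      hα.2, Matrix.mul_assoc α, Matrix.J_squared]
    simp [hα.1]
  have h2 := mul_eq_one_comm.1 h1
  rwa [fromCols_mul_fromRows, Matrix.mul_neg, ← sub_eq_add_neg] at h2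

theorem mulVec_eq (v : Fin n ⊕ Fin n → ℂ) :
    v = αᴴ *ᵥ (α *ᵥ v) + (-(Matrix.J (Fin n) ℂ * αᴴ)) *ᵥ (α *ᵥ (Matrix.J (Fin n) ℂ *ᵥ v)) := by
  conv_lhs => rw [← one_mulVec v, ← hα.completeness, sub_mulVec, ← mulVec_mulVec, ← mulVec_mulVec]
  rw [← mulVec_mulVec v α, neg_mulVec, sub_eq_add_neg]

theorem mulVec_initial (c : Fin n → ℂ) : α *ᵥ ((-(Matrix.J (Fin n) ℂ * αᴴ)) *ᵥ c) = 0 := by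
  rw [mulVec_mulVec, Matrix.mul_neg, ← Matrix.mul_assoc, hα.2, neg_zero, zero_mulVec]

theorem mulVec_J_initial (c : Fin n → ℂ) :
    α *ᵥ (Matrix.J (Fin n) ℂ *ᵥ ((-(Matrix.J (Fin n) ℂ * αᴴ)) *ᵥ c)) = c := by
  rw [mulVec_mulVec c, Matrix.mul_neg, ← Matrix.mul_assoc, Matrix.J_squared, Matrix.neg_mul,
    neg_neg, Matrix.one_mul, mulVec_mulVec, hα.1, one_mulVec]

omit hα in
theorem star_initial_dotProduct (c : Fin n → ℂ) (v : Fin n ⊕ Fin n → ℂ) :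
    star ((-(Matrix.J (Fin n) ℂ * αᴴ)) *ᵥ c) ⬝ᵥ (Matrix.J (Fin n) ℂ *ᵥ v) =
      -(star c ⬝ᵥ (α *ᵥ v)) := by
  rw [star_mulVec, ← dotProduct_mulVec, mulVec_mulVec, conjTranspose_neg, conjTranspose_mul,
    conjTranspose_conjTranspose, Matrix.conjTranspose_J, Matrix.mul_neg, neg_neg, Matrix.mul_assoc,
    Matrix.J_squared, Matrix.mul_neg, Matrix.mul_one, neg_mulVec, dotProduct_neg]

theorem dotProduct_J_eq_zero {v w : Fin n ⊕ Fin n → ℂ} (hv : α *ᵥ v = 0) (hw : α *ᵥ w = 0) :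
    star v ⬝ᵥ (Matrix.J (Fin n) ℂ *ᵥ w) = 0 := by
  have h := hα.mulVec_eq v
  rw [hv, mulVec_zero, zero_add] at h
  rw [h, star_initial_dotProduct, hw, dotProduct_zero, neg_zero]

end IsBoundaryCondition

namespace RegularCanonicalSystem

variable {n : ℕ} {a b : ℝ} (𝓢 : RegularCanonicalSystem n a b)
  {α β : Matrix (Fin n) (Fin n ⊕ Fin n) ℂ}

/-- The square integrable function `x ↦ X(x, z) c`, where `X(a, z) = C`. -/
noncomputable def matrixSolutionL2 (hab : a ≤ b) (z : ℂ) (C : Matrix (Fin n ⊕ Fin n) (Fin n) ℂ)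
    (c : Fin n → ℂ) : 𝓢.weight.PreL2 :=
  𝓢.ofContinuousOn hab (fun x => 𝓢.matrixSolution z C x *ᵥ c)
    ((𝓢.solves_matrixSolution_mulVec hab z C c).1.continuousOn 𝓢 hab)

theorem matrixSolutionL2_apply (hab : a ≤ b) (z : ℂ) (C : Matrix (Fin n ⊕ Fin n) (Fin n) ℂ)
    (c : Fin n → ℂ) {x : ℝ} (hx : x ∈ Icc a b) :
    𝓢.matrixSolutionL2 hab z C c x = 𝓢.matrixSolution z C x *ᵥ c :=
  𝓢.ofContinuousOn_apply hab _ _ hx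

theorem matrixSolutionL2_left (hab : a ≤ b) (z : ℂ) (C : Matrix (Fin n ⊕ Fin n) (Fin n) ℂ)
    (c : Fin n → ℂ) : 𝓢.matrixSolutionL2 hab z C c a = C *ᵥ c := by
  rw [𝓢.matrixSolutionL2_apply hab z C c (left_mem_Icc.2 hab),
    (𝓢.solves_matrixSolution_mulVec hab z C c).2]

theorem solves_matrixSolutionL2 (hab : a ≤ b) (z : ℂ) (C : Matrix (Fin n ⊕ Fin n) (Fin n) ℂ)
    (c : Fin n → ℂ) : 𝓢.Solves (𝓢.matrixSolutionL2 hab z C c)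
      (z • (𝓢.matrixSolutionL2 hab z C c : ℝ → Fin n ⊕ Fin n → ℂ)) := by
  refine (𝓢.solves_matrixSolution_mulVec hab z C c).1.congr hab
    (fun x hx => 𝓢.matrixSolutionL2_apply hab z C c hx) ?_
  filter_upwards [ae_restrict_mem measurableSet_Ioo] with x hx
  rw [Pi.smul_apply, Pi.smul_apply, 𝓢.matrixSolutionL2_apply hab z C c (Ioo_subset_Icc_self hx)]

theorem toL2_eq_of_eqOn {f g : 𝓢.weight.PreL2} (h : ∀ x ∈ Icc a b, f x = g x) :
    𝓢.weight.toL2 f = 𝓢.weight.toL2 g := by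
  refine (𝓢.weight.toL2_eq_iff f g).2 ?_
  refine (ae_restrict_iff' measurableSet_Ioo).2 (Eventually.of_forall fun x hx => ?_)
  rw [h x (Ioo_subset_Icc_self hx)]

/-- The class of `x ↦ u(x, z) c`. -/
noncomputable def uL2 (hab : a ≤ b) (α : Matrix (Fin n) (Fin n ⊕ Fin n) ℂ) (z : ℂ)
    (c : Fin n → ℂ) : 𝓢.weight.L2 :=
  𝓢.weight.toL2 (𝓢.matrixSolutionL2 hab z (-(Matrix.J (Fin n) ℂ * αᴴ)) c)

theorem uL2_zero (hab : a ≤ b) (α : Matrix (Fin n) (Fin n ⊕ Fin n) ℂ) (z : ℂ) :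
    𝓢.uL2 hab α z 0 = 0 :=
  𝓢.toL2_eq_of_eqOn (g := 0) fun x hx => by
    rw [𝓢.matrixSolutionL2_apply hab _ _ _ hx, mulVec_zero]
    rfl

theorem isRepresentedBy_iff (hab : a ≤ b) {t : ℝ} {φ : 𝓢.weight.L2} {c : Fin n → ℂ} :
    𝓢.IsRepresentedBy α t φ c ↔ φ = 𝓢.uL2 hab α t c := by
  constructor
  · rintro ⟨f, rfl, hf⟩
    exact 𝓢.toL2_eq_of_eqOn fun x hx => by rw [hf x hx, 𝓢.matrixSolutionL2_apply hab _ _ _ hx]; rfl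
  · rintro rfl
    exact ⟨_, rfl, fun x hx => 𝓢.matrixSolutionL2_apply hab _ _ _ hx⟩

/-- The condition at a forces f(a) = −Jα*c with c = αJf(a), so f = u(·,z)c by uniqueness; the
condition at b is then the equation for c. -/
theorem mem_relation_smul_iff (hab : a ≤ b) (hα : IsBoundaryCondition α) (z : ℂ)
    (h : 𝓢.weight.L2) : (h, z • h) ∈ 𝓢.relation α β ↔
      ∃ c, (β * 𝓢.u α b z) *ᵥ c = 0 ∧ h = 𝓢.uL2 hab α z c := by
  constructor
  · rintro ⟨f, g, rfl, hg, hfg, h1, h2⟩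
    have hfz : 𝓢.Solves f (z • (f : ℝ → Fin n ⊕ Fin n → ℂ)) := hfg.congr hab (fun _ _ => rfl) (by
      have := (𝓢.weight.toL2_eq_iff (z • f) g).1 hg.symm
      exact this)
    set c := α *ᵥ (Matrix.J (Fin n) ℂ *ᵥ f a) with hc
    have ha : f a = (-(Matrix.J (Fin n) ℂ * αᴴ)) *ᵥ c := by
      conv_lhs => rw [hα.mulVec_eq (f a), h1, mulVec_zero, zero_add]
    have hu := 𝓢.solves_matrixSolution_mulVec hab z (-(Matrix.J (Fin n) ℂ * αᴴ)) c
    have he := hfz.unique 𝓢 hab hu.1 (by rw [ha]; exact hu.2.symm)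
    refine ⟨c, ?_, 𝓢.toL2_eq_of_eqOn fun x hx => ?_⟩
    · rw [← mulVec_mulVec]
      rw [he (right_mem_Icc.2 hab)] at h2
      exact h2
    · rw [he hx, 𝓢.matrixSolutionL2_apply hab _ _ _ hx]
  · rintro ⟨c, hc, rfl⟩
    refine ⟨_, z • 𝓢.matrixSolutionL2 hab z (-(Matrix.J (Fin n) ℂ * αᴴ)) c, rfl, rfl,
      𝓢.solves_matrixSolutionL2 hab z _ c, ?_, ?_⟩
    · rw [𝓢.matrixSolutionL2_left, hα.mulVec_initial]
    · rw [𝓢.matrixSolutionL2_apply hab _ _ _ (right_mem_Icc.2 hab), mulVec_mulVec]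
      exact hc

theorem uL2_eq_zero (hab : a ≤ b) (hdef : 𝓢.IsDefinite) (hα : IsBoundaryCondition α) {z : ℂ}
    {c : Fin n → ℂ} (h : 𝓢.uL2 hab α z c = 0) : c = 0 := by
  have h1 := 𝓢.eqOn_zero_of_toL2_eq_zero hab hdef (𝓢.solves_matrixSolutionL2 hab z _ c) h a
    (left_mem_Icc.2 hab)
  rw [𝓢.matrixSolutionL2_left] at h1
  rw [← hα.mulVec_J_initial c, h1, mulVec_zero, mulVec_zero]

theorem relation_symm (hab : a ≤ b) (hα : IsBoundaryCondition α) (hβ : IsBoundaryCondition β)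
    (f g f' g' : 𝓢.weight.L2) (h : (f, g) ∈ 𝓢.relation α β) (h' : (f', g') ∈ 𝓢.relation α β) :
    inner ℂ g f' = inner ℂ f g' := by
  obtain ⟨F, G, rfl, rfl, h1, h2, h3⟩ := h
  obtain ⟨F', G', rfl, rfl, h1', h2', h3'⟩ := h'
  have := 𝓢.green_inner hab h1 h1'
  rw [hα.dotProduct_J_eq_zero h2 h2', hβ.dotProduct_J_eq_zero h3 h3', sub_zero] at this
  exact sub_eq_zero.1 this

/-- A kernel vector would give a nonreal eigenvalue of a symmetric relation, with an eigenfunction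
that is nonzero by definiteness. -/
theorem isUnit_det_of_im_ne_zero (hab : a ≤ b) (hdef : 𝓢.IsDefinite) (hα : IsBoundaryCondition α)
    (hβ : IsBoundaryCondition β) {z : ℂ} (hz : z.im ≠ 0) : IsUnit (β * 𝓢.u α b z).det := by
  by_contra hdet
  rw [isUnit_iff_ne_zero, not_not] at hdet
  obtain ⟨c, hc0, hc⟩ := exists_mulVec_eq_zero_iff.2 hdet
  refine hc0 (𝓢.uL2_eq_zero hab hdef hα (z := z) ?_)
  have hmem := (𝓢.mem_relation_smul_iff (β := β) hab hα z _).2 ⟨c, hc, rfl⟩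
  have h1 := 𝓢.relation_symm hab hα hβ _ _ _ _ hmem hmem
  rw [inner_smul_left, inner_smul_right] at h1
  have h2 : (starRingEnd ℂ z - z) * inner ℂ (𝓢.uL2 hab α z c) (𝓢.uL2 hab α z c) = 0 := by
    rw [sub_mul, h1, sub_self]
  refine inner_self_eq_zero.1 ((mul_eq_zero.1 h2).resolve_left fun h => hz ?_)
  exact Complex.conj_eq_iff_im.1 (sub_eq_zero.1 h)

theorem differentiable_det (hab : a ≤ b) :
    Differentiable ℂ fun z => (β * 𝓢.u α b z).det := by
  have h : ∀ i j, Differentiable ℂ fun z => (β * 𝓢.u α b z) i j := fun i j => by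
    simp only [mul_apply, u]
    exact Differentiable.fun_sum fun k _ =>
      (𝓢.differentiable_matrixSolution_apply hab _ (right_mem_Icc.2 hab) k j).const_mul _
  simp only [det_apply]
  exact Differentiable.fun_sum fun σ _ =>
    (Differentiable.fun_finsetProd fun i _ => h _ _).const_smul _

/-- Infinitely many zeros in a compact interval would accumulate, and the identity theorem would
make the entire determinant vanish at i as well. -/
theorem finite_zeros_det (hab : a ≤ b) (hdef : 𝓢.IsDefinite) (hα : IsBoundaryCondition α)
    (hβ : IsBoundaryCondition β) (R : ℝ) :
    ({t : ℝ | (β * 𝓢.u α b t).det = 0} ∩ Icc (-R) R).Finite := by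
  by_contra hinf
  obtain ⟨t, -, ht⟩ := Set.Infinite.exists_accPt_of_subset_isCompact hinf
    (isCompact_Icc (a := -R) (b := R)) inter_subset_right
  have hA : AnalyticOnNhd ℂ (fun z => (β * 𝓢.u α b z).det) univ :=
    (𝓢.differentiable_det hab).differentiableOn.analyticOnNhd isOpen_univ
  have h0 : AnalyticOnNhd ℂ (fun _ : ℂ => (0 : ℂ)) univ := analyticOnNhd_const
  have hmap : Tendsto (fun s : ℝ => (s : ℂ)) (𝓝[≠] t) (𝓝[≠] (t : ℂ)) := by
    refine tendsto_nhdsWithin_iff.2 ⟨(Complex.continuous_ofReal.tendsto t).mono_left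
      nhdsWithin_le_nhds, ?_⟩
    filter_upwards [self_mem_nhdsWithin] with s hs
    exact fun h => hs (Complex.ofReal_injective h)
  have hfr : ∃ᶠ z in 𝓝[≠] (t : ℂ), (β * 𝓢.u α b z).det = 0 := by
    refine hmap.frequently ?_
    rw [accPt_iff_frequently_nhdsNE] at ht
    exact ht.mono fun s hs => hs.1
  have := congrFun (hA.eq_of_frequently_eq h0 hfr) Complex.I
  exact (𝓢.isUnit_det_of_im_ne_zero hab hdef hα hβ (z := Complex.I) (by simp)).ne_zero this

theorem eigenvalues_subset (hab : a ≤ b) (hα : IsBoundaryCondition α) :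
    LinearRel.eigenvalues (𝓢.relation α β) ⊆ {t : ℝ | (β * 𝓢.u α b t).det = 0} := by
  intro t ht
  obtain ⟨h, hh, h0⟩ := (Submodule.ne_bot_iff _).1 ht
  obtain ⟨c, hc, rfl⟩ := (𝓢.mem_relation_smul_iff hab hα t h).1 hh
  refine exists_mulVec_eq_zero_iff.1 ⟨c, ?_, hc⟩
  rintro rfl
  refine h0 ?_
  exact 𝓢.uL2_zero hab α t

theorem finite_eigenvalues (hab : a ≤ b) (hdef : 𝓢.IsDefinite) (hα : IsBoundaryCondition α)
    (hβ : IsBoundaryCondition β) (R : ℝ) :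
    (LinearRel.eigenvalues (𝓢.relation α β) ∩ Icc (-R) R).Finite :=
  (𝓢.finite_zeros_det hab hdef hα hβ R).subset
    (inter_subset_inter_left _ (𝓢.eigenvalues_subset hab hα))

end RegularCanonicalSystem

/-! ### Sets of reals with finitely many points in each bounded interval. -/

theorem Set.countable_of_finite_inter_Icc {Λ : Set ℝ} (h : ∀ R : ℝ, (Λ ∩ Icc (-R) R).Finite) :
    Λ.Countable := by
  refine (countable_iUnion fun R : ℕ => (h R).countable).mono fun t ht => ?_
  obtain ⟨R, hR⟩ := exists_nat_ge |t|
  exact mem_iUnion.2 ⟨R, ht, abs_le.1 hR⟩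

theorem IsClosed.of_finite_inter_Icc {Λ : Set ℝ} (h : ∀ R : ℝ, (Λ ∩ Icc (-R) R).Finite) :
    IsClosed Λ := by
  rw [← isOpen_compl_iff, isOpen_iff_mem_nhds]
  intro x hx
  have h1 := (h (|x| + 1)).isClosed.isOpen_compl.mem_nhds fun h => hx h.1
  have h2 : Icc (-(|x| + 1)) (|x| + 1) ∈ 𝓝 x :=
    Icc_mem_nhds (by linarith [neg_abs_le x]) (by linarith [le_abs_self x])
  filter_upwards [h1, h2] with y hy hy' hyΛ using hy ⟨hyΛ, hy'⟩

/-! ### The compact resolvent of a canonical system -/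

open scoped BoundedContinuousFunction

theorem Matrix.norm_mulVec_le_of_forall_norm_le {ι κ : Type*} [Fintype ι] [Fintype κ]
    {A : Matrix ι κ ℂ} {M : ℝ} (hM : 0 ≤ M) (hA : ∀ i k, ‖A i k‖ ≤ M) (c : κ → ℂ) :
    ‖A *ᵥ c‖ ≤ Fintype.card κ * M * ‖c‖ := by
  refine (pi_norm_le_iff_of_nonneg (by positivity)).2 fun i => ?_
  simp only [mulVec, dotProduct]
  refine (norm_sum_le _ _).trans ((Finset.sum_le_card_nsmul _ _ (M * ‖c‖) fun k _ => ?_).trans ?_)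
  · rw [norm_mul]
    gcongr
    · exact hA i k
    · exact norm_le_pi_norm c k
  · rw [Finset.card_univ, nsmul_eq_mul, mul_assoc]

theorem Matrix.exists_norm_mulVec_le {ι κ : Type*} [Fintype ι] [Fintype κ] (A : Matrix ι κ ℂ) :
    ∃ K, 0 ≤ K ∧ ∀ c, ‖A *ᵥ c‖ ≤ K * ‖c‖ := by
  refine ⟨Fintype.card κ * ∑ i, ∑ k, ‖A i k‖, by positivity, fun c =>
    Matrix.norm_mulVec_le_of_forall_norm_le (by positivity) (fun i k => ?_) c⟩
  exact (Finset.single_le_sum (f := fun k => ‖A i k‖) (fun _ _ => norm_nonneg _)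
    (Finset.mem_univ k)).trans (Finset.single_le_sum (f := fun i => ∑ k, ‖A i k‖)
      (fun _ _ => by positivity) (Finset.mem_univ i))

namespace RegularCanonicalSystem

variable {n : ℕ} {a b : ℝ} (𝓢 : RegularCanonicalSystem n a b)
  {α β : Matrix (Fin n) (Fin n ⊕ Fin n) ℂ}

theorem exists_particular_solution (hab : a ≤ b) (z : ℂ) : ∃ C, 0 ≤ C ∧ ∀ G : 𝓢.weight.PreL2,
    ∃ f : ℝ → Fin n ⊕ Fin n → ℂ, 𝓢.Solves f (z • f + (G : ℝ → Fin n ⊕ Fin n → ℂ)) ∧ f a = 0 ∧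
      ∀ x ∈ Icc a b, ‖f x‖ ≤ C * ‖G‖ := by
  obtain ⟨M, hM⟩ := isCompact_Icc.exists_bound_of_continuousOn (𝓢.continuousOn_modulus hab)
  refine ⟨√(M + M) * Real.exp (‖z‖ * ∫ r in a..b, ‖𝓢.coeff r‖), by positivity, fun G => ?_⟩
  have hi := 𝓢.intervalIntegrable_coeff_apply hab G
  set w : ℝ → Fin n ⊕ Fin n → ℂ := fun x => 0 + ∫ s in a..x, 𝓢.coeff s (G s) with hw
  have hwa : w a = 0 := by simp [hw]
  have hwG : 𝓢.Solves w G := (𝓢.solves_iff hab hi).2 fun x _ => by rw [hwa]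
  have hwb : ∀ x ∈ Icc a b, ‖w x‖ ≤ √(M + M) * ‖G‖ := by
    intro x hx
    have h1 := 𝓢.norm_sub_le hab hwG hx (left_mem_Icc.2 hab) hx.1
    rw [hwa, sub_zero] at h1
    refine h1.trans (mul_le_mul_of_nonneg_right (Real.sqrt_le_sqrt ?_) (norm_nonneg _))
    exact (abs_sub _ _).trans (add_le_add (hM x hx) (hM a (left_mem_Icc.2 hab)))
  have hs := 𝓢.solves_volterraSolution hab z 0 hi (w := w) fun x => rfl
  refine ⟨_, hs.1, hs.2, fun x hx => ?_⟩
  have h2 := norm_volterraSolution_le (𝓢.intervalIntegrable_coeff hab) hwb (le_refl ‖z‖) hx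
  linarith

/-- Adding u(·,z)c to the particular solution with f(a) = 0 keeps the condition at a; the choice c =
−(βu(b,z))⁻¹βf(b) achieves the one at b. The bound is in the supremum norm, as Arzelà–Ascoli
requires. -/
theorem exists_resolvent_solution (hab : a ≤ b) (hα : IsBoundaryCondition α) {z : ℂ}
    (hz : IsUnit (β * 𝓢.u α b z).det) : ∃ C, 0 ≤ C ∧ ∀ G : 𝓢.weight.PreL2,
    ∃ f : 𝓢.weight.PreL2, 𝓢.Solves f (z • f + G : 𝓢.weight.PreL2) ∧ α *ᵥ f a = 0 ∧
      β *ᵥ f b = 0 ∧ ∀ x ∈ Icc a b, ‖f x‖ ≤ C * ‖G‖ := by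
  obtain ⟨C₁, hC₁, hp⟩ := 𝓢.exists_particular_solution hab z
  set A : Matrix (Fin n) (Fin n ⊕ Fin n) ℂ := -((β * 𝓢.u α b z)⁻¹ * β) with hA
  obtain ⟨K, hK, hKA⟩ := A.exists_norm_mulVec_le
  obtain ⟨M, hM⟩ := 𝓢.exists_norm_matrixSolution_le hab (-(Matrix.J (Fin n) ℂ * αᴴ)) ‖z‖
  refine ⟨C₁ + Fintype.card (Fin n) * |M| * (K * C₁), by positivity, fun G => ?_⟩
  obtain ⟨f, hf, hfa, hfb⟩ := hp G
  set c := A *ᵥ f b with hc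
  have hu := 𝓢.solves_matrixSolution_mulVec hab z (-(Matrix.J (Fin n) ℂ * αᴴ)) c
  have hsum := hf.add 𝓢 hu.1
  have hcont := hsum.continuousOn 𝓢 hab
  have hF : ∀ x ∈ Icc a b, 𝓢.ofContinuousOn hab _ hcont x = f x + 𝓢.u α x z *ᵥ c :=
    fun x hx => 𝓢.ofContinuousOn_apply hab _ hcont hx
  refine ⟨𝓢.ofContinuousOn hab _ hcont, hsum.congr hab hF ?_, ?_, ?_, fun x hx => ?_⟩
  · filter_upwards [ae_restrict_mem measurableSet_Ioo] with x hx
    change 𝓢.H x *ᵥ (z • (𝓢.ofContinuousOn hab _ hcont x) + G x) =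
      𝓢.H x *ᵥ (z • f x + G x + z • (𝓢.u α x z *ᵥ c))
    rw [hF x (Ioo_subset_Icc_self hx), smul_add]
    congr 1
    abel
  · rw [hF a (left_mem_Icc.2 hab), hfa, zero_add]
    exact (congrArg (α *ᵥ ·) hu.2).trans (hα.mulVec_initial c)
  · rw [hF b (right_mem_Icc.2 hab), mulVec_add, mulVec_mulVec, hc, hA, neg_mulVec, mulVec_neg,
      mulVec_mulVec, ← Matrix.mul_assoc, Matrix.mul_nonsing_inv _ hz, Matrix.one_mul,
      add_neg_cancel]
  · rw [hF x hx]
    refine (norm_add_le _ _).trans ?_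
    have h1 : ‖𝓢.u α x z *ᵥ c‖ ≤ Fintype.card (Fin n) * |M| * (K * (C₁ * ‖G‖)) := by
      refine (Matrix.norm_mulVec_le_of_forall_norm_le (abs_nonneg M)
        (fun i k => (hM z le_rfl x hx i k).trans (le_abs_self M)) c).trans ?_
      gcongr
      exact (hKA _).trans (mul_le_mul_of_nonneg_left (hfb b (right_mem_Icc.2 hab)) hK)
    linarith [hfb x hx]

theorem eq_of_mem_relation (hab : a ≤ b) (hα : IsBoundaryCondition α) {z : ℂ}
    (hz : IsUnit (β * 𝓢.u α b z).det) {f f' g : 𝓢.weight.L2}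
    (h : (f, g + z • f) ∈ 𝓢.relation α β) (h' : (f', g + z • f') ∈ 𝓢.relation α β) : f = f' := by
  have h1 := (𝓢.relation α β).sub_mem h h'
  rw [Prod.mk_sub_mk, add_sub_add_left_eq_sub, ← smul_sub] at h1
  obtain ⟨c, hc, he⟩ := (𝓢.mem_relation_smul_iff hab hα z _).1 h1
  have hc0 : c = 0 := by
    by_contra hne
    exact hz.ne_zero (exists_mulVec_eq_zero_iff.1 ⟨c, hne, hc⟩)
  rw [hc0, uL2_zero] at he
  exact sub_eq_zero.1 he

/-- The map from continuous functions on `[a, b]` to square integrable functions. -/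
noncomputable def ofBoundedContinuous (hab : a ≤ b) (F : Icc a b →ᵇ (Fin n ⊕ Fin n → ℂ)) :
    𝓢.weight.L2 :=
  𝓢.weight.toL2 (𝓢.bounded (fun x => F (projIcc a b hab x))
    (F.continuous.comp continuous_projIcc).measurable ‖F‖ fun _ => F.norm_coe_le_norm _)

theorem continuous_ofBoundedContinuous (hab : a ≤ b) : Continuous (𝓢.ofBoundedContinuous hab) := by
  refine (LipschitzWith.of_dist_le_mul (K := ⟨√(∫ x in Ioo a b, ∑ i, ∑ j, ‖𝓢.H x i j‖),
    Real.sqrt_nonneg _⟩) fun F F' => ?_).continuous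
  rw [dist_eq_norm, dist_eq_norm]
  exact 𝓢.norm_toL2_le_of_bounded (f := 𝓢.bounded (fun x => F (projIcc a b hab x)) _ _ _ -
    𝓢.bounded (fun x => F' (projIcc a b hab x)) _ _ _)
    (fun x _ => (F - F').norm_coe_le_norm (projIcc a b hab x)) (norm_nonneg _)

theorem isCompact_closure_modulus (hab : a ≤ b) (C C' : ℝ) :
    IsCompact (closure {F : Icc a b →ᵇ (Fin n ⊕ Fin n → ℂ) | (∀ x, ‖F x‖ ≤ C) ∧
      ∀ x y, dist (F x) (F y) ≤ √|𝓢.modulus x - 𝓢.modulus y| * C'}) := by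
  refine BoundedContinuousFunction.arzela_ascoli (Metric.closedBall 0 C)
    (isCompact_closedBall 0 C) _ (fun F x hF => by simpa using hF.1 x) fun x => ?_
  refine Metric.equicontinuousAt_of_continuity_modulus
    (fun y : Icc a b => √|𝓢.modulus x - 𝓢.modulus y| * C') ?_ _
    (Eventually.of_forall fun y F => F.2.2 x y)
  have h1 : Continuous fun y : Icc a b => 𝓢.modulus y :=
    (𝓢.continuousOn_modulus hab).domRestrict
  have h2 : Continuous fun y : Icc a b => √|𝓢.modulus x - 𝓢.modulus y| * C' := by fun_prop
  simpa using h2.tendsto x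

theorem exists_hasCompactResolvent (hab : a ≤ b) (hα : IsBoundaryCondition α)
    (hβ : IsBoundaryCondition β) {t₀ : ℝ} (hz : IsUnit (β * 𝓢.u α b t₀).det) :
    ∃ R : 𝓢.weight.L2 →L[ℂ] 𝓢.weight.L2,
      LinearRel.HasCompactResolvent (𝓢.relation α β) t₀ R := by
  obtain ⟨C, hC, hex⟩ := 𝓢.exists_resolvent_solution hab hα hz
  set K := √(∫ x in Ioo a b, ∑ i, ∑ j, ‖𝓢.H x i j‖) with hK
  have hadd : ∀ f G : 𝓢.weight.PreL2, 𝓢.weight.toL2 ((t₀ : ℂ) • f + G) =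
      𝓢.weight.toL2 G + (t₀ : ℂ) • 𝓢.weight.toL2 f := fun f G =>
    add_comm ((t₀ : ℂ) • 𝓢.weight.toL2 f) (𝓢.weight.toL2 G)
  have hex' : ∀ g : 𝓢.weight.L2, ∃ f, (f, g + (t₀ : ℂ) • f) ∈ 𝓢.relation α β ∧
      ‖f‖ ≤ K * C * ‖g‖ := by
    intro g
    obtain ⟨G, rfl⟩ : ∃ G, 𝓢.weight.toL2 G = g := SeparationQuotient.surjective_mk g
    obtain ⟨f, hf, h1, h2, hb⟩ := hex G
    refine ⟨𝓢.weight.toL2 f, ⟨f, _, rfl, hadd f G, hf, h1, h2⟩, ?_⟩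
    · rw [mul_assoc]
      exact 𝓢.norm_toL2_le_of_bounded (fun x hx => hb x (Ioo_subset_Icc_self hx)) (by positivity)
  choose r hr hrb using hex'
  -- Uniqueness makes the chosen r linear and identifies it as the inverse of S − t₀.
  have huniq : ∀ f g, (f, g + (t₀ : ℂ) • f) ∈ 𝓢.relation α β → f = r g := fun f g h =>
    𝓢.eq_of_mem_relation hab hα hz h (hr g)
  let r' : 𝓢.weight.L2 →ₗ[ℂ] 𝓢.weight.L2 :=
    { toFun := r
      map_add' := fun g g' => by
        refine (huniq _ _ ?_).symm
        have := (𝓢.relation α β).add_mem (hr g) (hr g')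
        rw [Prod.mk_add_mk] at this
        convert this using 2
        rw [smul_add]
        abel
      map_smul' := fun c g => by
        refine (huniq _ _ ?_).symm
        have := (𝓢.relation α β).smul_mem c (hr g)
        rw [Prod.smul_mk, smul_add, smul_comm c] at this
        exact this }
  refine ⟨r'.mkContinuous (K * C) hrb, hr, fun f g h => huniq _ _ (by rwa [sub_add_cancel]), ?_,
    𝓢.relation_symm hab hα hβ⟩
  rw [isCompactOperator_iff_exists_mem_nhds_image_subset_compact]
  refine ⟨Metric.closedBall 0 1, Metric.closedBall_mem_nhds 0 zero_lt_one, _,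
    (𝓢.isCompact_closure_modulus hab C (|t₀| * (K * C) + 1)).image
      (𝓢.continuous_ofBoundedContinuous hab), ?_⟩
  rintro _ ⟨g, hg, rfl⟩
  obtain ⟨G, rfl⟩ : ∃ G, 𝓢.weight.toL2 G = g := SeparationQuotient.surjective_mk g
  have hG : ‖G‖ ≤ 1 := by
    rw [mem_closedBall_zero_iff] at hg
    exact hg
  obtain ⟨f, hf, h1, h2, hb⟩ := hex G
  have hfr : 𝓢.weight.toL2 f = r (𝓢.weight.toL2 G) :=
    huniq _ _ ⟨f, _, rfl, hadd f G, hf, h1, h2⟩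
  have hfc := hf.continuousOn 𝓢 hab
  refine ⟨BoundedContinuousFunction.mkOfCompact ⟨fun x : Icc a b => f x, hfc.domRestrict⟩,
    subset_closure ⟨fun x => ?_, ?_⟩, ?_⟩
  · exact (hb x x.2).trans (mul_le_of_le_one_right hC hG)
  -- The right side of the equation for f is t₀f + G, so its norm controls the oscillation of f.
  · have hk : ‖(t₀ : ℂ) • f + G‖ ≤ |t₀| * (K * C) + 1 := by
      refine (norm_add_le _ _).trans (add_le_add ?_ hG)
      rw [norm_smul, Complex.norm_real, Real.norm_eq_abs]
      refine mul_le_mul_of_nonneg_left ?_ (abs_nonneg _)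
      refine (𝓢.norm_toL2_le_of_bounded (fun x hx => hb x (Ioo_subset_Icc_self hx))
        (by positivity)).trans ?_
      gcongr
      exact mul_le_of_le_one_right hC hG
    have key : ∀ x y : Icc a b, y ≤ x → ‖f x - f y‖ ≤
        √|𝓢.modulus x - 𝓢.modulus y| * (|t₀| * (K * C) + 1) := fun x y hyx =>
      (𝓢.norm_sub_le hab hf x.2 y.2 hyx).trans
        (mul_le_mul_of_nonneg_left hk (Real.sqrt_nonneg _))
    intro x y
    change dist (f x) (f y) ≤ _
    rcases le_total y x with h | h
    · rw [dist_eq_norm]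
      exact key x y h
    · rw [dist_comm, dist_eq_norm, abs_sub_comm]
      exact key y x h
  · rw [ofBoundedContinuous]
    refine Eq.trans ?_ hfr
    refine 𝓢.toL2_eq_of_eqOn fun x hx => ?_
    change f (projIcc a b hab x) = f x
    rw [projIcc_of_mem hab hx]

end RegularCanonicalSystem

/-! ### The Weyl solutions and the Herglotz representation of the `m` function -/

/-- Both sums are ⟨x, Py⟩ with P the projection onto the common span, so the formula for the point
masses does not depend on the basis. -/
theorem LinearRel.sum_inner_mul_inner_eq {E : Type*} [NormedAddCommGroup E] [InnerProductSpace ℂ E]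
    {ι κ : Type*} [Fintype ι] [Fintype κ] {φ : ι → E} {ψ : κ → E} (hφ : Orthonormal ℂ φ)
    (hψ : Orthonormal ℂ ψ) (h : Submodule.span ℂ (range φ) = Submodule.span ℂ (range ψ))
    (x y : E) : ∑ k, inner ℂ x (φ k) * inner ℂ (φ k) y = ∑ l, inner ℂ x (ψ l) * inner ℂ (ψ l) y := by
  set q := ∑ l, inner ℂ (ψ l) y • ψ l with hq
  have hqm : q ∈ Submodule.span ℂ (range φ) := by
    rw [h]
    exact Submodule.sum_mem _ fun l _ => Submodule.smul_mem _ _ (Submodule.subset_span ⟨l, rfl⟩)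
  have hqi : ∀ k, inner ℂ (φ k) q = inner ℂ (φ k) y := fun k => by
    have hk : φ k ∈ Submodule.span ℂ (range ψ) := h ▸ Submodule.subset_span ⟨k, rfl⟩
    rw [eq_sum_of_mem_span hψ hk, sum_inner, sum_inner]
    refine Finset.sum_congr rfl fun l _ => ?_
    rw [inner_smul_left, inner_smul_left, hq, hψ.inner_right_fintype]
  have h1 := eq_sum_of_mem_span hφ hqm
  simp only [hqi] at h1
  have h2 : inner ℂ x (∑ k, inner ℂ (φ k) y • φ k) = inner ℂ x (∑ l, inner ℂ (ψ l) y • ψ l) := by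
    rw [← h1]
  simpa only [inner_sum, inner_smul_right, mul_comm] using h2

namespace RegularCanonicalSystem

variable {n : ℕ} {a b : ℝ} (𝓢 : RegularCanonicalSystem n a b)
  {α β : Matrix (Fin n) (Fin n ⊕ Fin n) ℂ}

/-- The Weyl solution `x ↦ (v(x, z) + u(x, z) m(z)) c`. -/
noncomputable def weyl (hab : a ≤ b) (α β : Matrix (Fin n) (Fin n ⊕ Fin n) ℂ) (z : ℂ)
    (c : Fin n → ℂ) : 𝓢.weight.PreL2 :=
  𝓢.matrixSolutionL2 hab z αᴴ c +
    𝓢.matrixSolutionL2 hab z (-(Matrix.J (Fin n) ℂ * αᴴ)) (𝓢.mFunction α β z *ᵥ c)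

theorem solves_weyl (hab : a ≤ b) (z : ℂ) (c : Fin n → ℂ) :
    𝓢.Solves (𝓢.weyl hab α β z c) (z • 𝓢.weyl hab α β z c : 𝓢.weight.PreL2) := by
  have := (𝓢.solves_matrixSolutionL2 hab z αᴴ c).add 𝓢 (𝓢.solves_matrixSolutionL2 hab z
    (-(Matrix.J (Fin n) ℂ * αᴴ)) (𝓢.mFunction α β z *ᵥ c))
  rw [← smul_add] at this
  exact this

theorem weyl_left (hab : a ≤ b) (z : ℂ) (c : Fin n → ℂ) : 𝓢.weyl hab α β z c a =
    αᴴ *ᵥ c + (-(Matrix.J (Fin n) ℂ * αᴴ)) *ᵥ (𝓢.mFunction α β z *ᵥ c) := by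
  change 𝓢.matrixSolutionL2 hab z αᴴ c a + 𝓢.matrixSolutionL2 hab z _ _ a = _
  rw [𝓢.matrixSolutionL2_left, 𝓢.matrixSolutionL2_left]

theorem mulVec_weyl_left (hab : a ≤ b) (hα : IsBoundaryCondition α) (z : ℂ) (c : Fin n → ℂ) :
    α *ᵥ 𝓢.weyl hab α β z c a = c := by
  rw [𝓢.weyl_left, mulVec_add, hα.mulVec_initial, mulVec_mulVec, hα.1, one_mulVec, add_zero]

theorem mulVec_J_weyl_left (hab : a ≤ b) (hα : IsBoundaryCondition α) (z : ℂ) (c : Fin n → ℂ) :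
    α *ᵥ (Matrix.J (Fin n) ℂ *ᵥ 𝓢.weyl hab α β z c a) = 𝓢.mFunction α β z *ᵥ c := by
  rw [𝓢.weyl_left, mulVec_add, mulVec_add, hα.mulVec_J_initial, mulVec_mulVec, mulVec_mulVec,
    hα.2, zero_mulVec, zero_add]

theorem mulVec_weyl_right (hab : a ≤ b) {z : ℂ} (hz : IsUnit (β * 𝓢.u α b z).det)
    (c : Fin n → ℂ) : β *ᵥ 𝓢.weyl hab α β z c b = 0 := by
  change β *ᵥ (𝓢.matrixSolutionL2 hab z αᴴ c b + 𝓢.matrixSolutionL2 hab z _ _ b) = 0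
  rw [𝓢.matrixSolutionL2_apply hab _ _ _ (right_mem_Icc.2 hab),
    𝓢.matrixSolutionL2_apply hab _ _ _ (right_mem_Icc.2 hab)]
  change β *ᵥ (𝓢.v α b z *ᵥ c + 𝓢.u α b z *ᵥ (𝓢.mFunction α β z *ᵥ c)) = 0
  rw [mulVec_add, mulVec_mulVec, mulVec_mulVec, mulVec_mulVec, mFunction, Matrix.mul_neg,
    ← Matrix.mul_assoc (β * 𝓢.u α b z), Matrix.mul_nonsing_inv _ hz, Matrix.one_mul, neg_mulVec,
    add_neg_cancel]

/-- The class of the Weyl solution. -/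
noncomputable def weylL2 (hab : a ≤ b) (α β : Matrix (Fin n) (Fin n ⊕ Fin n) ℂ) (z : ℂ)
    (c : Fin n → ℂ) : 𝓢.weight.L2 :=
  𝓢.weight.toL2 (𝓢.weyl hab α β z c)

/-- In Green's formula the term at b vanishes because both Weyl solutions satisfy the condition β;
at a their boundary data are c, m(z)c and d, m(w)d. -/
theorem inner_weylL2_weylL2 (hab : a ≤ b) (hα : IsBoundaryCondition α) (hβ : IsBoundaryCondition β)
    {z w : ℂ} (hz : IsUnit (β * 𝓢.u α b z).det) (hw : IsUnit (β * 𝓢.u α b w).det)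
    (c d : Fin n → ℂ) : (w - star z) * inner ℂ (𝓢.weylL2 hab α β z c) (𝓢.weylL2 hab α β w d) =
      star c ⬝ᵥ (𝓢.mFunction α β w *ᵥ d) - star (𝓢.mFunction α β z *ᵥ c) ⬝ᵥ d := by
  have h := 𝓢.green_inner hab (𝓢.solves_weyl (α := α) (β := β) hab z c)
    (𝓢.solves_weyl (α := α) (β := β) hab w d)
  have hz' : 𝓢.weight.toL2 (z • 𝓢.weyl hab α β z c) = z • 𝓢.weylL2 hab α β z c := rfl
  have hw' : 𝓢.weight.toL2 (w • 𝓢.weyl hab α β w d) = w • 𝓢.weylL2 hab α β w d := rfl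
  rw [hβ.dotProduct_J_eq_zero (𝓢.mulVec_weyl_right hab hz c) (𝓢.mulVec_weyl_right hab hw d),
    hz', hw'] at h
  change inner ℂ _ (𝓢.weylL2 hab α β w d) - inner ℂ (𝓢.weylL2 hab α β z c) _ = _ at h
  rw [inner_smul_left, inner_smul_right] at h
  conv_rhs at h => rw [𝓢.weyl_left hab z c, star_add, add_dotProduct,
    IsBoundaryCondition.star_initial_dotProduct, 𝓢.mulVec_weyl_left hab hα, star_mulVec,
    ← dotProduct_mulVec, conjTranspose_conjTranspose, 𝓢.mulVec_J_weyl_left hab hα]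
  rw [starRingEnd_apply] at h
  linear_combination -h

theorem inner_weylL2 (hab : a ≤ b) (hα : IsBoundaryCondition α) (hβ : IsBoundaryCondition β)
    {w : ℂ} (hw : IsUnit (β * 𝓢.u α b w).det) {F G : 𝓢.weight.PreL2} (h : 𝓢.Solves F G)
    (ha : α *ᵥ F a = 0) (hb : β *ᵥ F b = 0) (d : Fin n → ℂ) :
    inner ℂ (𝓢.weight.toL2 G) (𝓢.weylL2 hab α β w d) -
      w * inner ℂ (𝓢.weight.toL2 F) (𝓢.weylL2 hab α β w d) =
        star (α *ᵥ (Matrix.J (Fin n) ℂ *ᵥ F a)) ⬝ᵥ d := by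
  have h1 := 𝓢.green_inner hab h (𝓢.solves_weyl (α := α) (β := β) hab w d)
  have hw' : 𝓢.weight.toL2 (w • 𝓢.weyl hab α β w d) = w • 𝓢.weylL2 hab α β w d := rfl
  have ha' := hα.mulVec_eq (F a)
  rw [ha, mulVec_zero, zero_add] at ha'
  rw [hβ.dotProduct_J_eq_zero hb (𝓢.mulVec_weyl_right hab hw d), hw'] at h1
  conv_rhs at h1 => rw [ha', IsBoundaryCondition.star_initial_dotProduct,
    𝓢.mulVec_weyl_left hab hα]
  change inner ℂ _ (𝓢.weylL2 hab α β w d) - _ = _ at h1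
  rw [inner_smul_right] at h1
  rw [h1]
  ring

theorem inner_uL2_weylL2 (hab : a ≤ b) (hα : IsBoundaryCondition α) (hβ : IsBoundaryCondition β)
    {w : ℂ} (hw : IsUnit (β * 𝓢.u α b w).det) {t : ℝ} {c : Fin n → ℂ}
    (hc : 𝓢.uL2 hab α t c ∈ LinearRel.eigenspace (𝓢.relation α β) (t : ℂ)) (hdef : 𝓢.IsDefinite)
    (d : Fin n → ℂ) :
    ((t : ℂ) - w) * inner ℂ (𝓢.uL2 hab α t c) (𝓢.weylL2 hab α β w d) = star c ⬝ᵥ d := by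
  obtain ⟨c', hc', he⟩ := (𝓢.mem_relation_smul_iff hab hα t _).1 hc
  -- The class determines the coefficient by definiteness, so c itself satisfies the condition at b.
  have hcc : c = c' := by
    have h0 : 𝓢.uL2 hab α t (c - c') = 0 := by
      rw [← sub_eq_zero] at he
      rw [← he]
      refine 𝓢.toL2_eq_of_eqOn (g := _ - _) fun x hx => ?_
      rw [MatrixWeight.coe_sub, Pi.sub_apply, 𝓢.matrixSolutionL2_apply hab _ _ _ hx,
        𝓢.matrixSolutionL2_apply hab _ _ _ hx, 𝓢.matrixSolutionL2_apply hab _ _ _ hx, mulVec_sub]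
    exact sub_eq_zero.1 (𝓢.uL2_eq_zero hab hdef hα h0)
  rw [← hcc] at hc'
  have h := 𝓢.inner_weylL2 hab hα hβ hw
    (F := 𝓢.matrixSolutionL2 hab t (-(Matrix.J (Fin n) ℂ * αᴴ)) c)
    (G := (t : ℂ) • 𝓢.matrixSolutionL2 hab t (-(Matrix.J (Fin n) ℂ * αᴴ)) c)
    (𝓢.solves_matrixSolutionL2 hab t _ c)
    (by rw [𝓢.matrixSolutionL2_left, hα.mulVec_initial])
    (by
      rw [𝓢.matrixSolutionL2_apply hab _ _ _ (right_mem_Icc.2 hab), mulVec_mulVec]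
      exact hc') d
  rw [𝓢.matrixSolutionL2_left, hα.mulVec_J_initial] at h
  change inner ℂ ((t : ℂ) • 𝓢.uL2 hab α t c) _ - w * inner ℂ (𝓢.uL2 hab α t c) _ = _ at h
  rw [inner_smul_left, Complex.conj_ofReal] at h
  rw [← h]
  ring

/-- For (0, g) in S the spectral parameter drops out of ⟨g, χ(w)d⟩, so the component of χ(w)d in
S(0) is the same for all w. It is the source of the linear term Bz. -/
theorem inner_weylL2_sub (hab : a ≤ b) (hα : IsBoundaryCondition α) (hβ : IsBoundaryCondition β)
    {z w : ℂ} (hz : IsUnit (β * 𝓢.u α b z).det) (hw : IsUnit (β * 𝓢.u α b w).det)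
    (d : Fin n → ℂ) : 𝓢.weylL2 hab α β w d - 𝓢.weylL2 hab α β z d ∈
      (LinearRel.multivaluedPart (𝓢.relation α β))ᗮ := by
  rintro _ ⟨F, G, h0, rfl, h1, h2, h3⟩
  have e1 := 𝓢.inner_weylL2 hab hα hβ hz h1 h2 h3 d
  have e2 := 𝓢.inner_weylL2 hab hα hβ hw h1 h2 h3 d
  replace h0 : 𝓢.weight.toL2 F = 0 := h0
  rw [h0, inner_zero_left, mul_zero, sub_zero] at e1 e2
  change inner ℂ (𝓢.weight.toL2 G) _ = _
  rw [inner_sub_right, e1, e2, sub_self]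

end RegularCanonicalSystem

theorem Complex.star_I : star Complex.I = -Complex.I := Complex.conj_I

theorem Complex.ofReal_add_I_mul_sub_I (t : ℝ) :
    ((t : ℂ) + Complex.I) * ((t : ℂ) - Complex.I) = (t : ℂ) ^ 2 + 1 := by
  linear_combination -Complex.I_sq

/-- The kernel equals (z + i)/((t + i)(t − z)) − i/(t² + 1), a combination of the two expressions
Parseval's identity delivers. -/
theorem hasSum_herglotzKernel_mul {f : ℝ → ℂ} {x y z : ℂ} (hz : 0 < z.im)
    (hx : HasSum (fun t : ℝ => f t / (((t : ℂ) - star Complex.I) * ((t : ℂ) - z))) x)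
    (hy : HasSum (fun t : ℝ => f t / ((t : ℂ) ^ 2 + 1)) y) :
    HasSum (fun t => herglotzKernel z t * f t) ((z + Complex.I) * x - Complex.I * y) := by
  refine ((hx.mul_left (z + Complex.I)).sub (hy.mul_left Complex.I)).congr_fun fun t => ?_
  have hne1 := Complex.ofReal_sub_ne_zero hz t
  have hne2 := Complex.ofReal_sq_add_one_ne_zero t
  rw [← Complex.ofReal_add_I_mul_sub_I] at hne2 ⊢
  have hne3 := left_ne_zero_of_mul hne2
  have hne4 := right_ne_zero_of_mul hne2
  rw [Complex.star_I, sub_neg_eq_add, herglotzKernel, ← Complex.ofReal_add_I_mul_sub_I]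
  field_simp
  ring

namespace RegularCanonicalSystem

variable {n : ℕ} {a b : ℝ} (𝓢 : RegularCanonicalSystem n a b)
  {α β : Matrix (Fin n) (Fin n ⊕ Fin n) ℂ}

theorem exists_eigenCoeff (hab : a ≤ b) (hα : IsBoundaryCondition α)
    (e : LinearRel.EigenBasis (𝓢.relation α β)) :
    ∃ c : ∀ t, Fin (e.dim t) → Fin n → ℂ, ∀ t k, e.vec t k = 𝓢.uL2 hab α t (c t k) := by
  have h : ∀ t k, ∃ c, e.vec t k = 𝓢.uL2 hab α t c := fun t k =>
    let ⟨c, _, hc⟩ := (𝓢.mem_relation_smul_iff hab hα t _).1 (e.mem t k)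
    ⟨c, hc⟩
  choose c hc using h
  exact ⟨c, hc⟩

theorem sum_inner_weylL2 (hab : a ≤ b) (hdef : 𝓢.IsDefinite) (hα : IsBoundaryCondition α)
    (hβ : IsBoundaryCondition β) {z w : ℂ} (hz : z.im ≠ 0) (hw : w.im ≠ 0) {t : ℝ} {M : ℕ}
    {φ : Fin M → 𝓢.weight.L2} {c : Fin M → Fin n → ℂ}
    (hφ : ∀ k, φ k ∈ LinearRel.eigenspace (𝓢.relation α β) (t : ℂ))
    (hc : ∀ k, φ k = 𝓢.uL2 hab α t (c k)) (i j : Fin n) :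
    ((t : ℂ) - star z) * ((t : ℂ) - w) *
      ∑ k, inner ℂ (𝓢.weylL2 hab α β z (Pi.single i 1)) (φ k) *
        inner ℂ (φ k) (𝓢.weylL2 hab α β w (Pi.single j 1)) =
      (∑ k, vecMulVec (c k) (star (c k))) i j := by
  have hz' := 𝓢.isUnit_det_of_im_ne_zero hab hdef hα hβ hz
  have hw' := 𝓢.isUnit_det_of_im_ne_zero hab hdef hα hβ hw
  rw [Matrix.sum_apply, Finset.mul_sum]
  refine Finset.sum_congr rfl fun k _ => ?_
  have hk := hφ k
  rw [hc k] at hk ⊢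
  have h1 := 𝓢.inner_uL2_weylL2 hab hα hβ hw' hk hdef (Pi.single j 1)
  have h2 := congrArg star (𝓢.inner_uL2_weylL2 hab hα hβ hz' hk hdef (Pi.single i 1))
  rw [dotProduct_single, mul_one, Pi.star_apply] at h1 h2
  rw [star_mul', star_sub, star_star] at h2
  have h3 : star (inner ℂ (𝓢.uL2 hab α t (c k)) (𝓢.weylL2 hab α β z (Pi.single i 1))) =
      inner ℂ (𝓢.weylL2 hab α β z (Pi.single i 1)) (𝓢.uL2 hab α t (c k)) := inner_conj_symm _ _
  have h4 : star (t : ℂ) = t := Complex.conj_ofReal t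
  rw [h3, h4] at h2
  rw [vecMulVec_apply, Pi.star_apply, ← h1, ← h2]
  ring

theorem inner_weylL2_single (hab : a ≤ b) (hα : IsBoundaryCondition α)
    (hβ : IsBoundaryCondition β) {z w : ℂ} (hz : IsUnit (β * 𝓢.u α b z).det)
    (hw : IsUnit (β * 𝓢.u α b w).det) (i j : Fin n) :
    (w - star z) * inner ℂ (𝓢.weylL2 hab α β z (Pi.single i 1))
      (𝓢.weylL2 hab α β w (Pi.single j 1)) =
      𝓢.mFunction α β w i j - star (𝓢.mFunction α β z j i) := by
  rw [𝓢.inner_weylL2_weylL2 hab hα hβ hz hw, dotProduct_single, mul_one, Pi.star_apply,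
    mulVec_single_one, mulVec_single_one]
  have : star (Pi.single i (1 : ℂ) : Fin n → ℂ) = Pi.single i 1 := by
    ext k
    rw [Pi.star_apply, Pi.single_apply]
    split_ifs <;> simp
  rw [this, single_one_dotProduct]
  rfl

theorem posSemidef_sum_vecMulVec {ι : Type*} [Fintype ι] (c : ι → Fin n → ℂ) :
    (∑ k, vecMulVec (c k) (star (c k))).PosSemidef :=
  posSemidef_sum _ fun k _ => posSemidef_vecMulVec_self_star (c k)

/-- Apply Parseval's identity to χ(z)e_i and to χ(w)e_j minus its component p_j in S(0).
Eigenvectors do not see p_j, and since p does not depend on z or w, what is subtracted is the Gram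
matrix of p. -/
theorem exists_hasSum_inner_weylL2 (hab : a ≤ b) (hdef : 𝓢.IsDefinite)
    (hα : IsBoundaryCondition α) (hβ : IsBoundaryCondition β) {t₀ : ℝ}
    {R : 𝓢.weight.L2 →L[ℂ] 𝓢.weight.L2}
    (hR : LinearRel.HasCompactResolvent (𝓢.relation α β) t₀ R)
    (e : LinearRel.EigenBasis (𝓢.relation α β)) {c : ∀ t, Fin (e.dim t) → Fin n → ℂ}
    (hc : ∀ t k, e.vec t k = 𝓢.uL2 hab α t (c t k)) :
    ∃ B : Matrix (Fin n) (Fin n) ℂ, B.PosSemidef ∧ ∀ z w : ℂ, z.im ≠ 0 → w.im ≠ 0 → ∀ i j,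
      HasSum (fun t : ℝ => (∑ k, vecMulVec (c t k) (star (c t k))) i j /
        (((t : ℂ) - star z) * ((t : ℂ) - w)))
        (inner ℂ (𝓢.weylL2 hab α β z (Pi.single i 1)) (𝓢.weylL2 hab α β w (Pi.single j 1)) -
          B i j) := by
  set N := LinearRel.multivaluedPart (𝓢.relation α β) with hN
  have hcl : IsClosed (N : Set 𝓢.weight.L2) := by
    rw [hN, ← hR.iSup_eigenspace_orthogonal]
    exact Submodule.isClosed_orthogonal _
  have : CompleteSpace N := hcl.completeSpace_coe
  set χ : ℂ → Fin n → 𝓢.weight.L2 := fun w j => 𝓢.weylL2 hab α β w (Pi.single j 1) with hχ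
  have hdec : ∀ j, ∃ p ∈ N, χ Complex.I j - p ∈ Nᗮ := fun j => by
    obtain ⟨p, hp, q, hq, he⟩ := N.exists_add_mem_mem_orthogonal (χ Complex.I j)
    exact ⟨p, hp, by rwa [he, add_sub_cancel_left]⟩
  choose p hp hpo using hdec
  have hunit : ∀ {z : ℂ}, z.im ≠ 0 → IsUnit (β * 𝓢.u α b z).det := fun hz =>
    𝓢.isUnit_det_of_im_ne_zero hab hdef hα hβ hz
  have hχp : ∀ w : ℂ, w.im ≠ 0 → ∀ j, χ w j - p j ∈ Nᗮ := fun w hw j => by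
    have h1 := 𝓢.inner_weylL2_sub hab hα hβ (hunit (z := Complex.I) (by simp)) (hunit hw)
      (Pi.single j 1)
    have h2 := Nᗮ.add_mem h1 (hpo j)
    rwa [sub_add_sub_cancel] at h2
  refine ⟨Matrix.gram ℂ p, Matrix.posSemidef_gram ℂ p, fun z w hz hw i j => ?_⟩
  have h1 := e.hasSum_inner hR (χ z i) (hχp w hw j)
  have h2 : inner ℂ (χ z i) (χ w j - p j) = inner ℂ (χ z i) (χ w j) - Matrix.gram ℂ p i j := by
    have h3 : inner ℂ (χ z i - p i) (p j) = 0 :=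
      Submodule.inner_left_of_mem_orthogonal (hp j) (hχp z hz i)
    rw [inner_sub_left, sub_eq_zero] at h3
    rw [inner_sub_right, h3]
    rfl
  rw [h2] at h1
  refine h1.congr_fun fun t => ?_
  have hne : ∀ {x : ℂ}, x.im ≠ 0 → (t : ℂ) - x ≠ 0 := fun {x} hx h => by
    have := congrArg Complex.im h
    simp at this
    exact hx this
  have hz0 := hne (x := star z) (by simpa using hz)
  rw [← 𝓢.sum_inner_weylL2 hab hdef hα hβ hz hw (fun k => e.mem t k) (hc t) i j,
    mul_div_cancel_left₀ _ (mul_ne_zero hz0 (hne hw))]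
  refine Finset.sum_congr rfl fun k _ => ?_
  have h4 : inner ℂ (e.vec t k) (p j) = 0 :=
    Submodule.inner_left_of_mem_orthogonal (hp j) (hR.eigenspace_le_orthogonal t (e.mem t k))
  rw [inner_sub_right, h4, sub_zero]

theorem exists_hasSum_herglotzKernel (hab : a ≤ b) (hdef : 𝓢.IsDefinite)
    (hα : IsBoundaryCondition α) (hβ : IsBoundaryCondition β) {t₀ : ℝ}
    {R : 𝓢.weight.L2 →L[ℂ] 𝓢.weight.L2}
    (hR : LinearRel.HasCompactResolvent (𝓢.relation α β) t₀ R)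
    (e : LinearRel.EigenBasis (𝓢.relation α β)) {c : ∀ t, Fin (e.dim t) → Fin n → ℂ}
    (hc : ∀ t k, e.vec t k = 𝓢.uL2 hab α t (c t k)) :
    ∃ A B : Matrix (Fin n) (Fin n) ℂ, A.IsHermitian ∧ B.PosSemidef ∧ ∀ i j,
      (Summable fun t : ℝ => (∑ k, vecMulVec (c t k) (star (c t k))) i j / ((t : ℂ) ^ 2 + 1)) ∧
      ∀ z : ℂ, 0 < z.im → HasSum
        (fun t : ℝ => herglotzKernel z t * (∑ k, vecMulVec (c t k) (star (c t k))) i j)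
        (𝓢.mFunction α β z i j - (A i j + B i j * z)) := by
  obtain ⟨B, hB, hs⟩ := 𝓢.exists_hasSum_inner_weylL2 hab hdef hα hβ hR e hc
  set m := 𝓢.mFunction α β with hm
  have hI : (Complex.I).im ≠ 0 := by simp
  have hunit : ∀ {z : ℂ}, z.im ≠ 0 → IsUnit (β * 𝓢.u α b z).det := fun hz =>
    𝓢.isUnit_det_of_im_ne_zero hab hdef hα hβ hz
  have hsI : ∀ i j, HasSum (fun t : ℝ => (∑ k, vecMulVec (c t k) (star (c t k))) i j /
      ((t : ℂ) ^ 2 + 1))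
      ((m Complex.I i j - star (m Complex.I j i)) / (2 * Complex.I) - B i j) := fun i j => by
    have h1 := hs Complex.I Complex.I hI hI i j
    have h2 := 𝓢.inner_weylL2_single hab hα hβ (hunit hI) (hunit hI) i j
    rw [Complex.star_I, sub_neg_eq_add, ← two_mul, ← hm] at h2
    rw [← h2, mul_div_cancel_left₀ _ (by simp)]
    refine h1.congr_fun fun t => ?_
    rw [Complex.star_I, sub_neg_eq_add, Complex.ofReal_add_I_mul_sub_I]
  -- The Hermitian part of m(i): what remains of m(z) − m(i)* after subtracting half of m(i) −
  -- m(i)*; the two contributions iB cancel.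
  refine ⟨(1 / 2 : ℂ) • (m Complex.I + (m Complex.I)ᴴ), B, ?_, hB,
    fun i j => ⟨(hsI i j).summable, fun z hz => ?_⟩⟩
  · have h1 : (m Complex.I + (m Complex.I)ᴴ).IsHermitian := isHermitian_add_transpose_self _
    rw [IsHermitian, conjTranspose_smul, h1.eq]
    simp
  · have h1 := hasSum_herglotzKernel_mul hz (hs Complex.I z hI hz.ne' i j) (hsI i j)
    have h2 := 𝓢.inner_weylL2_single hab hα hβ (hunit hI) (hunit hz.ne') i j
    rw [Complex.star_I, sub_neg_eq_add, ← hm] at h2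
    rw [mul_sub, h2] at h1
    convert h1 using 1
    simp only [Matrix.smul_apply, Matrix.add_apply, conjTranspose_apply, smul_eq_mul]
    have := Complex.I_ne_zero
    field_simp
    ring

theorem exists_herglotzRepresentation (hab : a ≤ b) (hdef : 𝓢.IsDefinite)
    (hα : IsBoundaryCondition α) (hβ : IsBoundaryCondition β) {t₀ : ℝ}
    {R : 𝓢.weight.L2 →L[ℂ] 𝓢.weight.L2}
    (hR : LinearRel.HasCompactResolvent (𝓢.relation α β) t₀ R)
    (e : LinearRel.EigenBasis (𝓢.relation α β)) {c : ∀ t, Fin (e.dim t) → Fin n → ℂ}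
    (hc : ∀ t k, e.vec t k = 𝓢.uL2 hab α t (c t k)) :
    ∃ A B ρ, IsHerglotzRepresentation (𝓢.mFunction α β) A B ρ ∧
      ρ.base (LinearRel.eigenvalues (𝓢.relation α β))ᶜ = 0 ∧
      ∀ t ∈ LinearRel.eigenvalues (𝓢.relation α β),
        ρ.value {t} = ∑ k, vecMulVec (c t k) (star (c t k)) := by
  obtain ⟨A, B, hA, hB, hs⟩ := 𝓢.exists_hasSum_herglotzKernel hab hdef hα hβ hR e hc
  have hΛ := countable_of_finite_inter_Icc (𝓢.finite_eigenvalues hab hdef hα hβ)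
  set Λ := LinearRel.eigenvalues (𝓢.relation α β) with hΛdef
  set P : ℝ → Matrix (Fin n) (Fin n) ℂ := fun t => ∑ k, vecMulVec (c t k) (star (c t k)) with hP
  have hP0 : ∀ t ∉ Λ, P t = 0 := fun t ht => by
    have h1 : LinearRel.eigenspace (𝓢.relation α β) (t : ℂ) = ⊥ := by
      by_contra h
      exact ht h
    refine Finset.sum_eq_zero fun k _ => ?_
    have h2 := e.mem t k
    rw [h1, Submodule.mem_bot] at h2
    exact absurd h2 ((e.orthonormal t).ne_zero k)
  have hsum : Summable fun t : ℝ => (P t).trace.re * (1 / (1 + t ^ 2)) := by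
    have h1 := summable_sum (s := Finset.univ) fun i _ => (hs i i).1
    refine (Complex.reCLM.summable h1).congr fun t => ?_
    have h2 : ∑ i, P t i i / ((t : ℂ) ^ 2 + 1) =
        (P t).trace * ((1 / (1 + t ^ 2) : ℝ) : ℂ) := by
      rw [trace, Finset.sum_mul]
      refine Finset.sum_congr rfl fun i _ => ?_
      push_cast
      rw [mul_one_div, add_comm]
      rfl
    rw [Complex.reCLM_apply, h2, Complex.re_mul_ofReal]
  obtain ⟨ρ, h1, h2, h3⟩ := MatrixMeasure.exists_isHerglotzRepresentation hΛ
    (fun t => posSemidef_sum_vecMulVec (c t)) (hsum.subtype Λ) hA hB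
    fun z hz i j => (hasSum_subtype_iff_of_support_subset (fun t ht => by
      by_contra h
      refine ht ?_
      change herglotzKernel z t * P t i j = 0
      rw [hP0 t h, Matrix.zero_apply, mul_zero])).2 ((hs i j).2 z hz)
  exact ⟨A, B, ρ, h1, h2, h3⟩

end RegularCanonicalSystem

/-! ### The transform -/

/-- The linear form `v ↦ c* v`. -/
noncomputable def starDotProductCLM {ι : Type*} [Fintype ι] (c : ι → ℂ) : (ι → ℂ) →L[ℂ] ℂ :=
  LinearMap.toContinuousLinearMap
    { toFun := fun v => star c ⬝ᵥ v
      map_add' := dotProduct_add _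
      map_smul' := fun r v => dotProduct_smul r _ v }

namespace RegularCanonicalSystem

variable {n : ℕ} {a b : ℝ} (𝓢 : RegularCanonicalSystem n a b)
  {α β : Matrix (Fin n) (Fin n ⊕ Fin n) ℂ}

theorem star_dotProduct_transformIntegrand (α : Matrix (Fin n) (Fin n ⊕ Fin n) ℂ)
    (h : ℝ → Fin n ⊕ Fin n → ℂ) (t x : ℝ) (c : Fin n → ℂ) :
    star c ⬝ᵥ 𝓢.transformIntegrand α h t x = star (𝓢.u α x t *ᵥ c) ⬝ᵥ (𝓢.H x *ᵥ h x) := by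
  rw [transformIntegrand, dotProduct_mulVec, star_mulVec]

theorem star_dotProduct_transformIntegrand_ae (hab : a ≤ b) (h : 𝓢.weight.PreL2) (t : ℝ)
    (c : Fin n → ℂ) : (fun x => star c ⬝ᵥ 𝓢.transformIntegrand α h t x)
      =ᵐ[volume.restrict (Ioo a b)] 𝓢.weight.pairing
        (𝓢.matrixSolutionL2 hab t (-(Matrix.J (Fin n) ℂ * αᴴ)) c) h := by
  filter_upwards [ae_restrict_mem measurableSet_Ioo] with x hx
  rw [star_dotProduct_transformIntegrand, MatrixWeight.pairing,
    𝓢.matrixSolutionL2_apply hab _ _ _ (Ioo_subset_Icc_self hx)]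
  rfl

theorem integrable_transformIntegrand (hab : a ≤ b) (α : Matrix (Fin n) (Fin n ⊕ Fin n) ℂ)
    (h : 𝓢.weight.PreL2) (t : ℝ) : IntegrableOn (𝓢.transformIntegrand α h t) (Ioo a b) := by
  refine Integrable.of_eval fun i => ?_
  have h1 := 𝓢.star_dotProduct_transformIntegrand_ae (α := α) hab h t (star (Pi.single i 1))
  simp only [star_star, single_one_dotProduct] at h1
  exact (𝓢.weight.integrable_pairing _ h).congr h1.symm

/-- The transform `t ↦ ∫ u(x, t)* H(x) h(x) dx`. -/
noncomputable def transform (α : Matrix (Fin n) (Fin n ⊕ Fin n) ℂ) (h : 𝓢.weight.PreL2) (t : ℝ) :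
    Fin n → ℂ :=
  ∫ x in Ioo a b, 𝓢.transformIntegrand α h t x

/-- For eigenfunctions u(·,t)c this says that the coordinates of the transform in L²(ρ) are Fourier
coefficients. -/
theorem star_dotProduct_transform (hab : a ≤ b) (h : 𝓢.weight.PreL2) (t : ℝ) (c : Fin n → ℂ) :
    star c ⬝ᵥ 𝓢.transform α h t = inner ℂ (𝓢.uL2 hab α t c) (𝓢.weight.toL2 h) := by
  rw [uL2, 𝓢.weight.inner_toL2]
  have h1 := (starDotProductCLM c).integral_comp_comm (𝓢.integrable_transformIntegrand hab α h t)
  exact h1.symm.trans (integral_congr_ae (𝓢.star_dotProduct_transformIntegrand_ae hab h t c))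

theorem transform_add (hab : a ≤ b) (g h : 𝓢.weight.PreL2) :
    𝓢.transform α (g + h) = 𝓢.transform α g + 𝓢.transform α h := by
  funext t
  rw [Pi.add_apply, transform, transform, transform,
    ← integral_add (𝓢.integrable_transformIntegrand hab α g t)
      (𝓢.integrable_transformIntegrand hab α h t)]
  refine integral_congr_ae (Eventually.of_forall fun x => ?_)
  change (𝓢.u α x t)ᴴ *ᵥ (𝓢.H x *ᵥ (g x + h x)) = _
  rw [mulVec_add, mulVec_add]
  rfl

theorem transform_smul (r : ℂ) (h : 𝓢.weight.PreL2) :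
    𝓢.transform α (r • h) = r • 𝓢.transform α h := by
  funext t
  rw [Pi.smul_apply, transform, transform, ← integral_smul]
  refine integral_congr_ae (Eventually.of_forall fun x => ?_)
  change (𝓢.u α x t)ᴴ *ᵥ (𝓢.H x *ᵥ (r • h x)) = _
  rw [mulVec_smul, mulVec_smul]
  rfl

theorem transform_congr {g h : 𝓢.weight.PreL2} (hgh : 𝓢.weight.toL2 g = 𝓢.weight.toL2 h) :
    𝓢.transform α g = 𝓢.transform α h := by
  funext t
  refine integral_congr_ae ?_
  have h1 : ∀ᵐ x ∂volume.restrict (Ioo a b), 𝓢.H x *ᵥ g x = 𝓢.H x *ᵥ h x :=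
    (𝓢.weight.toL2_eq_iff g h).1 hgh
  filter_upwards [h1] with x hx
  rw [transformIntegrand, transformIntegrand, hx]

theorem continuous_transform (hab : a ≤ b) (h : 𝓢.weight.PreL2) :
    Continuous (𝓢.transform α h) := by
  have hint : IntegrableOn (fun x => 𝓢.H x *ᵥ h x) (Ioo a b) := Integrable.of_eval fun i => by
    have := 𝓢.integrable_dotProduct (Pi.single i 1) h
    simp only [single_one_dotProduct] at this
    exact this
  refine continuous_iff_continuousAt.2 fun t => ?_
  obtain ⟨M, hM⟩ := 𝓢.exists_norm_matrixSolution_le hab (-(Matrix.J (Fin n) ℂ * αᴴ)) (|t| + 1)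
  refine continuousAt_of_dominated
    (bound := fun x => Fintype.card (Fin n ⊕ Fin n) * |M| * ‖𝓢.H x *ᵥ h x‖)
    (Eventually.of_forall fun s =>
      (𝓢.integrable_transformIntegrand hab α h s).aestronglyMeasurable) ?_
    (hint.norm.const_mul _) ?_
  · filter_upwards [Metric.ball_mem_nhds t one_pos] with s hs
    filter_upwards [ae_restrict_mem measurableSet_Ioo] with x hx
    refine Matrix.norm_mulVec_le_of_forall_norm_le (abs_nonneg M) (fun i k => ?_) _
    rw [conjTranspose_apply, norm_star]
    refine (hM s ?_ x (Ioo_subset_Icc_self hx) k i).trans (le_abs_self M)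
    rw [Complex.norm_real, Real.norm_eq_abs]
    rw [Metric.mem_ball, Real.dist_eq] at hs
    linarith [abs_sub_abs_le_abs_sub s t]
  · filter_upwards [ae_restrict_mem measurableSet_Ioo] with x hx
    have hc : ∀ k i, Continuous fun s : ℝ => 𝓢.u α x s k i := fun k i =>
      (𝓢.differentiable_matrixSolution_apply hab _ (Ioo_subset_Icc_self hx) k i).continuous.comp
        Complex.continuous_ofReal
    have hc' : Continuous fun s : ℝ => 𝓢.u α x s := continuous_matrix hc
    exact (hc'.matrix_conjTranspose.matrix_mulVec continuous_const).continuousAt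

theorem exists_transform (hab : a ≤ b) {t₀ : ℝ} {R : 𝓢.weight.L2 →L[ℂ] 𝓢.weight.L2}
    (hR : LinearRel.HasCompactResolvent (𝓢.relation α β) t₀ R)
    (e : LinearRel.EigenBasis (𝓢.relation α β)) {c : ∀ t, Fin (e.dim t) → Fin n → ℂ}
    (hc : ∀ t k, e.vec t k = 𝓢.uL2 hab α t (c t k)) {ρ : MatrixMeasure n}
    (hρ : LinearRel.IsDiscrete ρ e c) :
    ∃ U : 𝓢.weight.L2 →ₗ[ℂ] ρ.L2, (∀ h : 𝓢.weight.PreL2, ∃ F : ρ.PreL2,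
      (∀ t, F t = 𝓢.transform α h t) ∧ U (𝓢.weight.toL2 h) = ρ.toL2 F) ∧
      IsSpectralRepresentation (𝓢.relation α β) ρ U := by
  have hinner : ∀ (h : 𝓢.weight.PreL2) t k, star (c t k) ⬝ᵥ 𝓢.transform α h t =
      inner ℂ (e.vec t k) (𝓢.weight.toL2 h) := fun h t k => by
    rw [𝓢.star_dotProduct_transform hab, hc]
  have hmem : ∀ h : 𝓢.weight.PreL2, 𝓢.transform α h ∈ ρ.sqIntegrable := fun h => by
    refine hρ.mem _ (𝓢.continuous_transform hab h).measurable ?_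
    have hcl : IsClosed (LinearRel.multivaluedPart (𝓢.relation α β) : Set 𝓢.weight.L2) := by
      rw [← hR.iSup_eigenspace_orthogonal]
      exact Submodule.isClosed_orthogonal _
    have : CompleteSpace (LinearRel.multivaluedPart (𝓢.relation α β)) := hcl.completeSpace_coe
    obtain ⟨p, hp, q, hq, he⟩ :=
      (LinearRel.multivaluedPart (𝓢.relation α β)).exists_add_mem_mem_orthogonal (𝓢.weight.toL2 h)
    refine (e.hasSum_norm_sq hR hq).summable.congr fun t => Finset.sum_congr rfl fun k _ => ?_
    rw [hinner, he, inner_add_right, Submodule.inner_left_of_mem_orthogonal hp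
      (hR.eigenspace_le_orthogonal t (e.mem t k)), zero_add]
  let T : 𝓢.weight.PreL2 →ₗ[ℂ] ρ.PreL2 :=
    { toFun := fun h => ⟨𝓢.transform α h, hmem h⟩
      map_add' := fun g h => Subtype.ext (𝓢.transform_add hab g h)
      map_smul' := fun r h => Subtype.ext (𝓢.transform_smul r h) }
  have hT : ∀ g h, 𝓢.weight.toL2 g = 𝓢.weight.toL2 h → T g = T h := fun g h hgh =>
    Subtype.ext (𝓢.transform_congr hgh)
  -- Since T depends only on the class, any choice of representatives yields the same map, and
  -- linearity of T passes to it.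
  let s : 𝓢.weight.L2 → 𝓢.weight.PreL2 := Function.surjInv SeparationQuotient.surjective_mk
  have hs : ∀ x, 𝓢.weight.toL2 (s x) = x := Function.surjInv_eq SeparationQuotient.surjective_mk
  let U : 𝓢.weight.L2 →ₗ[ℂ] ρ.L2 :=
    { toFun := fun x => ρ.toL2 (T (s x))
      map_add' := fun x y => by
        have h1 : T (s (x + y)) = T (s x + s y) := hT _ _ (by
          rw [hs]
          exact congrArg₂ (· + ·) (hs x).symm (hs y).symm)
        rw [h1, map_add]
        rfl
      map_smul' := fun r x => by
        have h1 : T (s (r • x)) = T (r • s x) := hT _ _ (by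
          rw [hs]
          exact congrArg (r • ·) (hs x).symm)
        rw [h1, map_smul]
        rfl }
  have hU : ∀ h, U (𝓢.weight.toL2 h) = ρ.toL2 (T h) := fun h =>
    congrArg ρ.toL2 (hT _ _ (hs (𝓢.weight.toL2 h)))
  refine ⟨U, fun h => ⟨T h, fun t => rfl, hU h⟩,
    LinearRel.isSpectralRepresentation hR e hρ fun x => ?_⟩
  refine ⟨T (s x), rfl, fun t k => ?_⟩
  conv_rhs => rw [← hs x]
  exact hinner (s x) t k

end RegularCanonicalSystem

end

/-! ### The main theorem. -/

theorem mainTheorem2 {n : ℕ} {a b : ℝ} (hab : a < b) (𝓢 : RegularCanonicalSystem n a b)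
    (hdef : 𝓢.IsDefinite) (α β : Matrix (Fin n) (Fin n ⊕ Fin n) ℂ)
    (hα : IsBoundaryCondition α) (hβ : IsBoundaryCondition β) :
    (∀ z : ℂ, 0 < z.im → IsUnit (β * 𝓢.u α b z).det) ∧
    (∃ A B ρ, IsHerglotzRepresentation (𝓢.mFunction α β) A B ρ) ∧
    ∀ A B ρ, IsHerglotzRepresentation (𝓢.mFunction α β) A B ρ →
      -- the spectral representation
      (∃ U : 𝓢.weight.L2 →ₗ[ℂ] ρ.L2,
        (∀ h : 𝓢.weight.PreL2,
          (∀ t : ℝ, IntegrableOn (𝓢.transformIntegrand α h t) (Ioo a b)) ∧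
          ∃ F : ρ.PreL2, (∀ t : ℝ, F t = ∫ x in Ioo a b, 𝓢.transformIntegrand α h t x) ∧
            U (𝓢.weight.toL2 h) = ρ.toL2 F) ∧
        IsSpectralRepresentation (𝓢.relation α β) ρ U) ∧
      -- the measure is discrete, carried by the eigenvalues
      (∀ R : ℝ, (LinearRel.eigenvalues (𝓢.relation α β) ∩ Icc (-R) R).Finite) ∧
      ρ.base (LinearRel.eigenvalues (𝓢.relation α β))ᶜ = 0 ∧
      -- the point masses
      ∀ t ∈ LinearRel.eigenvalues (𝓢.relation α β),
        FiniteDimensional ℂ (LinearRel.eigenspace (𝓢.relation α β) t) ∧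
        ∀ (M : ℕ) (φ : Fin M → 𝓢.weight.L2), Orthonormal ℂ φ →
          Submodule.span ℂ (range φ) = LinearRel.eigenspace (𝓢.relation α β) t →
          (∃ c : Fin M → Fin n → ℂ, ∀ k, 𝓢.IsRepresentedBy α t (φ k) (c k)) ∧
          ∀ c : Fin M → Fin n → ℂ, (∀ k, 𝓢.IsRepresentedBy α t (φ k) (c k)) →
            ρ.value {t} = ∑ k, vecMulVec (c k) (star (c k)) := by
  have hab' := hab.le
  have hfin := 𝓢.finite_eigenvalues hab' hdef hα hβ
  have hcount := countable_of_finite_inter_Icc hfin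
  -- The real zeros of the determinant are countable, and ℝ is not.
  obtain ⟨t₀, ht₀⟩ : ∃ t₀ : ℝ, IsUnit (β * 𝓢.u α b t₀).det := by
    have h1 := countable_of_finite_inter_Icc (𝓢.finite_zeros_det hab' hdef hα hβ)
    by_contra! h2
    refine Set.not_countable_univ (h1.mono fun t _ => ?_)
    by_contra h3
    exact h2 t (isUnit_iff_ne_zero.2 h3)
  obtain ⟨R, hR⟩ := 𝓢.exists_hasCompactResolvent hab' hα hβ ht₀
  obtain ⟨e⟩ := hR.nonempty_eigenBasis
  obtain ⟨c, hc⟩ := 𝓢.exists_eigenCoeff hab' hα e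
  obtain ⟨A₀, B₀, ρ₀, hrep₀, hbase₀, hval₀⟩ :=
    𝓢.exists_herglotzRepresentation hab' hdef hα hβ hR e hc
  refine ⟨fun z hz => 𝓢.isUnit_det_of_im_ne_zero hab' hdef hα hβ hz.ne', ⟨A₀, B₀, ρ₀, hrep₀⟩,
    fun A B ρ hrep => ?_⟩
  have hbase := hrep.base_compl_eq_zero hrep₀ (IsClosed.of_finite_inter_Icc hfin) hbase₀
  have hval : ∀ t ∈ LinearRel.eigenvalues (𝓢.relation α β),
      ρ.value {t} = ∑ k, vecMulVec (c t k) (star (c t k)) := fun t ht =>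
    (hrep.value_singleton_eq hrep₀ t).trans (hval₀ t ht)
  obtain ⟨U, hU, hspec⟩ := 𝓢.exists_transform hab' hR e hc
    (ρ.isDiscrete e c hcount hbase hval)
  refine ⟨⟨U, fun h => ⟨fun t => 𝓢.integrable_transformIntegrand hab' α h t, hU h⟩, hspec⟩, hfin,
    hbase, fun t ht => ⟨hR.finiteDimensional_eigenspace t, fun M φ hφ hspan => ?_⟩⟩
  have hφm : ∀ k, φ k ∈ LinearRel.eigenspace (𝓢.relation α β) (t : ℂ) := fun k => by
    rw [← hspan]
    exact Submodule.subset_span ⟨k, rfl⟩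
  refine ⟨?_, fun d hd => ?_⟩
  · have h1 : ∀ k, ∃ d, φ k = 𝓢.uL2 hab' α t d := fun k =>
      let ⟨d, _, hd⟩ := (𝓢.mem_relation_smul_iff hab' hα t _).1 (hφm k)
      ⟨d, hd⟩
    choose d hd using h1
    exact ⟨d, fun k => (𝓢.isRepresentedBy_iff hab').2 (hd k)⟩
  · have hI : (Complex.I).im ≠ 0 := by simp
    rw [hval t ht]
    ext i j
    -- Both matrices are expressed by inner products of eigenvectors with the Weyl solutions at i;
    -- in that form they do not depend on the orthonormal basis.
    rw [← 𝓢.sum_inner_weylL2 hab' hdef hα hβ hI hI (e.mem t) (hc t) i j,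
      ← 𝓢.sum_inner_weylL2 hab' hdef hα hβ hI hI hφm
        (fun k => (𝓢.isRepresentedBy_iff hab').1 (hd k)) i j,
      LinearRel.sum_inner_mul_inner_eq (e.orthonormal t) hφ ((e.span_eq t).trans hspan.symm)]
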